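/- \textbf{Setting.} Quantum polynomial-time (QPT) algorithms are families $\{C_\lambda\}_{\lambda\in\mathbb N}$ of generalized quantum circuits (auxiliary qubits prepared in $|0\rangle$, measurements, and discarding of qubits are allowed) with polynomially many qubits and gates over a fixed universal gate set that consists of $X,H,T,\mathrm{CNOT}$, Toffoli and possibly a set of further single-qubit unitaries. In the classical-accessible random oracle model (CAROM) circuits may also use oracle gates for a uniformly random function $\mathcal O:\{0,1\}^{a(\lambda)}\to\{0,1\}^{b(\lambda)}$; such a gate measures the query register in the computational basis, obtaining $q$, and XORs $\mathcal O(q)$ into the answer register. In the plain model there is no oracle. Probabilities in CAROM are also over $\mathcal O$, which is the same for all algorithms of an experiment. "For large $\lambda$" means for all sufficiently large $\lambda$. Let $\mathcal F=\mathcal F(\lambda)$ be a class of functions $f:X\to Y$ with $X=\{0,1\}^{n(\lambda)}$ and $Y=\{0,1\}^{m(\lambda)}$, each with a classical description $d_f$. A \emph{copy-protection scheme} for $\mathcal F$ is a pair of QPT algorithms $(\mathsf{CP},\mathsf{Eval})$: $\mathsf{CP}(1^\lambda,d_f)$ outputs a mixed state $\rho_f$ on a register $Z$, and $\mathsf{Eval}(1^\lambda,\rho,x)$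 outputs a residual state on $Z$ and a value $y\in Y$. Let $\mathcal D_X$ be a distribution over $X$, $\mathcal D_{\mathcal F}$ a distribution over $\mathcal F$, and $\mathfrak D_X=\{\mathfrak D_X(f)\}_{f\in\mathcal F}$ a class of distributions over $X$ (all depending on $\lambda$). \begin{itemize} \item The scheme is $(\mathcal D_X,\gamma)$-\emph{mean-correct} if for large $\lambda$ and every $f\in\mathcal F$, evaluating $\rho_f\leftarrow\mathsf{CP}(1^\lambda,d_f)$ on $x\leftarrow\mathcal D_X$ outputs $f(x)$ with probability at least $\gamma(\lambda)$. \item A $(\mathcal D_X,\gamma)$-mean-correct scheme is \emph{reusable} if for every polynomially bounded $k=k(\lambda)\ge 0$ there is a negligible function $\mu$ such that for large $\lambda$ and every $f\in\mathcal F$, after $k$ successive evaluations of $\rho_f$ on independent inputs drawn from $\mathcal D_X$, one more evaluation of the residual state on an independent $x\leftarrow\mathcal D_X$ outputs $f(x)$ with probability at least $\gamma(\lambda)-\mu(\lambda)$. \item The scheme is $(\mathcal D_{\mathcal F},\mathfrak D_X,\delta)$-\emph{secure} if every triple $(\mathcal A,\mathcal B,\mathcal C)$ of QPT algorithms (with oracle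 access in CAROM) wins the following game with probability at most $\delta(\lambda)$ for large $\lambda$: $f\leftarrow\mathcal D_{\mathcal F}$ is sampled and $\mathcal A$ receives $\rho_f\leftarrow\mathsf{CP}(1^\lambda,d_f)$ and outputs a bipartite state $\rho_{BC}$; independent $x_B,x_C\leftarrow\mathfrak D_X(f)$ are sampled; $\mathcal B$ receives the $B$ part and $x_B$ and outputs $y_B$, $\mathcal C$ receives the $C$ part and $x_C$ and outputs $y_C$, without communicating; they win if $y_B=f(x_B)$ and $y_C=f(x_C)$. \end{itemize} A function $\varepsilon$ is \emph{noticeable} if $\varepsilon(\lambda)>1/p(\lambda)$ for some polynomial $p$ (positive for large $\lambda$) and all large $\lambda$. \textbf{Lemma.} Let $\delta=\delta(\lambda)$ be a function, let $\mathcal F$, $\mathcal D_{\mathcal F}$, $\mathcal D_X$, $\mathfrak D_X$ be as above, and assume that $\mathcal D_X$ is efficiently samplable, i.e. it is the output distribution of a QPT algorithm without input or oracle. Suppose there exists a reusable copy-protection scheme in CAROM for $\mathcal F$ with $(\mathcal D_X,1-\nu)$-mean-correctness for some negligible $\nu$, and with $(\mathcal D_{\mathcal F},\mathfrak D_X,\delta)$-security.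 Then for every noticeable function $\varepsilon$ there exists a copy-protection scheme for $\mathcal F$ in the plain model with $(\mathcal D_X,1-\varepsilon)$-mean-correctness and $(\mathcal D_{\mathcal F},\mathfrak D_X,\delta)$-security. -/

import Mathlib

/-! ### States on registers of qubits -/

/-- Bit strings of length `n`. -/
abbrev BitStr (n : ℕ) : Type := Fin n → Bool

/-- Operators on the Hilbert space of a register whose qubits are labelled by `I`, written as
matrices in the computational basis. Density operators are elements of this type. -/
abbrev Op (I : Type) : Type := Matrix (I → Bool) (I → Bool) ℂ

/-- The basis state `|x⟩⟨x|`. -/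
def ketbra {I : Type} [Fintype I] (x : I → Bool) : Op I :=
  fun s t => if s = x ∧ t = x then 1 else 0

/-- `ρ ⊗ |x⟩⟨x|`. -/
def attach {I J : Type} [Fintype J] (ρ : Op I) (x : J → Bool) : Op (I ⊕ J) :=
  fun s t =>
    if (fun j => s (Sum.inr j)) = x ∧ (fun j => t (Sum.inr j)) = x then
      ρ (fun i => s (Sum.inl i)) (fun i => t (Sum.inl i))
    else 0

/-- Relabelling of the qubits of a register. -/
def relabel {I J : Type} (e : I ≃ J) (ρ : Op I) : Op J :=
  fun s t => ρ (fun i => s (e i)) (fun i => t (e i))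

/-- Partial trace over the second register. -/
def traceRight {I J : Type} [Fintype J] [DecidableEq J] (ρ : Op (I ⊕ J)) : Op I :=
  fun s t => ∑ u : J → Bool, ρ (Sum.elim s u) (Sum.elim t u)

/-- The probability that measuring a register in the computational basis yields `y`. -/
def outcomeProb {I : Type} (ρ : Op I) (y : I → Bool) : ℝ := (ρ y y).re

/-- The probability that measuring the second register yields `y`. -/
def outcomeProbRight {I J : Type} [Fintype I] [DecidableEq I] (ρ : Op (I ⊕ J))
    (y : J → Bool) : ℝ :=
  ∑ s : I → Bool, (ρ (Sum.elim s y) (Sum.elim s y)).re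

/-- Place the qubits of `I` on the wires `inp i`; all other wires start in `|0⟩`. -/
def load {I W : Type} [Fintype I] [Fintype W] [DecidableEq W] (inp : I ↪ W) (ρ : Op I) : Op W :=
  fun s t =>
    if ∀ w, (∀ i, inp i ≠ w) → s w = false ∧ t w = false then
      ρ (fun i => s (inp i)) (fun i => t (inp i))
    else 0

/-- Keep the wires `out j` and trace out all other wires. (`Function.extend out t u` is the
assignment that equals `t` on the wires kept and `u` on the others.) -/
noncomputable def keep {J W : Type} [Fintype J] [Fintype W] [DecidableEq W] (out : J ↪ W)
    (ρ : Op W) : Op J :=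
  fun s t => ∑ u : W → Bool,
    if (fun j => u (out j)) = s then ρ u (Function.extend out t u) else 0

/-! ### Quantum circuits with classical-accessible oracle gates -/

/-- A classical oracle with queries of `a` bits and answers of `b` bits. -/
abbrev Oracle (a b : ℕ) : Type := BitStr a → BitStr b

/-- The gates: Pauli `X`, Hadamard `H`, the `π/8` gate `T`, `CNOT`, Toffoli, single-qubit
unitaries from a fixed further set `𝒢`, computational-basis measurement of one wire, and one
oracle query (query wires `e (inl _)`, answer wires `e (inr _)`). -/
inductive Gate (𝒢 : Set (Matrix.unitaryGroup Bool ℂ)) (a b : ℕ) (W : Type) : Type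
  | x (i : W)
  | h (i : W)
  | t (i : W)
  | cnot (c i : W) (hc : c ≠ i)
  | toffoli (c d i : W) (hcd : c ≠ d) (hc : c ≠ i) (hd : d ≠ i)
  | single (U : Matrix.unitaryGroup Bool ℂ) (hU : U ∈ 𝒢) (i : W)
  | measure (i : W)
  | query (e : Fin a ⊕ Fin b ↪ W)

/-- The Pauli matrix `X`. -/
def matX : Matrix Bool Bool ℂ := fun p q => if p = q then 0 else 1

/-- The Hadamard matrix. -/
noncomputable def matH : Matrix Bool Bool ℂ :=
  fun p q => (if p && q then -1 else 1) / (Real.sqrt 2 : ℂ)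

/-- The matrix of the `T` gate. -/
noncomputable def matT : Matrix Bool Bool ℂ :=
  Matrix.diagonal fun p => if p then Complex.exp (Real.pi * Complex.I / 4) else 1

/-- The single-qubit operator `U` on wire `i`, tensored with the identity on all other wires. -/
def onWire {W : Type} [Fintype W] [DecidableEq W] (U : Matrix Bool Bool ℂ) (i : W) : Op W :=
  fun s t => if ∀ w, w ≠ i → s w = t w then U (s i) (t i) else 0

/-- The operator `|t⟩ ↦ |f t⟩`. -/
def basisMap {W : Type} [Fintype W] (f : (W → Bool) → (W → Bool)) : Op W :=
  fun s t => if s = f t then 1 else 0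

/-- `ρ ↦ U ρ U†`. -/
def conjBy {W : Type} [Fintype W] [DecidableEq W] (U ρ : Op W) : Op W :=
  U * ρ * U.conjTranspose

/-- XOR the oracle's answer into the answer wires. -/
noncomputable def xorAnswer {a b : ℕ} {W : Type} (𝓞 : Oracle a b) (e : Fin a ⊕ Fin b ↪ W)
    (t : W → Bool) : W → Bool :=
  Function.extend (fun k => e (Sum.inr k))
    (fun k => xor (t (e (Sum.inr k))) (𝓞 (fun q => t (e (Sum.inl q))) k)) t

namespace Gate

variable {𝒢 : Set (Matrix.unitaryGroup Bool ℂ)} {a b : ℕ} {W : Type}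

/-- The action of a gate on states. A query first measures the query wires in the computational
basis and then XORs the oracle's answer into the answer wires. -/
noncomputable def apply [Fintype W] [DecidableEq W] (𝓞 : Oracle a b) :
    Gate 𝒢 a b W → Op W → Op W
  | x i, ρ => conjBy (onWire matX i) ρ
  | h i, ρ => conjBy (onWire matH i) ρ
  | t i, ρ => conjBy (onWire matT i) ρ
  | cnot c i _, ρ => conjBy (basisMap fun s => Function.update s i (xor (s i) (s c))) ρ
  | toffoli c d i _ _ _, ρ =>
      conjBy (basisMap fun s => Function.update s i (xor (s i) (s c && s d))) ρ
  | single U _ i, ρ => conjBy (onWire (U : Matrix Bool Bool ℂ) i) ρ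
  | measure i, ρ => fun s t => if s i = t i then ρ s t else 0
  | query e, ρ => conjBy (basisMap (xorAnswer 𝓞 e))
      (fun s t => if ∀ q, s (e (Sum.inl q)) = t (e (Sum.inl q)) then ρ s t else 0)

/-- The same gate on a larger set of wires. -/
def map {V : Type} (f : W ↪ V) : Gate 𝒢 a b W → Gate 𝒢 a b V
  | x i => x (f i)
  | h i => h (f i)
  | t i => t (f i)
  | cnot c i hc => cnot (f c) (f i) (f.injective.ne hc)
  | toffoli c d i hcd hc hd =>
      toffoli (f c) (f d) (f i) (f.injective.ne hcd) (f.injective.ne hc) (f.injective.ne hd)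
  | single U hU i => single U hU (f i)
  | measure i => measure (f i)
  | query e => query (e.trans f)

/-- If queries and answers have length zero, a query does nothing. This is why the plain model
below can be taken to be the oracle model with an oracle of lengths `0` and `0`. -/
theorem apply_query_zero [Fintype W] [DecidableEq W] (𝓞 : Oracle 0 0)
    (e : Fin 0 ⊕ Fin 0 ↪ W) (ρ : Op W) :
    apply 𝓞 (query e : Gate 𝒢 0 0 W) ρ = ρ := by
  have h1 : xorAnswer 𝓞 e = id := by
    funext t w
    unfold xorAnswer
    rw [Function.extend_apply']
    · rfl
    · rintro ⟨k, _⟩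
      exact k.elim0
  have h2 : basisMap (xorAnswer 𝓞 e) = (1 : Op W) := by
    funext s t
    rw [h1]
    simp [basisMap, Matrix.one_apply]
  have h3 : (fun s t => if ∀ q : Fin 0, s (e (Sum.inl q)) = t (e (Sum.inl q)) then ρ s t else 0)
      = ρ := by
    funext s t
    exact if_pos fun q => q.elim0
  simp only [apply, conjBy, h2, h3, Matrix.one_mul, Matrix.conjTranspose_one, Matrix.mul_one]

end Gate

/-- A (generalized) quantum circuit from register `I` to register `J`: finitely many wires, the
input being placed on the wires `inp` and all other wires prepared in `|0⟩`, then a sequence of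
gates, after which the wires `out` are kept and all others are discarded. -/
structure Circuit (𝒢 : Set (Matrix.unitaryGroup Bool ℂ)) (a b : ℕ) (I J : Type) where
  Wire : Type
  fintypeWire : Fintype Wire
  decEqWire : DecidableEq Wire
  inp : I ↪ Wire
  out : J ↪ Wire
  gates : List (Gate 𝒢 a b Wire)

attribute [instance] Circuit.fintypeWire Circuit.decEqWire

namespace Circuit

variable {𝒢 : Set (Matrix.unitaryGroup Bool ℂ)} {a b : ℕ} {I J I₁ J₁ : Type}

/-- Number of qubits plus number of gates. -/
def size (C : Circuit 𝒢 a b I J) : ℕ := Fintype.card C.Wire + C.gates.length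

/-- The quantum operation computed by a circuit relative to the oracle `𝓞`. -/
noncomputable def run [Fintype I] [Fintype J] (C : Circuit 𝒢 a b I J) (𝓞 : Oracle a b)
    (ρ : Op I) : Op J :=
  keep C.out (C.gates.foldl (fun σ g => g.apply 𝓞 σ) (load C.inp ρ))

/-- Two circuits side by side, on disjoint wires. -/
def par (C : Circuit 𝒢 a b I J) (D : Circuit 𝒢 a b I₁ J₁) : Circuit 𝒢 a b (I ⊕ I₁) (J ⊕ J₁) where
  Wire := C.Wire ⊕ D.Wire
  fintypeWire := inferInstance
  decEqWire := inferInstance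
  inp := C.inp.sumMap D.inp
  out := C.out.sumMap D.out
  gates := C.gates.map (Gate.map Function.Embedding.inl) ++
    D.gates.map (Gate.map Function.Embedding.inr)

end Circuit

/-! ### Asymptotics -/

/-- Bounded by a polynomial in the security parameter. -/
def PolyBounded (s : ℕ → ℕ) : Prop := ∃ p : Polynomial ℕ, ∀ n, s n ≤ p.eval n

/-- Negligible: eventually smaller than every inverse polynomial. -/
def Negligible (ν : ℕ → ℝ) : Prop :=
  Asymptotics.SuperpolynomialDecay Filter.atTop (fun n : ℕ => (n : ℝ)) ν

/-- Noticeable: eventually larger than some inverse polynomial. -/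
def Noticeable (ε : ℕ → ℝ) : Prop :=
  ∃ p : Polynomial ℕ, ∀ᶠ n in Filter.atTop, 0 < p.eval n ∧ 1 / ((p.eval n : ℕ) : ℝ) < ε n

/-- A quantum polynomial-time algorithm is a family of circuits, indexed by the security
parameter, with polynomially many qubits and gates. -/
def QPT {𝒢 : Set (Matrix.unitaryGroup Bool ℂ)} {a b : ℕ → ℕ} {I J : ℕ → Type}
    (C : ∀ n, Circuit 𝒢 (a n) (b n) (I n) (J n)) : Prop :=
  PolyBounded fun n => (C n).size

/-- The average of `g` over a uniformly random oracle. -/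
noncomputable def oracleAvg {a b : ℕ} (g : Oracle a b → ℝ) : ℝ :=
  (∑ 𝓞 : Oracle a b, g 𝓞) / Fintype.card (Oracle a b)

/-- A family of distributions on bit strings is efficiently samplable if a quantum
polynomial-time algorithm without input (and without oracle) outputs a sample of it. -/
def EfficientlySamplable (𝒢 : Set (Matrix.unitaryGroup Bool ℂ)) {ℓ : ℕ → ℕ}
    (D : ∀ n, PMF (BitStr (ℓ n))) : Prop :=
  ∃ C : ∀ n, Circuit 𝒢 0 0 (Fin 0) (Fin (ℓ n)),
    QPT (a := fun _ => 0) (b := fun _ => 0) C ∧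
    ∀ n (x : BitStr (ℓ n)),
      outcomeProb ((C n).run id (ketbra Fin.elim0)) x = (D n x).toReal

/-! ### Copy-protection -/

/-- A class of functions `f : {0,1}^inLen → {0,1}^outLen` for every value of the security
parameter, each member `f` with a classical description `d_f`. -/
structure FunctionClass where
  inLen : ℕ → ℕ
  outLen : ℕ → ℕ
  descLen : ℕ → ℕ
  Member : ℕ → Type
  fintypeMember : ∀ n, Fintype (Member n)
  toFun : ∀ n, Member n → BitStr (inLen n) → BitStr (outLen n)
  desc : ∀ n, Member n → BitStr (descLen n)

attribute [instance] FunctionClass.fintypeMember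

/-- A copy-protection scheme `(CP, Eval)` for `F` in the classical-accessible random oracle model,
the oracle having queries of `a n` bits and answers of `b n` bits. The copy-protected state lives
on the register `Z n`. -/
structure Scheme (𝒢 : Set (Matrix.unitaryGroup Bool ℂ)) (F : FunctionClass) (a b : ℕ → ℕ) where
  Z : ℕ → Type
  fintypeZ : ∀ n, Fintype (Z n)
  decEqZ : ∀ n, DecidableEq (Z n)
  cp : ∀ n, Circuit 𝒢 (a n) (b n) (Fin (F.descLen n)) (Z n)
  eval : ∀ n, Circuit 𝒢 (a n) (b n) (Z n ⊕ Fin (F.inLen n)) (Z n ⊕ Fin (F.outLen n))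
  cp_qpt : QPT cp
  eval_qpt : QPT eval

attribute [instance] Scheme.fintypeZ Scheme.decEqZ

/-- A copy-protection scheme in the plain model: the oracle is trivial. -/
abbrev PlainScheme (𝒢 : Set (Matrix.unitaryGroup Bool ℂ)) (F : FunctionClass) : Type 1 :=
  Scheme 𝒢 F (fun _ => 0) (fun _ => 0)

/-- An adversary `(A, B, C)` for the piracy experiment: all three are quantum polynomial-time
algorithms with oracle access; `A` splits the program into registers `RB` and `RC`. -/
structure Adversary {𝒢 : Set (Matrix.unitaryGroup Bool ℂ)} {F : FunctionClass} {a b : ℕ → ℕ}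
    (S : Scheme 𝒢 F a b) where
  RB : ℕ → Type
  RC : ℕ → Type
  fintypeRB : ∀ n, Fintype (RB n)
  fintypeRC : ∀ n, Fintype (RC n)
  alice : ∀ n, Circuit 𝒢 (a n) (b n) (S.Z n) (RB n ⊕ RC n)
  bob : ∀ n, Circuit 𝒢 (a n) (b n) (RB n ⊕ Fin (F.inLen n)) (Fin (F.outLen n))
  charlie : ∀ n, Circuit 𝒢 (a n) (b n) (RC n ⊕ Fin (F.inLen n)) (Fin (F.outLen n))
  alice_qpt : QPT alice
  bob_qpt : QPT bob
  charlie_qpt : QPT charlie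

attribute [instance] Adversary.fintypeRB Adversary.fintypeRC

namespace Scheme

variable {𝒢 : Set (Matrix.unitaryGroup Bool ℂ)} {F : FunctionClass} {a b : ℕ → ℕ}

/-- The program `ρ_f ← CP(1ⁿ, d_f)` after `k` evaluations on independent inputs drawn from `D`,
as a mixed state, for a fixed oracle. -/
noncomputable def stateAfter (S : Scheme 𝒢 F a b) {n : ℕ} (D : PMF (BitStr (F.inLen n)))
    (f : F.Member n) (𝓞 : Oracle (a n) (b n)) : ℕ → Op (S.Z n)
  | 0 => (S.cp n).run 𝓞 (ketbra (F.desc n f))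
  | k + 1 => ∑ x : BitStr (F.inLen n), ((D x).toReal : ℂ) •
      traceRight ((S.eval n).run 𝓞 (attach (S.stateAfter D f 𝓞 k) x))

/-- The probability, also over the random oracle, that `Eval` outputs `f(x)` for an input `x`
drawn from `D` after `k` earlier evaluations on independent inputs drawn from `D`. -/
noncomputable def successProb (S : Scheme 𝒢 F a b) {n : ℕ} (D : PMF (BitStr (F.inLen n)))
    (f : F.Member n) (k : ℕ) : ℝ :=
  oracleAvg fun 𝓞 => ∑ x : BitStr (F.inLen n), (D x).toReal *
    outcomeProbRight ((S.eval n).run 𝓞 (attach (S.stateAfter D f 𝓞 k) x)) (F.toFun n f x)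

/-- `(D, γ)`-mean-correctness. -/
def MeanCorrect (S : Scheme 𝒢 F a b) (D : ∀ n, PMF (BitStr (F.inLen n))) (γ : ℕ → ℝ) : Prop :=
  ∀ᶠ n in Filter.atTop, ∀ f : F.Member n, γ n ≤ S.successProb (D n) f 0

/-- Reusability of a `(D, γ)`-mean-correct scheme: the `(k + 1)`-st evaluation is correct with
probability at least `γ - negl`, for every polynomially bounded `k`. -/
def Reusable (S : Scheme 𝒢 F a b) (D : ∀ n, PMF (BitStr (F.inLen n))) (γ : ℕ → ℝ) : Prop :=
  ∀ k : ℕ → ℕ, PolyBounded k → ∃ μ : ℕ → ℝ, Negligible μ ∧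
    ∀ᶠ n in Filter.atTop, ∀ f : F.Member n, γ n - μ n ≤ S.successProb (D n) f (k n)

/-- The joint output state of `B` and `C` on challenges `xB`, `xC`, for a fixed oracle. -/
noncomputable def pirateOutput (S : Scheme 𝒢 F a b) (A : Adversary S) {n : ℕ} (f : F.Member n)
    (xB xC : BitStr (F.inLen n)) (𝓞 : Oracle (a n) (b n)) :
    Op (Fin (F.outLen n) ⊕ Fin (F.outLen n)) :=
  ((A.bob n).par (A.charlie n)).run 𝓞
    (relabel (Equiv.sumSumSumComm (A.RB n) (A.RC n) (Fin (F.inLen n)) (Fin (F.inLen n)))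
      (attach ((A.alice n).run 𝓞 ((S.cp n).run 𝓞 (ketbra (F.desc n f)))) (Sum.elim xB xC)))

/-- The probability that the piracy experiment outputs `1`. -/
noncomputable def pirateProb (S : Scheme 𝒢 F a b) (A : Adversary S) {n : ℕ}
    (DF : PMF (F.Member n)) (DC : F.Member n → PMF (BitStr (F.inLen n))) : ℝ :=
  oracleAvg fun 𝓞 => ∑ f : F.Member n, (DF f).toReal *
    ∑ xB : BitStr (F.inLen n), ∑ xC : BitStr (F.inLen n),
      (DC f xB).toReal * (DC f xC).toReal *
        outcomeProb (S.pirateOutput A f xB xC 𝓞) (Sum.elim (F.toFun n f xB) (F.toFun n f xC))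

/-- `(DF, DC, δ)`-security. -/
def Secure (S : Scheme 𝒢 F a b) (DF : ∀ n, PMF (F.Member n))
    (DC : ∀ n, F.Member n → PMF (BitStr (F.inLen n))) (δ : ℕ → ℝ) : Prop :=
  ∀ A : Adversary S, ∀ᶠ n in Filter.atTop, S.pirateProb A (DF n) (DC n) ≤ δ n

end Scheme

/-! The oracle is removed by shipping with the program the answers that later evaluations are likely
to need, and by withholding the queries that `CP` itself made.

The plain program is prepared thus. `CP` runs with a lazily sampled oracle, which leaves records
`d₁`. A number `i` is drawn uniformly below a polynomially large `2 ^ m`, and `i` evaluations are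
run on inputs from `DX`, with answers consistent with `d₁`. Every query of these evaluations enters
a second list `d`, including those answered from `d₁`. Then `d₁` is erased; the residual state and
`d` are the program. The plain evaluation answers a query from `d`, and at random if `d` has no
entry for it.

Security. Whoever holds the original program and the true oracle can make the plain program: run the
`i` evaluations with real queries and note them down. A lazily sampled oracle is distributed like
one sampled in advance (`avg_lookup`, `runE_lazy`), so after averaging over the oracle both
constructions give the same state (`circE_iterate_roundE_lazy`). A plain adversary makes no queries,
hence its winning probability is the mean over `i` of winning probabilities of adversaries against
the original scheme (`plain_pirate`). Algorithms are nonuniform, so the best `i` for each parameter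
gives one legitimate adversary, and `δ` is kept without loss.

Correctness. Erasing `d₁` changes an evaluation only if it queries a point of `d₁` that is not yet
in `d`. Such a query increases the potential `hits d₁ d`, so the loss of one evaluation is at most
the expected increase of the potential (`runE_lazy_le`). An evaluation after `i` rounds with full
records is itself the next round, so over `i = 0, …, 2 ^ m - 1` the increases telescope, to at most
the length of `d₁` and hence the size of `CP` (`sum_evalE_lazy_le`). The mean loss is therefore at
most this size divided by `2 ^ m`. Evaluations with full records are those of the original scheme
(`Scheme.successProb_eq`), which reusability controls; applied to the worst index for each
parameter, it controls all `i` with one negligible error.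

Classical access makes this work: a query gate measures its query wires anyway, so recording the
query does not disturb the computation (`runE_real`). The rest realises the recorded executions by
circuits of polynomial size (`exists_lazy_answerer`, `run_recGates`, `exists_plain_cp`,
`exists_plain_eval`, `exists_real_rounds`). The query and answer lengths need not be polynomially
bounded; but a single query gate occupies `a + b` wires, and a scheme without queries needs no
database. -/

set_option linter.unusedSectionVars false

/-! ### Basis operators and tensor products -/

open Classical in
/-- The operator `|s⟩⟨t|`. -/
noncomputable def bk {I : Type} (s t : I → Bool) : Op I :=
  fun u v => if u = s ∧ v = t then 1 else 0

theorem bk_of_eq {I : Type} {s t u v : I → Bool} (h : u = s ∧ v = t) : bk s t u v = 1 := if_pos h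

theorem bk_of_ne {I : Type} {s t u v : I → Bool} (h : ¬(u = s ∧ v = t)) : bk s t u v = 0 := if_neg h

theorem ketbra_eq_bk {I : Type} [Fintype I] (x : I → Bool) : ketbra x = bk x x := by
  funext s t
  simp [ketbra, bk]

/-- Matrix units span all operators. The off-diagonal ones cannot be omitted: basis states alone do
not detect coherences. -/
theorem op_linearMap_ext {I M : Type} [Finite I] [AddCommMonoid M] [Module ℂ M]
    {L L' : Op I →ₗ[ℂ] M} (h : ∀ s t, L (bk s t) = L' (bk s t)) : L = L' := by
  classical
  have := Fintype.ofFinite I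
  refine LinearMap.ext fun ρ => ?_
  rw [Matrix.matrix_eq_sum_single ρ]
  simp only [map_sum]
  refine Finset.sum_congr rfl fun s _ => Finset.sum_congr rfl fun t _ => ?_
  have : Matrix.single s t (ρ s t) = ρ s t • bk s t := by
    funext u v
    simp only [Matrix.single, bk, Matrix.smul_apply, Matrix.of_apply, smul_eq_mul]
    by_cases h1 : s = u <;> by_cases h2 : t = v <;> simp [h1, h2, eq_comm]
  rw [this, map_smul, map_smul, h]

/-- The tensor product of operators. -/
def kron {I J : Type} (ρ : Op I) (σ : Op J) : Op (I ⊕ J) :=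
  fun s t => ρ (fun i => s (Sum.inl i)) (fun i => t (Sum.inl i)) *
    σ (fun j => s (Sum.inr j)) (fun j => t (Sum.inr j))

/-- The tensor product as a bilinear map. -/
def kronB (I J : Type) : Op I →ₗ[ℂ] Op J →ₗ[ℂ] Op (I ⊕ J) :=
  LinearMap.mk₂ ℂ kron
    (fun _ _ _ => by funext s t; simp [kron, add_mul])
    (fun _ _ _ => by funext s t; simp [kron, mul_assoc])
    (fun _ _ _ => by funext s t; simp [kron, mul_add])
    (fun _ _ _ => by funext s t; simp [kron, mul_left_comm])

@[simp] theorem kronB_apply {I J : Type} (ρ : Op I) (σ : Op J) : kronB I J ρ σ = kron ρ σ := rfl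

theorem kron_sum_left {I J ι : Type} (S : Finset ι) (f : ι → Op I) (σ : Op J) :
    kron (∑ i ∈ S, f i) σ = ∑ i ∈ S, kron (f i) σ := by
  exact (congrArg (fun L => L σ) (map_sum (kronB I J) f S)).trans
    (LinearMap.sum_apply S (fun i => kronB I J (f i)) σ)

theorem kron_sum_right {I J ι : Type} (S : Finset ι) (ρ : Op I) (f : ι → Op J) :
    kron ρ (∑ i ∈ S, f i) = ∑ i ∈ S, kron ρ (f i) := by
  exact map_sum (kronB I J ρ) f S

theorem kron_smul_left {I J : Type} (c : ℂ) (ρ : Op I) (σ : Op J) :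
    kron (c • ρ) σ = c • kron ρ σ := by
  exact congrArg (fun L => L σ) (map_smul (kronB I J) c ρ)

theorem kron_smul_right {I J : Type} (c : ℂ) (ρ : Op I) (σ : Op J) :
    kron ρ (c • σ) = c • kron ρ σ := by
  exact map_smul (kronB I J ρ) c σ

@[simp] theorem kron_zero_left {I J : Type} (σ : Op J) : kron (0 : Op I) σ = 0 := by
  funext s t; simp [kron]

@[simp] theorem kron_zero_right {I J : Type} (ρ : Op I) : kron ρ (0 : Op J) = 0 := by
  funext s t; simp [kron]

theorem sum_fun_ext {I J A : Type} {s : I ⊕ J → A} {u : I → A} {v : J → A} :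
    s = Sum.elim u v ↔ (fun i => s (Sum.inl i)) = u ∧ (fun j => s (Sum.inr j)) = v := by
  constructor
  · rintro rfl; exact ⟨rfl, rfl⟩
  · rintro ⟨rfl, rfl⟩; funext w; cases w <;> rfl

theorem kron_bk {I J : Type} (s t : I → Bool) (s' t' : J → Bool) :
    kron (bk s t) (bk s' t') = bk (Sum.elim s s') (Sum.elim t t') := by
  funext u v
  have h1 := sum_fun_ext (s := u) (u := s) (v := s')
  have h2 := sum_fun_ext (s := v) (u := t) (v := t')
  by_cases h : u = Sum.elim s s' ∧ v = Sum.elim t t'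
  · rw [bk_of_eq h, kron, bk_of_eq ⟨(h1.1 h.1).1, (h2.1 h.2).1⟩,
      bk_of_eq ⟨(h1.1 h.1).2, (h2.1 h.2).2⟩, one_mul]
  · rw [bk_of_ne h, kron]
    by_cases h' : (fun i => u (Sum.inl i)) = s ∧ (fun i => v (Sum.inl i)) = t
    · rw [bk_of_ne (s := s'), mul_zero]
      exact fun h'' => h ⟨h1.2 ⟨h'.1, h''.1⟩, h2.2 ⟨h'.2, h''.2⟩⟩
    · rw [bk_of_ne h', zero_mul]

theorem bk_eq_kron {I J : Type} (s t : I ⊕ J → Bool) :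
    bk s t = kron (bk (fun i => s (Sum.inl i)) (fun i => t (Sum.inl i)))
      (bk (fun i => s (Sum.inr i)) (fun i => t (Sum.inr i))) := by
  rw [kron_bk]
  congr 1 <;> funext w <;> cases w <;> rfl

theorem kron_ketbra {I J : Type} [Fintype I] [Fintype J] (s : I → Bool) (s' : J → Bool) :
    kron (ketbra s) (ketbra s') = ketbra (Sum.elim s s') := by
  simp only [ketbra_eq_bk, kron_bk]

/-- Every matrix unit of a joint register factors, so product operators span. Identities for
circuits side by side therefore need no treatment of entangled states. -/
theorem op_sum_linearMap_ext {I J M : Type} [Finite I] [Finite J] [AddCommMonoid M] [Module ℂ M]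
    {L L' : Op (I ⊕ J) →ₗ[ℂ] M} (h : ∀ ρ σ, L (kron ρ σ) = L' (kron ρ σ)) : L = L' :=
  op_linearMap_ext fun s t => by rw [bk_eq_kron]; exact h _ _

theorem attach_eq_kron {I J : Type} [Fintype J] (ρ : Op I) (x : J → Bool) :
    attach ρ x = kron ρ (ketbra x) := by
  funext s t
  simp only [attach, kron, ketbra]
  split_ifs <;> simp_all

/-! ### Loading, keeping and relabelling as linear maps -/

theorem load_add {I W : Type} [Fintype I] [Fintype W] [DecidableEq W] (f : I ↪ W) (ρ σ : Op I) :
    load f (ρ + σ) = load f ρ + load f σ := by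
  funext s t
  simp only [load, Matrix.add_apply]
  split_ifs <;> simp

theorem load_smul {I W : Type} [Fintype I] [Fintype W] [DecidableEq W] (f : I ↪ W) (c : ℂ)
    (ρ : Op I) : load f (c • ρ) = c • load f ρ := by
  funext s t
  simp only [load, Matrix.smul_apply]
  split_ifs <;> simp

/-- `load` as a linear map. -/
def loadL {I W : Type} [Fintype I] [Fintype W] [DecidableEq W] (f : I ↪ W) :
    Op I →ₗ[ℂ] Op W where
  toFun := load f
  map_add' := load_add f
  map_smul' := load_smul f

/-- `keep` as a linear map. -/
noncomputable def keepL {J W : Type} [Fintype J] [Fintype W] [DecidableEq W] (f : J ↪ W) :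
    Op W →ₗ[ℂ] Op J where
  toFun := keep f
  map_add' ρ σ := by
    funext s t
    simp only [keep, Matrix.add_apply, ← Finset.sum_add_distrib]
    refine Finset.sum_congr rfl fun u _ => ?_
    split_ifs <;> simp
  map_smul' c ρ := by
    funext s t
    simp only [keep, Matrix.smul_apply, RingHom.id_apply, smul_eq_mul, Finset.mul_sum]
    refine Finset.sum_congr rfl fun u _ => ?_
    split_ifs <;> simp

/-- `relabel` as a linear map. -/
def relabelL {I J : Type} (e : I ≃ J) : Op I →ₗ[ℂ] Op J where
  toFun := relabel e
  map_add' _ _ := rfl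
  map_smul' _ _ := rfl

/-- `traceRight` as a linear map. -/
def traceRightL {I J : Type} [Fintype J] [DecidableEq J] : Op (I ⊕ J) →ₗ[ℂ] Op I where
  toFun := traceRight
  map_add' ρ σ := by
    funext s t
    simp only [traceRight, Matrix.add_apply, Finset.sum_add_distrib]
  map_smul' c ρ := by
    funext s t
    simp only [traceRight, Matrix.smul_apply, RingHom.id_apply, smul_eq_mul, Finset.mul_sum]

/-- The assignment `s` on the image of `f`, and `false` elsewhere. -/
noncomputable def ext0 {I W : Type} (f : I ↪ W) (s : I → Bool) : W → Bool :=
  Function.extend f s fun _ => false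

@[simp] theorem extend_emb_apply {I W A : Type} (f : I ↪ W) (s : I → A) (u : W → A) (i : I) :
    Function.extend f s u (f i) = s i := f.injective.extend_apply s u i

theorem extend_emb_of_notMem {I W A : Type} (f : I ↪ W) (s : I → A) (u : W → A) {w : W}
    (h : ∀ i, f i ≠ w) : Function.extend f s u w = u w :=
  Function.extend_apply' _ _ _ (by rintro ⟨i, hi⟩; exact h i hi)

@[simp] theorem ext0_apply {I W : Type} (f : I ↪ W) (s : I → Bool) (i : I) :
    ext0 f s (f i) = s i := extend_emb_apply f s _ i

theorem ext0_of_notMem {I W : Type} (f : I ↪ W) (s : I → Bool) {w : W}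
    (h : ∀ i, f i ≠ w) : ext0 f s w = false := extend_emb_of_notMem f s _ h

/-- Identities between assignments of wires are reduced by this to one check on the image of the
embedding and one off it. -/
theorem eq_extend_iff {I W A : Type} (f : I ↪ W) (s : W → A) (x : I → A) (u : W → A) :
    s = Function.extend f x u ↔ (fun i => s (f i)) = x ∧ ∀ w, (∀ i, f i ≠ w) → s w = u w := by
  constructor
  · rintro rfl
    exact ⟨by funext i; simp, fun w hw => extend_emb_of_notMem f x u hw⟩
  · rintro ⟨rfl, h⟩
    funext w
    by_cases hw : ∃ i, f i = w
    · obtain ⟨i, rfl⟩ := hw; simp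
    · rw [extend_emb_of_notMem f _ u (by simpa using hw)]
      exact h w (by simpa using hw)

theorem load_bk {I W : Type} [Fintype I] [Fintype W] [DecidableEq W] (f : I ↪ W)
    (s t : I → Bool) : load f (bk s t) = bk (ext0 f s) (ext0 f t) := by
  funext u v
  have hu := eq_extend_iff f u s fun _ => false
  have hv := eq_extend_iff f v t fun _ => false
  rw [load]
  by_cases h : u = ext0 f s ∧ v = ext0 f t
  · rw [bk_of_eq h, if_pos fun w hw => ⟨(hu.1 h.1).2 w hw, (hv.1 h.2).2 w hw⟩,
      bk_of_eq ⟨(hu.1 h.1).1, (hv.1 h.2).1⟩]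
  · rw [bk_of_ne h]
    split_ifs with h1
    · exact bk_of_ne fun h2 => h ⟨hu.2 ⟨h2.1, fun w hw => (h1 w hw).1⟩,
        hv.2 ⟨h2.2, fun w hw => (h1 w hw).2⟩⟩
    · rfl

-- A partial trace destroys the coherence between strings that differ on a discarded wire; this is
-- the source of the zero.
open Classical in
theorem keep_bk {J W : Type} [Fintype J] [Fintype W] [DecidableEq W] (f : J ↪ W)
    (s t : W → Bool) : keep f (bk s t) =
      if ∀ w, (∀ j, f j ≠ w) → s w = t w then bk (fun j => s (f j)) (fun j => t (f j)) else 0 := by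
  funext u v
  simp only [keep]
  rw [Finset.sum_eq_single s]
  · have hx : (Function.extend f v s = t) ↔ (v = fun j => t (f j)) ∧
        ∀ w, (∀ j, f j ≠ w) → s w = t w := by
      rw [eq_comm, eq_extend_iff]
      simp only [eq_comm]
    have hb : bk s t s (Function.extend f v s) =
        if (v = fun j => t (f j)) ∧ ∀ w, (∀ j, f j ≠ w) → s w = t w then 1 else 0 := by
      split_ifs with h
      · exact bk_of_eq ⟨rfl, hx.2 h⟩
      · exact bk_of_ne fun h' => h (hx.1 h'.2)
    rw [hb]
    by_cases h : ∀ w, (∀ j, f j ≠ w) → s w = t w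
    · rw [if_pos h]
      by_cases h1 : (fun j => s (f j)) = u ∧ v = fun j => t (f j)
      · rw [bk_of_eq ⟨h1.1.symm, h1.2⟩, if_pos h1.1, if_pos ⟨h1.2, h⟩]
      · rw [bk_of_ne fun h' => h1 ⟨h'.1.symm, h'.2⟩]
        split_ifs with h2 h3
        · exact absurd ⟨h2, h3.1⟩ h1
        · rfl
        · rfl
    · rw [if_neg h]
      split_ifs with h1 h2
      · exact absurd h2.2 h
      · rfl
      · rfl
  · intro b _ hb
    rw [bk_of_ne fun h => hb h.1, ite_self]
  · simp

theorem relabel_bk {I J : Type} (e : I ≃ J) (s t : I → Bool) :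
    relabel e (bk s t) = bk (fun j => s (e.symm j)) (fun j => t (e.symm j)) := by
  have h : ∀ (u : J → Bool) (s : I → Bool),
      ((fun i => u (e i)) = s) ↔ (u = fun j => s (e.symm j)) := by
    intro u s
    constructor
    · rintro rfl; funext j; simp
    · rintro rfl; funext j; simp
  funext u v
  have h1 := h u s
  have h2 := h v t
  rw [relabel]
  by_cases hh : (fun i => u (e i)) = s ∧ (fun i => v (e i)) = t
  · rw [bk_of_eq hh, bk_of_eq ⟨h1.1 hh.1, h2.1 hh.2⟩]
  · rw [bk_of_ne hh, bk_of_ne fun h' => hh ⟨h1.2 h'.1, h2.2 h'.2⟩]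

theorem relabel_ketbra {I J : Type} [Fintype I] [Fintype J] (e : I ≃ J) (s : I → Bool) :
    relabel e (ketbra s) = ketbra fun j => s (e.symm j) := by
  simp only [ketbra_eq_bk, relabel_bk]

/-! ### Gates -/

/-- In row `s` only the two strings that agree with `s` away from wire `i` contribute, so the sum
over all strings becomes a sum over one bit. -/
theorem onWire_mulVec {W : Type} [Fintype W] [DecidableEq W] (U : Matrix Bool Bool ℂ) (i : W)
    (s : W → Bool) (g : (W → Bool) → ℂ) :
    ∑ u, onWire U i s u * g u = ∑ p, U (s i) p * g (Function.update s i p) := by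
  have hinj : Function.Injective fun p => Function.update s i p :=
    Function.update_injective s i
  rw [← Finset.sum_subset (Finset.subset_univ (Finset.univ.image fun p => Function.update s i p)),
    Finset.sum_image fun p _ q _ h => hinj h]
  · refine Finset.sum_congr rfl fun p _ => ?_
    rw [onWire, if_pos]
    · simp
    · intro w hw; simp [hw]
  · intro u _ hu
    rw [onWire, if_neg, zero_mul]
    intro h
    apply hu
    refine Finset.mem_image.2 ⟨u i, Finset.mem_univ _, ?_⟩
    funext w
    by_cases hw : w = i
    · subst hw; simp
    · simp [hw, h w hw]

theorem conjBy_onWire_apply {W : Type} [Fintype W] [DecidableEq W] (U : Matrix Bool Bool ℂ)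
    (i : W) (ρ : Op W) (s t : W → Bool) :
    conjBy (onWire U i) ρ s t = ∑ q, ∑ p, U (s i) p *
      ρ (Function.update s i p) (Function.update t i q) * star (U (t i) q) := by
  simp only [conjBy, Matrix.mul_apply, Matrix.conjTranspose_apply]
  have h1 : ∀ u, ∑ v, onWire U i s v * ρ v u =
      ∑ p, U (s i) p * ρ (Function.update s i p) u := fun u => onWire_mulVec U i s _
  simp only [h1]
  have h2 := congrArg star (onWire_mulVec U i t fun u =>
    star (∑ p, U (s i) p * ρ (Function.update s i p) u))
  simp only [star_sum, star_mul, star_star] at h2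
  rw [show (∑ u, (∑ p, U (s i) p * ρ (Function.update s i p) u) * star (onWire U i t u)) =
    ∑ u, (∑ p, U (s i) p * ρ (Function.update s i p) u) * star (onWire U i t u) from rfl]
  simp only [Finset.sum_mul] at h2 ⊢
  simpa [mul_comm, mul_assoc, mul_left_comm] using h2

/-- An involution is its own inverse, so conjugation just permutes the entries by `g`. `CNOT`,
Toffoli and the XOR of an oracle answer are all of this kind. -/
theorem conjBy_basisMap_apply {W : Type} [Fintype W] [DecidableEq W]
    {g : (W → Bool) → (W → Bool)} (hg : Function.Involutive g) (ρ : Op W) (s t : W → Bool) :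
    conjBy (basisMap g) ρ s t = ρ (g s) (g t) := by
  have h : ∀ u v : W → Bool, u = g v ↔ v = g u := fun u v =>
    ⟨fun h => by rw [h, hg], fun h => by rw [h, hg]⟩
  have h1 : ∀ u v, basisMap g u v = if v = g u then (1 : ℂ) else 0 := fun u v => by
    simp only [basisMap, h u v]
  simp only [conjBy, Matrix.mul_apply, Matrix.conjTranspose_apply, h1]
  simp

theorem cnot_involutive {W : Type} [DecidableEq W] {c i : W} (hc : c ≠ i) :
    Function.Involutive fun s : W → Bool => Function.update s i (xor (s i) (s c)) := by
  intro s
  funext w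
  by_cases hw : w = i
  · subst hw; simp [Function.update_of_ne hc]
  · simp [hw]

theorem toffoli_involutive {W : Type} [DecidableEq W] {c d i : W} (hc : c ≠ i) (hd : d ≠ i) :
    Function.Involutive fun s : W → Bool => Function.update s i (xor (s i) (s c && s d)) := by
  intro s
  funext w
  by_cases hw : w = i
  · subst hw; simp [Function.update_of_ne hc, Function.update_of_ne hd]
  · simp [hw]

/-- The embedding of the answer wires. -/
def answerEmb {a b : ℕ} {W : Type} (e : Fin a ⊕ Fin b ↪ W) : Fin b ↪ W :=
  Function.Embedding.inr.trans e

/-- XOR the string `y` into the wires `f k`. -/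
noncomputable def xorAt {K W : Type} (f : K ↪ W) (y : K → Bool) (t : W → Bool) : W → Bool :=
  Function.extend f (fun k => xor (t (f k)) (y k)) t

theorem xorAnswer_eq {a b : ℕ} {W : Type} (𝓞 : Oracle a b) (e : Fin a ⊕ Fin b ↪ W)
    (t : W → Bool) :
    xorAnswer 𝓞 e t = xorAt (answerEmb e) (𝓞 fun q => t (e (Sum.inl q))) t := rfl

theorem xorAt_involutive {K W : Type} (f : K ↪ W) (y : K → Bool) :
    Function.Involutive (xorAt f y) := by
  intro s
  symm
  rw [xorAt, eq_extend_iff]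
  refine ⟨?_, fun w hw => ?_⟩
  · funext k; simp [xorAt]
  · rw [xorAt, extend_emb_of_notMem f _ _ hw]

theorem xorAt_query {a b : ℕ} {W : Type} (e : Fin a ⊕ Fin b ↪ W) (y : BitStr b)
    (t : W → Bool) (q : Fin a) :
    xorAt (answerEmb e) y t (e (Sum.inl q)) = t (e (Sum.inl q)) :=
  extend_emb_of_notMem _ _ _ fun k h => by
    have := e.injective h
    simp at this

/-- The query wires are disjoint from the answer wires and stay unchanged, so the second application
XORs the same answer and cancels the first. -/
theorem xorAnswer_involutive {a b : ℕ} {W : Type} (𝓞 : Oracle a b) (e : Fin a ⊕ Fin b ↪ W) :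
    Function.Involutive (xorAnswer 𝓞 e) := by
  intro s
  simp only [xorAnswer_eq, xorAt_query]
  exact xorAt_involutive _ _ s

open Classical in
/-- Measurement of the wires `f k` in the computational basis. -/
noncomputable def dephase {K W : Type} (f : K → W) (ρ : Op W) : Op W :=
  fun s t => if ∀ k, s (f k) = t (f k) then ρ s t else 0

theorem dephase_add {K W : Type} (f : K → W) (ρ σ : Op W) :
    dephase f (ρ + σ) = dephase f ρ + dephase f σ := by
  funext s t
  simp only [dephase, Matrix.add_apply]
  split_ifs <;> simp

theorem dephase_smul {K W : Type} (f : K → W) (c : ℂ) (ρ : Op W) :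
    dephase f (c • ρ) = c • dephase f ρ := by
  funext s t
  simp only [dephase, Matrix.smul_apply]
  split_ifs <;> simp

theorem conjBy_add {W : Type} [Fintype W] [DecidableEq W] (U ρ σ : Op W) :
    conjBy U (ρ + σ) = conjBy U ρ + conjBy U σ := by
  simp [conjBy, mul_add, add_mul]

theorem conjBy_smul {W : Type} [Fintype W] [DecidableEq W] (U : Op W) (c : ℂ) (ρ : Op W) :
    conjBy U (c • ρ) = c • conjBy U ρ := by
  simp [conjBy]

namespace Gate

variable {𝒢 : Set (Matrix.unitaryGroup Bool ℂ)} {a b : ℕ} {W V : Type}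

theorem apply_query [Fintype W] [DecidableEq W] (𝓞 : Oracle a b) (e : Fin a ⊕ Fin b ↪ W)
    (ρ : Op W) : (query e : Gate 𝒢 a b W).apply 𝓞 ρ =
      conjBy (basisMap (xorAnswer 𝓞 e)) (dephase (fun q => e (Sum.inl q)) ρ) := by
  refine congrArg (conjBy _) ?_
  unfold dephase
  funext s t
  congr

theorem apply_measure [Fintype W] [DecidableEq W] (𝓞 : Oracle a b) (i : W)
    (ρ : Op W) : (measure i : Gate 𝒢 a b W).apply 𝓞 ρ = dephase (fun _ : Unit => i) ρ := by
  funext s t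
  simp [apply, dephase]

theorem apply_add [Fintype W] [DecidableEq W] (𝓞 : Oracle a b) (g : Gate 𝒢 a b W) (ρ σ : Op W) :
    g.apply 𝓞 (ρ + σ) = g.apply 𝓞 ρ + g.apply 𝓞 σ := by
  cases g with
  | measure i => simp only [apply_measure, dephase_add]
  | query e => simp only [apply_query, dephase_add, conjBy_add]
  | _ => exact conjBy_add _ _ _

theorem apply_smul [Fintype W] [DecidableEq W] (𝓞 : Oracle a b) (g : Gate 𝒢 a b W) (c : ℂ)
    (ρ : Op W) : g.apply 𝓞 (c • ρ) = c • g.apply 𝓞 ρ := by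
  cases g with
  | measure i => simp only [apply_measure, dephase_smul]
  | query e => simp only [apply_query, dephase_smul, conjBy_smul]
  | _ => exact conjBy_smul _ _ _

/-- The action of a gate as a linear map. -/
noncomputable def applyL [Fintype W] [DecidableEq W] (𝓞 : Oracle a b) (g : Gate 𝒢 a b W) :
    Op W →ₗ[ℂ] Op W where
  toFun := g.apply 𝓞
  map_add' := g.apply_add 𝓞
  map_smul' := g.apply_smul 𝓞

end Gate

/-! ### Locality: gates act block by block -/

/-- The block of `ρ` on the wires `f w`, for assignments `u`, `v` of the other wires. -/
noncomputable def slice {W V : Type} (f : W ↪ V) (u v : V → Bool) (ρ : Op V) : Op W :=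
  fun s t => ρ (Function.extend f s u) (Function.extend f t v)

theorem update_extend {W V A : Type} [DecidableEq W] [DecidableEq V] (f : W ↪ V) (s : W → A)
    (u : V → A) (i : W) (p : A) :
    Function.update (Function.extend f s u) (f i) p =
      Function.extend f (Function.update s i p) u := by
  rw [eq_extend_iff]
  constructor
  · funext j
    by_cases h : j = i
    · subst h; simp
    · simp [h]
  · intro w hw
    rw [Function.update_of_ne (hw i).symm, extend_emb_of_notMem f s u hw]

theorem xorAt_extend {K W V : Type} (g : K ↪ W) (f : W ↪ V) (y : K → Bool) (s : W → Bool)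
    (u : V → Bool) :
    xorAt (g.trans f) y (Function.extend f s u) = Function.extend f (xorAt g y s) u := by
  rw [eq_extend_iff]
  constructor
  · funext j
    by_cases h : ∃ k, g k = j
    · obtain ⟨k, rfl⟩ := h
      have h1 := extend_emb_apply (g.trans f)
        (fun k => xor (Function.extend f s u ((g.trans f) k)) (y k)) (Function.extend f s u) k
      have h2 := extend_emb_apply g (fun k => xor (s (g k)) (y k)) s k
      rw [Function.Embedding.trans_apply] at h1
      rw [xorAt, h1, xorAt, h2, extend_emb_apply]
    · rw [xorAt, extend_emb_of_notMem, xorAt, extend_emb_of_notMem g]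
      · simp
      · simpa using h
      · intro k hk; exact h ⟨k, f.injective hk⟩
  · intro w hw
    rw [xorAt, extend_emb_of_notMem, extend_emb_of_notMem f _ _ hw]
    intro k; exact hw _

/-- A gate moved along `f` touches only wires in the range of `f`, so it acts within each block,
off-diagonal blocks `u ≠ v` included. Commutation with loading, discarding and tensoring all derive
from this. -/
theorem Gate.slice_apply {𝒢 : Set (Matrix.unitaryGroup Bool ℂ)} {a b : ℕ} {W V : Type}
    [Fintype W] [DecidableEq W] [Fintype V] [DecidableEq V] (𝓞 : Oracle a b)
    (g : Gate 𝒢 a b W) (f : W ↪ V) (u v : V → Bool) (ρ : Op V) :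
    slice f u v ((g.map f).apply 𝓞 ρ) = g.apply 𝓞 (slice f u v ρ) := by
  funext s t
  cases g with
  | x i => simp [slice, Gate.map, Gate.apply, conjBy_onWire_apply, update_extend]
  | h i => simp [slice, Gate.map, Gate.apply, conjBy_onWire_apply, update_extend]
  | t i => simp [slice, Gate.map, Gate.apply, conjBy_onWire_apply, update_extend]
  | single U hU i => simp [slice, Gate.map, Gate.apply, conjBy_onWire_apply, update_extend]
  | cnot c i hc =>
    simp only [slice, Gate.map, Gate.apply]
    rw [conjBy_basisMap_apply (cnot_involutive hc),
      conjBy_basisMap_apply (cnot_involutive (f.injective.ne hc))]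
    simp [update_extend, slice]
  | toffoli c d i hcd hc hd =>
    simp only [slice, Gate.map, Gate.apply]
    rw [conjBy_basisMap_apply (toffoli_involutive hc hd),
      conjBy_basisMap_apply (toffoli_involutive (f.injective.ne hc) (f.injective.ne hd))]
    simp [update_extend, slice]
  | measure i => simp [slice, Gate.map, Gate.apply]
  | query e =>
    have h1 : answerEmb (e.trans f) = (answerEmb e).trans f := rfl
    rw [slice, Gate.map, Gate.apply_query, Gate.apply_query,
      conjBy_basisMap_apply (xorAnswer_involutive 𝓞 e),
      conjBy_basisMap_apply (xorAnswer_involutive 𝓞 (e.trans f))]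
    simp only [xorAnswer_eq, h1, xorAt_extend, Function.Embedding.trans_apply, extend_emb_apply,
      dephase, slice]
    congr

theorem extend_self {W V A : Type} (f : W ↪ V) (s : V → A) :
    Function.extend f (fun w => s (f w)) s = s :=
  ((eq_extend_iff f s _ s).2 ⟨rfl, fun _ _ => rfl⟩).symm

section acts

variable {𝒢 : Set (Matrix.unitaryGroup Bool ℂ)} {a b : ℕ} {W V : Type}
  [Fintype W] [DecidableEq W] [Fintype V] [DecidableEq V]

/-- The action of a sequence of gates as a linear map. -/
noncomputable def acts (𝓞 : Oracle a b) : List (Gate 𝒢 a b W) → Op W →ₗ[ℂ] Op W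
  | [] => LinearMap.id
  | g :: gs => acts 𝓞 gs ∘ₗ g.applyL 𝓞

@[simp] theorem acts_nil (𝓞 : Oracle a b) (ρ : Op W) :
    acts 𝓞 ([] : List (Gate 𝒢 a b W)) ρ = ρ := rfl

@[simp] theorem acts_cons (𝓞 : Oracle a b) (g : Gate 𝒢 a b W) (gs : List (Gate 𝒢 a b W))
    (ρ : Op W) : acts 𝓞 (g :: gs) ρ = acts 𝓞 gs (g.apply 𝓞 ρ) := rfl

theorem foldl_apply_eq_acts (𝓞 : Oracle a b) (gs : List (Gate 𝒢 a b W)) (ρ : Op W) :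
    gs.foldl (fun σ g => g.apply 𝓞 σ) ρ = acts 𝓞 gs ρ := by
  induction gs generalizing ρ with
  | nil => rfl
  | cons g gs ih => exact ih _

theorem acts_append (𝓞 : Oracle a b) (gs hs : List (Gate 𝒢 a b W)) (ρ : Op W) :
    acts 𝓞 (gs ++ hs) ρ = acts 𝓞 hs (acts 𝓞 gs ρ) := by
  simp only [← foldl_apply_eq_acts, List.foldl_append]

theorem slice_acts (𝓞 : Oracle a b) (gs : List (Gate 𝒢 a b W)) (f : W ↪ V) (u v : V → Bool)
    (ρ : Op V) : slice f u v (acts 𝓞 (gs.map (Gate.map f)) ρ) = acts 𝓞 gs (slice f u v ρ) := by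
  induction gs generalizing ρ with
  | nil => rfl
  | cons g gs ih => rw [List.map_cons, acts_cons, ih, Gate.slice_apply, acts_cons]

theorem acts_map_apply (𝓞 : Oracle a b) (gs : List (Gate 𝒢 a b W)) (f : W ↪ V) (ρ : Op V)
    (s t : V → Bool) : acts 𝓞 (gs.map (Gate.map f)) ρ s t =
      acts 𝓞 gs (slice f s t ρ) (fun w => s (f w)) (fun w => t (f w)) := by
  rw [← slice_acts]
  simp only [slice, extend_self]

/-- Each block of a loaded operator is either the operator itself or zero, and both are handled by
linearity. -/
theorem acts_load (𝓞 : Oracle a b) (gs : List (Gate 𝒢 a b W)) (f : W ↪ V) (ρ : Op W) :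
    acts 𝓞 (gs.map (Gate.map f)) (load f ρ) = load f (acts 𝓞 gs ρ) := by
  funext s t
  rw [acts_map_apply]
  have : slice f s t (load f ρ) =
      if ∀ w, (∀ i, f i ≠ w) → s w = false ∧ t w = false then ρ else 0 := by
    funext x y
    have h : ∀ w, (∀ i, f i ≠ w) → (Function.extend f x s w = s w ∧
        Function.extend f y t w = t w) := fun w hw =>
      ⟨extend_emb_of_notMem f x s hw, extend_emb_of_notMem f y t hw⟩
    simp only [slice, load, extend_emb_apply]
    split_ifs with h1 h2 h2
    · rfl
    · exact absurd (fun w hw => by rw [← (h w hw).1, ← (h w hw).2]; exact h1 w hw) h2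
    · exact absurd (fun w hw => by rw [(h w hw).1, (h w hw).2]; exact h2 w hw) h1
    · rfl
  rw [this, load]
  split_ifs <;> simp

-- The partial trace adds the diagonal blocks, one for each assignment of the discarded wires. A
-- block does not depend on `u` at the kept wires; requiring `false` there picks one representative
-- for each assignment.
omit [DecidableEq W] in
theorem keep_eq_sum_slice (f : W ↪ V) (ρ : Op V) :
    keep f ρ = ∑ u : V → Bool, if (fun w => u (f w)) = (fun _ => false) then
      slice f u u ρ else 0 := by
  funext s t
  simp only [keep, Matrix.sum_apply]
  rw [← Finset.sum_filter (p := fun u : V → Bool => (fun w => u (f w)) = s)]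
  have : ∀ u : V → Bool, (if (fun w => u (f w)) = (fun _ => false) then slice f u u ρ else 0) s t =
      if (fun w => u (f w)) = (fun _ => false) then slice f u u ρ s t else 0 := by
    intro u; split_ifs <;> rfl
  simp only [this]
  rw [← Finset.sum_filter]
  refine Finset.sum_bij' (fun u _ => Function.extend f (fun _ => false) u)
    (fun u _ => Function.extend f s u) ?_ ?_ ?_ ?_ ?_
  · intro u _; simp
  · intro u _; simp
  · intro u hu
    simp only [Finset.mem_filter, Finset.mem_univ, true_and] at hu
    symm
    rw [eq_extend_iff]
    exact ⟨hu, fun w hw => (extend_emb_of_notMem f _ _ hw).symm⟩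
  · intro u hu
    simp only [Finset.mem_filter, Finset.mem_univ, true_and] at hu
    symm
    rw [eq_extend_iff]
    exact ⟨hu, fun w hw => (extend_emb_of_notMem f _ _ hw).symm⟩
  · intro u hu
    simp only [Finset.mem_filter, Finset.mem_univ, true_and] at hu
    have h : ∀ x : W → Bool, Function.extend f x (Function.extend f (fun _ => false) u) =
        Function.extend f x u := by
      intro x
      rw [eq_extend_iff]
      exact ⟨by simp, fun w hw => by
        rw [extend_emb_of_notMem f _ _ hw, extend_emb_of_notMem f _ _ hw]⟩
    simp only [slice, h]
    rw [← hu, extend_self]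

theorem keep_acts (𝓞 : Oracle a b) (gs : List (Gate 𝒢 a b W)) (f : W ↪ V) (ρ : Op V) :
    keep f (acts 𝓞 (gs.map (Gate.map f)) ρ) = acts 𝓞 gs (keep f ρ) := by
  rw [keep_eq_sum_slice, keep_eq_sum_slice, map_sum]
  refine Finset.sum_congr rfl fun u _ => ?_
  split_ifs
  · exact slice_acts _ _ _ _ _ _
  · simp

end acts

/-! ### Trace and positivity -/

open Classical in
/-- The trace of an operator. -/
noncomputable def tr {I : Type} [Fintype I] (ρ : Op I) : ℂ := ∑ s, ρ s s

/-- The trace as a linear map. -/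
noncomputable def trL {I : Type} [Fintype I] : Op I →ₗ[ℂ] ℂ where
  toFun := tr
  map_add' ρ σ := by simp [tr, Finset.sum_add_distrib]
  map_smul' c ρ := by simp [tr, Finset.mul_sum]

theorem tr_eq {I : Type} [Fintype I] [DecidableEq I] (ρ : Op I) : tr ρ = ∑ s, ρ s s := by
  unfold tr
  congr!

theorem tr_eq_trace {I : Type} [Fintype I] [DecidableEq I] (ρ : Op I) : tr ρ = Matrix.trace ρ :=
  tr_eq ρ

open Classical in
theorem tr_bk {I : Type} [Fintype I] (s t : I → Bool) : tr (bk s t) = if s = t then 1 else 0 := by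
  rw [tr, Finset.sum_eq_single s]
  · split_ifs with h
    · exact bk_of_eq ⟨rfl, h⟩
    · exact bk_of_ne fun h' => h h'.2
  · intro u _ hu
    exact bk_of_ne fun h => hu h.1
  · simp

@[simp] theorem tr_ketbra {I : Type} [Fintype I] (s : I → Bool) : tr (ketbra s) = 1 := by
  simp [ketbra_eq_bk, tr_bk]

theorem tr_kron {I J : Type} [Fintype I] [Fintype J] (ρ : Op I) (σ : Op J) :
    tr (kron ρ σ) = tr ρ * tr σ := by
  classical
  simp only [tr_eq, Finset.sum_mul_sum]
  rw [← Finset.sum_product']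
  exact Fintype.sum_equiv (Equiv.sumArrowEquivProdArrow I J Bool) _ _ fun s => rfl

theorem tr_traceRight {I J : Type} [Fintype I] [Fintype J] [DecidableEq J] (ρ : Op (I ⊕ J)) :
    tr (traceRight ρ) = tr ρ := by
  classical
  simp only [tr_eq, traceRight]
  rw [← Finset.sum_product']
  exact Fintype.sum_equiv (Equiv.sumArrowEquivProdArrow I J Bool).symm _ _ fun p => rfl

theorem traceRight_kron {I J : Type} [Fintype J] [DecidableEq J] (ρ : Op I) (σ : Op J) :
    traceRight (kron ρ σ) = tr σ • ρ := by
  funext s t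
  simp only [traceRight, kron, Sum.elim_inl, Sum.elim_inr, tr_eq, Matrix.smul_apply, smul_eq_mul]
  rw [← Finset.mul_sum, mul_comm]

theorem tr_load {I W : Type} [Fintype I] [Fintype W] [DecidableEq W] (f : I ↪ W) (ρ : Op I) :
    tr (load f ρ) = tr ρ := by
  have : trL ∘ₗ loadL f = trL := op_linearMap_ext fun s t => by
    change tr (load f (bk s t)) = tr (bk s t)
    rw [load_bk, tr_bk, tr_bk]
    congr 1
    refine propext ⟨fun h => ?_, fun h => by rw [h]⟩
    funext i
    rw [← ext0_apply f s i, h, ext0_apply]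
  exact LinearMap.congr_fun this ρ

theorem tr_keep {J W : Type} [Fintype J] [Fintype W] [DecidableEq W] (f : J ↪ W) (ρ : Op W) :
    tr (keep f ρ) = tr ρ := by
  classical
  have : trL ∘ₗ keepL f = trL := op_linearMap_ext fun s t => by
    change tr (keep f (bk s t)) = tr (bk s t)
    rw [keep_bk, tr_bk]
    by_cases h : s = t
    · subst h; simp [tr_bk]
    · rw [if_neg h]
      split_ifs with h1
      · rw [tr_bk, if_neg]
        intro h2
        apply h
        funext w
        by_cases hw : ∃ j, f j = w
        · obtain ⟨j, rfl⟩ := hw; exact congrFun h2 j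
        · exact h1 w (by simpa using hw)
      · exact map_zero trL
  exact LinearMap.congr_fun this ρ

section psd

open scoped ComplexOrder

/-- Positive semidefiniteness. -/
abbrev PSD {I : Type} (ρ : Op I) : Prop := Matrix.PosSemidef ρ

-- This is the compression by the diagonal projector onto the strings satisfying `p`.
open Classical in
theorem PSD.mask {I : Type} [Finite I] {ρ : Op I} (h : PSD ρ) (p : (I → Bool) → Prop) :
    PSD (fun s t => if p s ∧ p t then ρ s t else 0 : Op I) := by
  have := Fintype.ofFinite I
  have h1 := h.mul_mul_conjTranspose_same (Matrix.diagonal fun s => if p s then (1 : ℂ) else 0)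
  refine (congrArg PSD ?_).mpr h1
  funext s t
  rw [Matrix.diagonal_conjTranspose, Matrix.mul_diagonal, Matrix.diagonal_mul]
  by_cases hs : p s <;> by_cases ht : p t <;> simp [hs, ht]

theorem PSD.sum {I ι : Type} (S : Finset ι) {f : ι → Op I} (h : ∀ i ∈ S, PSD (f i)) :
    PSD (∑ i ∈ S, f i) := by
  classical
  induction S using Finset.induction_on with
  | empty => simpa using Matrix.PosSemidef.zero
  | insert i S hi ih =>
    rw [Finset.sum_insert hi]
    exact (h i (Finset.mem_insert_self _ _)).add
      (ih fun j hj => h j (Finset.mem_insert_of_mem hj))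

theorem PSD.diag_re_nonneg {I : Type} {ρ : Op I} (h : PSD ρ) (s : I → Bool) : 0 ≤ (ρ s s).re :=
  (Complex.nonneg_iff.1 h.diag_nonneg).1

theorem PSD.diag_eq_re {I : Type} {ρ : Op I} (h : PSD ρ) (s : I → Bool) :
    ρ s s = ((ρ s s).re : ℂ) :=
  Complex.ext rfl (by simpa using (Complex.nonneg_iff.1 h.diag_nonneg).2.symm)

theorem PSD.tr_re_nonneg {I : Type} [Fintype I] {ρ : Op I} (h : PSD ρ) : 0 ≤ (tr ρ).re := by
  rw [tr, Complex.re_sum]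
  exact Finset.sum_nonneg fun s _ => h.diag_re_nonneg s

theorem psd_ketbra {I : Type} [Fintype I] (x : I → Bool) : PSD (ketbra x) := by
  classical
  have h := Matrix.PosSemidef.one (n := I → Bool) (R := ℂ)
  have h1 := PSD.mask (ρ := (1 : Op I)) h fun s => s = x
  refine (congrArg PSD ?_).mpr h1
  funext s t
  simp only [ketbra]
  split_ifs with h
  · rw [h.1, h.2, Matrix.one_apply_eq]
  · rfl

theorem PSD.load {I W : Type} [Fintype I] [Fintype W] [DecidableEq W] (f : I ↪ W) {ρ : Op I}
    (h : PSD ρ) : PSD (load f ρ) := by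
  classical
  have h1 := PSD.mask (h.submatrix fun (s : W → Bool) i => s (f i))
    fun s => ∀ w, (∀ i, f i ≠ w) → s w = false
  refine (congrArg PSD ?_).mpr h1
  funext s t
  simp only [_root_.load, ← forall_and]
  rfl

theorem PSD.keep {J W : Type} [Fintype J] [Fintype W] [DecidableEq W] (f : J ↪ W) {ρ : Op W}
    (h : PSD ρ) : PSD (keep f ρ) := by
  rw [keep_eq_sum_slice]
  refine PSD.sum _ fun u _ => ?_
  split_ifs
  · exact h.submatrix fun s => Function.extend f s u
  · exact Matrix.PosSemidef.zero

theorem PSD.traceRight {I J : Type} [Fintype J] [DecidableEq J] {ρ : Op (I ⊕ J)} (h : PSD ρ) :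
    PSD (traceRight ρ) := by
  have : _root_.traceRight ρ =
      ∑ u : J → Bool, ρ.submatrix (fun s => Sum.elim s u) (fun s => Sum.elim s u) := by
    funext s t
    simp [_root_.traceRight, Matrix.sum_apply]
  rw [this]
  exact PSD.sum _ fun u _ => h.submatrix _

theorem PSD.attach {I J : Type} [Fintype I] [Fintype J] {ρ : Op I} (h : PSD ρ) (x : J → Bool) :
    PSD (attach ρ x) := by
  classical
  have h1 := PSD.mask (h.submatrix fun (s : I ⊕ J → Bool) i => s (Sum.inl i))
    fun s => (fun j => s (Sum.inr j)) = x
  refine (congrArg PSD ?_).mpr h1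
  funext s t
  simp only [_root_.attach]
  congr

/-! ### Gates preserve trace and positivity -/

section gates

variable {W : Type} [Fintype W] [DecidableEq W]

theorem onWire_conjTranspose (U : Matrix Bool Bool ℂ) (i : W) :
    (onWire U i).conjTranspose = onWire U.conjTranspose i := by
  funext s t
  simp only [Matrix.conjTranspose_apply, onWire, eq_comm (a := t _)]
  split_ifs <;> simp

theorem onWire_mul (U V : Matrix Bool Bool ℂ) (i : W) :
    onWire U i * onWire V i = onWire (U * V) i := by
  funext s t
  have h : ∀ p w, w ≠ i → Function.update s i p w = s w := fun p w hw =>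
    Function.update_of_ne hw _ _
  rw [Matrix.mul_apply, onWire_mulVec]
  simp only [onWire, Function.update_self, Matrix.mul_apply]
  by_cases h1 : ∀ w, w ≠ i → s w = t w
  · rw [if_pos h1]
    refine Finset.sum_congr rfl fun p _ => ?_
    rw [if_pos fun w hw => (h p w hw).trans (h1 w hw)]
  · rw [if_neg h1]
    refine Finset.sum_eq_zero fun p _ => ?_
    rw [if_neg fun h2 => h1 fun w hw => (h p w hw).symm.trans (h2 w hw), mul_zero]

theorem onWire_one (i : W) : onWire 1 i = (1 : Op W) := by
  funext s t
  simp only [onWire, Matrix.one_apply]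
  by_cases h : s = t
  · subst h; simp
  · rw [if_neg h]
    split_ifs with h1 h2
    · exfalso
      apply h
      funext w
      by_cases hw : w = i
      · rw [hw, h2]
      · exact h1 w hw
    · rfl
    · rfl

theorem tr_conjBy_onWire {U : Matrix Bool Bool ℂ} (hU : U.conjTranspose * U = 1) (i : W)
    (ρ : Op W) : tr (conjBy (onWire U i) ρ) = tr ρ := by
  rw [tr_eq_trace, tr_eq_trace, conjBy, Matrix.trace_mul_comm, ← mul_assoc, onWire_conjTranspose,
    onWire_mul, hU, onWire_one, one_mul]

theorem tr_conjBy_basisMap {g : (W → Bool) → (W → Bool)} (hg : Function.Involutive g)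
    (ρ : Op W) : tr (conjBy (basisMap g) ρ) = tr ρ := by
  simp only [tr_eq, conjBy_basisMap_apply hg]
  exact Equiv.sum_comp hg.toPerm fun s => ρ s s

theorem tr_dephase {K : Type} (f : K → W) (ρ : Op W) : tr (dephase f ρ) = tr ρ := by
  simp [tr_eq, dephase]

theorem matX_unitary : matX.conjTranspose * matX = 1 := by
  ext p q
  cases p <;> cases q <;> simp [Matrix.mul_apply, matX]

theorem matH_unitary : matH.conjTranspose * matH = 1 := by
  have h : ((Real.sqrt 2 : ℝ) : ℂ) * ((Real.sqrt 2 : ℝ) : ℂ) = 2 := by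
    rw [← Complex.ofReal_mul, Real.mul_self_sqrt (by norm_num)]; norm_num
  have h0 : ((Real.sqrt 2 : ℝ) : ℂ) ≠ 0 := by
    intro h1; rw [h1] at h; norm_num at h
  ext p q
  cases p <;> cases q <;>
    simp only [Matrix.mul_apply, matH, Matrix.conjTranspose_apply, Fintype.sum_bool,
      Bool.and_true, Bool.and_false, Bool.false_eq_true, if_true, if_false, star_div₀,
      star_one, RCLike.star_def, Complex.conj_ofReal, div_mul_div_comm, h] <;>
    norm_num

theorem matT_unitary : matT.conjTranspose * matT = 1 := by
  rw [matT, Matrix.diagonal_conjTranspose, Matrix.diagonal_mul_diagonal, ← Matrix.diagonal_one]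
  congr 1
  funext p
  cases p
  · simp
  · simp only [Pi.star_apply, if_true, RCLike.star_def, ← Complex.exp_conj, ← Complex.exp_add]
    have h4 : (starRingEnd ℂ) 4 = 4 := Complex.conj_ofNat 4
    rw [map_div₀, map_mul, Complex.conj_ofReal, Complex.conj_I, h4, mul_neg, neg_div,
      neg_add_cancel, Complex.exp_zero]

/-- The block of `ρ` in which the wires `f k` hold the string `q`. -/
noncomputable def projOn {K W : Type} (f : K → W) (q : K → Bool) (ρ : Op W) : Op W := by
  classical
  exact fun s t => if (fun k => s (f k)) = q ∧ (fun k => t (f k)) = q then ρ s t else 0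

-- A measurement is the sum over its outcomes of the projected blocks. This gives positivity here,
-- and later the splitting of a query according to the queried string.
omit [Fintype W] [DecidableEq W] in
theorem dephase_eq_sum {K : Type} [Fintype K] [DecidableEq K] (f : K → W) (ρ : Op W) :
    dephase f ρ = ∑ q : K → Bool, projOn f q ρ := by
  funext s t
  simp only [dephase, projOn, Matrix.sum_apply, ← funext_iff (f := fun k => s (f k))]
  by_cases h : (fun k => s (f k)) = fun k => t (f k)
  · rw [if_pos h, Finset.sum_eq_single fun k => t (f k)]
    · rw [if_pos ⟨h, rfl⟩]
    · intro q _ hq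
      rw [if_neg fun h' => hq h'.2.symm]
    · simp
  · rw [if_neg h]
    refine (Finset.sum_eq_zero fun q _ => ?_).symm
    rw [if_neg fun h' => h (h'.1.trans h'.2.symm)]

omit [DecidableEq W] in
theorem PSD.projOn {K : Type} (f : K → W) (q : K → Bool) {ρ : Op W} (h : PSD ρ) :
    PSD (projOn f q ρ) := by
  classical
  have := h.mask fun s => (fun k => s (f k)) = q
  exact this

omit [DecidableEq W] in
theorem PSD.dephase {K : Type} [Finite K] (f : K → W) {ρ : Op W} (h : PSD ρ) :
    PSD (dephase f ρ) := by
  classical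
  have := Fintype.ofFinite K
  rw [dephase_eq_sum]
  exact PSD.sum _ fun q _ => h.projOn f q

theorem PSD.conjBy_basisMap (g : (W → Bool) → (W → Bool)) {ρ : Op W} (h : PSD ρ) : PSD (conjBy (basisMap g) ρ) :=
  h.mul_mul_conjTranspose_same _

variable {𝒢 : Set (Matrix.unitaryGroup Bool ℂ)} {a b : ℕ}

theorem Gate.tr_apply (𝓞 : Oracle a b) (g : Gate 𝒢 a b W) (ρ : Op W) :
    tr (g.apply 𝓞 ρ) = tr ρ := by
  cases g with
  | x i => exact tr_conjBy_onWire matX_unitary i ρ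
  | h i => exact tr_conjBy_onWire matH_unitary i ρ
  | t i => exact tr_conjBy_onWire matT_unitary i ρ
  | single U hU i => exact tr_conjBy_onWire (Matrix.mem_unitaryGroup_iff'.1 U.2) i ρ
  | cnot c i hc => exact tr_conjBy_basisMap (cnot_involutive hc) ρ
  | toffoli c d i hcd hc hd => exact tr_conjBy_basisMap (toffoli_involutive hc hd) ρ
  | measure i => rw [apply_measure, tr_dephase]
  | query e => rw [apply_query, tr_conjBy_basisMap (xorAnswer_involutive 𝓞 e), tr_dephase]

theorem PSD.apply (𝓞 : Oracle a b) (g : Gate 𝒢 a b W) {ρ : Op W} (h : PSD ρ) :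
    PSD (g.apply 𝓞 ρ) := by
  cases g with
  | measure i => rw [Gate.apply_measure]; exact h.dephase _
  | query e => rw [Gate.apply_query]; exact (h.dephase _).mul_mul_conjTranspose_same _
  | _ => exact h.mul_mul_conjTranspose_same _

theorem tr_acts (𝓞 : Oracle a b) (gs : List (Gate 𝒢 a b W)) (ρ : Op W) :
    tr (acts 𝓞 gs ρ) = tr ρ := by
  induction gs generalizing ρ with
  | nil => rfl
  | cons g gs ih => rw [acts_cons, ih, Gate.tr_apply]

theorem PSD.acts (𝓞 : Oracle a b) (gs : List (Gate 𝒢 a b W)) {ρ : Op W} (h : PSD ρ) :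
    PSD (acts 𝓞 gs ρ) := by
  induction gs generalizing ρ with
  | nil => exact h
  | cons g gs ih => rw [acts_cons]; exact ih (h.apply 𝓞 g)

end gates

end psd

/-! ### The algebra of circuits -/

theorem ext0_trans {I W V : Type} (f : I ↪ W) (g : W ↪ V) (s : I → Bool) :
    ext0 (f.trans g) s = ext0 g (ext0 f s) := by
  symm
  refine (eq_extend_iff (f.trans g) _ s _).2 ⟨by funext i; simp, fun w hw => ?_⟩
  by_cases h : ∃ v, g v = w
  · obtain ⟨v, rfl⟩ := h
    rw [ext0_apply, ext0_of_notMem]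
    intro i hi
    exact hw i (by simp [hi])
  · exact ext0_of_notMem _ _ (by simpa using h)

theorem load_trans {I W V : Type} [Fintype I] [Fintype W] [DecidableEq W] [Fintype V]
    [DecidableEq V] (f : I ↪ W) (g : W ↪ V) (ρ : Op I) :
    load (f.trans g) ρ = load g (load f ρ) := by
  have : loadL (f.trans g) = loadL g ∘ₗ loadL f := op_linearMap_ext fun s t => by
    change load (f.trans g) (bk s t) = load g (load f (bk s t))
    simp only [load_bk, ext0_trans]
  exact LinearMap.congr_fun this ρ

theorem keep_zero {J W : Type} [Fintype J] [Fintype W] [DecidableEq W] (f : J ↪ W) :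
    keep f (0 : Op W) = 0 := map_zero (keepL f)

theorem keep_trans {I W V : Type} [Fintype I] [Fintype W] [DecidableEq W] [Fintype V]
    [DecidableEq V] (f : I ↪ W) (g : W ↪ V) (ρ : Op V) :
    keep (f.trans g) ρ = keep f (keep g ρ) := by
  classical
  have : keepL (f.trans g) = keepL f ∘ₗ keepL g := op_linearMap_ext fun s t => by
    change keep (f.trans g) (bk s t) = keep f (keep g (bk s t))
    rw [keep_bk, keep_bk]
    by_cases h : ∀ w, (∀ j, g j ≠ w) → s w = t w
    · rw [if_pos h, keep_bk]
      refine if_congr ⟨fun h1 w hw => ?_, fun h1 w hw => ?_⟩ rfl rfl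
      · exact h1 (g w) fun i hi => hw i (g.injective hi)
      · by_cases hv : ∃ v, g v = w
        · obtain ⟨v, rfl⟩ := hv
          exact h1 v fun i hi => hw i (by simp [hi])
        · exact h w (by simpa using hv)
    · rw [if_neg h, if_neg, keep_zero]
      exact fun h1 => h fun w hw => h1 w fun i => hw (f i)
  exact LinearMap.congr_fun this ρ

namespace Circuit

variable {𝒢 : Set (Matrix.unitaryGroup Bool ℂ)} {a b : ℕ} {I J K I₁ J₁ : Type}

theorem run_eq [Fintype I] [Fintype J] (C : Circuit 𝒢 a b I J) (𝓞 : Oracle a b) (ρ : Op I) :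
    C.run 𝓞 ρ = keep C.out (acts 𝓞 C.gates (load C.inp ρ)) := by
  rw [run, foldl_apply_eq_acts]

/-- The quantum operation of a circuit as a linear map. -/
noncomputable def runL [Fintype I] [Fintype J] (C : Circuit 𝒢 a b I J) (𝓞 : Oracle a b) :
    Op I →ₗ[ℂ] Op J := keepL C.out ∘ₗ acts 𝓞 C.gates ∘ₗ loadL C.inp

theorem runL_apply [Fintype I] [Fintype J] (C : Circuit 𝒢 a b I J) (𝓞 : Oracle a b) (ρ : Op I) :
    C.runL 𝓞 ρ = C.run 𝓞 ρ := (run_eq C 𝓞 ρ).symm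

theorem tr_run [Fintype I] [Fintype J] (C : Circuit 𝒢 a b I J) (𝓞 : Oracle a b) (ρ : Op I) :
    tr (C.run 𝓞 ρ) = tr ρ := by
  rw [run_eq, tr_keep, tr_acts, tr_load]

theorem psd_run [Fintype I] [Fintype J] (C : Circuit 𝒢 a b I J) (𝓞 : Oracle a b) {ρ : Op I}
    (h : PSD ρ) : PSD (C.run 𝓞 ρ) := by
  rw [run_eq]
  exact ((h.load _).acts _ _).keep _

/-- The circuit consisting of a sequence of gates. -/
def ofGates {W : Type} [Fintype W] [DecidableEq W] (gs : List (Gate 𝒢 a b W)) :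
    Circuit 𝒢 a b W W where
  Wire := W
  fintypeWire := inferInstance
  decEqWire := inferInstance
  inp := Function.Embedding.refl W
  out := Function.Embedding.refl W
  gates := gs

/-- The circuit that adds wires in `|0⟩`. -/
def ofLoad {W : Type} [Fintype W] [DecidableEq W] (f : I ↪ W) : Circuit 𝒢 a b I W where
  Wire := W
  fintypeWire := inferInstance
  decEqWire := inferInstance
  inp := f
  out := Function.Embedding.refl W
  gates := []

/-- The circuit that discards wires. -/
def ofKeep {W : Type} [Fintype W] [DecidableEq W] (f : J ↪ W) : Circuit 𝒢 a b W J where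
  Wire := W
  fintypeWire := inferInstance
  decEqWire := inferInstance
  inp := Function.Embedding.refl W
  out := f
  gates := []

theorem load_refl {W : Type} [Fintype W] [DecidableEq W] (ρ : Op W) :
    load (Function.Embedding.refl W) ρ = ρ := by
  funext s t
  rw [load, if_pos]
  · rfl
  · intro w h; exact absurd rfl (h w)

theorem keep_refl {W : Type} [Fintype W] [DecidableEq W] (ρ : Op W) :
    keep (Function.Embedding.refl W) ρ = ρ := by
  classical
  have : keepL (Function.Embedding.refl W) = LinearMap.id := op_linearMap_ext fun s t => by
    change keep (Function.Embedding.refl W) (bk s t) = bk s t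
    rw [keep_bk, if_pos]
    · rfl
    · intro w h; exact absurd rfl (h w)
  exact LinearMap.congr_fun this ρ

@[simp] theorem run_ofGates {W : Type} [Fintype W] [DecidableEq W] (gs : List (Gate 𝒢 a b W))
    (𝓞 : Oracle a b) (ρ : Op W) : (ofGates gs).run 𝓞 ρ = acts 𝓞 gs ρ := by
  rw [run_eq]
  exact (keep_refl _).trans (congrArg _ (load_refl ρ))

@[simp] theorem run_ofLoad {W : Type} [Fintype I] [Fintype W] [DecidableEq W] (f : I ↪ W)
    (𝓞 : Oracle a b) (ρ : Op I) : (ofLoad f : Circuit 𝒢 a b I W).run 𝓞 ρ = load f ρ := by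
  rw [run_eq]
  exact keep_refl _

@[simp] theorem run_ofKeep {W : Type} [Fintype J] [Fintype W] [DecidableEq W] (f : J ↪ W)
    (𝓞 : Oracle a b) (ρ : Op W) : (ofKeep f : Circuit 𝒢 a b W J).run 𝓞 ρ = keep f ρ := by
  rw [run_eq]
  exact congrArg _ (load_refl ρ)

theorem size_ofGates {W : Type} [Fintype W] [DecidableEq W] (gs : List (Gate 𝒢 a b W)) :
    (ofGates gs).size = Fintype.card W + gs.length := rfl

theorem size_ofLoad {W : Type} [Fintype W] [DecidableEq W] (f : I ↪ W) :
    (ofLoad f : Circuit 𝒢 a b I W).size = Fintype.card W := rfl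

theorem size_ofKeep {W : Type} [Fintype W] [DecidableEq W] (f : J ↪ W) :
    (ofKeep f : Circuit 𝒢 a b W J).size = Fintype.card W := rfl

theorem load_equiv {I J : Type} [Fintype I] [Fintype J] [DecidableEq J] (e : I ≃ J) (ρ : Op I) :
    load e.toEmbedding ρ = relabel e ρ := by
  funext s t
  rw [load, if_pos]
  · rfl
  · intro w h; exact absurd (e.apply_symm_apply w) (h _)

/-- The circuit that relabels wires. -/
def ofEquiv [Fintype J] [DecidableEq J] (e : I ≃ J) : Circuit 𝒢 a b I J := ofLoad e.toEmbedding

@[simp] theorem run_ofEquiv [Fintype I] [Fintype J] [DecidableEq J] (e : I ≃ J)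
    (𝓞 : Oracle a b) (ρ : Op I) : (ofEquiv e : Circuit 𝒢 a b I J).run 𝓞 ρ = relabel e ρ := by
  rw [ofEquiv, run_ofLoad, load_equiv]

/-! ### Composition of circuits -/

/-- The wires outside the image of `g`. -/
def Rest {J V : Type} (g : J ↪ V) : Type := {v : V // ∀ j, g j ≠ v}

noncomputable instance {J V : Type} (g : J ↪ V) [Fintype V] : Fintype (Rest g) := by
  classical
  exact inferInstanceAs (Fintype {v : V // ∀ j, g j ≠ v})

noncomputable instance {J V : Type} (g : J ↪ V) : DecidableEq (Rest g) := Classical.decEq _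

theorem card_rest_le {J V : Type} (g : J ↪ V) [Fintype V] :
    Fintype.card (Rest g) ≤ Fintype.card V :=
  Fintype.card_le_of_injective (fun v => v.1) Subtype.val_injective

open Classical in
/-- The underlying function of `compEmb`. -/
noncomputable def compFun {W V : Type} (f : J ↪ W) (g : J ↪ V) (v : V) :
    W ⊕ Rest g :=
  if h : ∃ j, g j = v then Sum.inl (f h.choose) else Sum.inr ⟨v, by simpa using h⟩

/-- The embedding of the wires of the second circuit of a composition: its input wires are
identified with the output wires of the first. -/
noncomputable def compEmb {W V : Type} (f : J ↪ W) (g : J ↪ V) :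
    V ↪ W ⊕ Rest g := by
  refine ⟨compFun f g, ?_⟩
  intro v w hvw
  by_cases hv : ∃ j, g j = v <;> by_cases hw : ∃ j, g j = w
  · simp only [compFun, dif_pos hv, dif_pos hw] at hvw
    rw [← hv.choose_spec, ← hw.choose_spec, f.injective (Sum.inl_injective hvw)]
  · simp [compFun, dif_pos hv, dif_neg hw] at hvw
  · simp [compFun, dif_neg hv, dif_pos hw] at hvw
  · simp only [compFun, dif_neg hv, dif_neg hw] at hvw
    exact congrArg Subtype.val (Sum.inr_injective hvw)

theorem compEmb_apply {W V : Type} (f : J ↪ W) (g : J ↪ V) (j : J) :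
    compEmb f g (g j) = Sum.inl (f j) := by
  have h : ∃ j', g j' = g j := ⟨j, rfl⟩
  change compFun f g (g j) = _
  rw [compFun, dif_pos h, g.injective h.choose_spec]

theorem compEmb_of_notMem {W V : Type} (f : J ↪ W) (g : J ↪ V) (v : V) (h : ∀ j, g j ≠ v) :
    compEmb f g v = Sum.inr ⟨v, h⟩ := by
  change compFun f g v = _
  rw [compFun, dif_neg (by simpa using h)]

/-- Under `compEmb` the input wires of the second circuit are the output wires of the first, and its
auxiliary wires are the fresh ones, still in `|0⟩`. Exactly the non-output wires of the first
circuit are missed, and these get traced out. -/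
theorem keep_compEmb_load {W V : Type} {g : J ↪ V} [Fintype J] [Fintype W] [DecidableEq W] [Fintype V]
    [DecidableEq V]
    (f : J ↪ W) (ρ : Op W) :
    keep (compEmb f g) (load Function.Embedding.inl ρ) = load g (keep f ρ) := by
  classical
  have hext : ∀ s : W → Bool, (fun v => ext0 (Function.Embedding.inl :
      W ↪ W ⊕ Rest g) s (compEmb f g v)) = ext0 g fun j => s (f j) := by
    intro s
    refine (eq_extend_iff g _ _ _).2 ⟨?_, fun v hv => ?_⟩
    · funext j
      rw [compEmb_apply]
      exact ext0_apply Function.Embedding.inl s (f j)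
    · rw [compEmb_of_notMem f g v hv, ext0_of_notMem]
      intro w; simp
  have : keepL (compEmb f g) ∘ₗ loadL Function.Embedding.inl = loadL g ∘ₗ keepL f :=
    op_linearMap_ext fun s t => by
      change keep (compEmb f g) (load Function.Embedding.inl (bk s t)) = load g (keep f (bk s t))
      rw [load_bk, keep_bk, keep_bk]
      simp only [hext]
      have hc : (∀ w, (∀ v, compEmb f g v ≠ w) → ext0 Function.Embedding.inl s w =
          ext0 Function.Embedding.inl t w) ↔ ∀ w, (∀ j, f j ≠ w) → s w = t w := by
        constructor
        · intro h w hw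
          have h1 := h (Sum.inl w) fun v hv => by
            by_cases hg : ∃ j, g j = v
            · obtain ⟨j, rfl⟩ := hg
              rw [compEmb_apply] at hv
              exact hw j (Sum.inl_injective hv)
            · rw [compEmb_of_notMem f g v (by simpa using hg)] at hv
              simp at hv
          rwa [show (Sum.inl w : W ⊕ Rest g) = Function.Embedding.inl w from rfl,
            ext0_apply, ext0_apply] at h1
        · intro h w hw
          rcases w with w | v
          · have h1 := h w fun j hj => hw (g j) (by rw [compEmb_apply, hj])
            change ext0 Function.Embedding.inl s (Function.Embedding.inl w) =
              ext0 Function.Embedding.inl t (Function.Embedding.inl w)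
            rw [ext0_apply, ext0_apply, h1]
          · exact absurd (compEmb_of_notMem f g v.1 v.2) (hw v.1)
      by_cases h : ∀ w, (∀ j, f j ≠ w) → s w = t w
      · rw [if_pos h, if_pos (hc.2 h), load_bk]
      · rw [if_neg h, if_neg fun h' => h (hc.1 h')]
        exact (map_zero (loadL g)).symm
  exact LinearMap.congr_fun this ρ

/-- The circuit with the given wires, input, output and gates. -/
def build {W : Type} [Fintype W] [DecidableEq W] (inp : I ↪ W) (out : J ↪ W)
    (gs : List (Gate 𝒢 a b W)) : Circuit 𝒢 a b I J where
  Wire := W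
  fintypeWire := inferInstance
  decEqWire := inferInstance
  inp := inp
  out := out
  gates := gs

theorem run_build {W : Type} [Fintype W] [DecidableEq W] [Fintype I] [Fintype J] (inp : I ↪ W)
    (out : J ↪ W) (gs : List (Gate 𝒢 a b W)) (𝓞 : Oracle a b) (ρ : Op I) :
    (build inp out gs).run 𝓞 ρ = keep out (acts 𝓞 gs (load inp ρ)) :=
  run_eq _ _ _

theorem size_build {W : Type} [Fintype W] [DecidableEq W] (inp : I ↪ W)
    (out : J ↪ W) (gs : List (Gate 𝒢 a b W)) :
    (build inp out gs).size = Fintype.card W + gs.length := rfl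

open Classical in
/-- The composition of circuits. -/
noncomputable def comp (C : Circuit 𝒢 a b I J) (D : Circuit 𝒢 a b J K) : Circuit 𝒢 a b I K :=
  build (W := C.Wire ⊕ Rest D.inp)
    (C.inp.trans Function.Embedding.inl) (D.out.trans (compEmb C.out D.inp))
    (C.gates.map (Gate.map Function.Embedding.inl) ++
      D.gates.map (Gate.map (compEmb C.out D.inp)))

-- The composite prepares all auxiliary wires at the start and discards at the end. The first gates
-- move inside the load, the second gates outside the discarding of the first circuit's leftovers,
-- and `keep_compEmb_load` identifies what remains in the middle.
@[simp] theorem run_comp [Fintype I] [Fintype J] [Fintype K] (C : Circuit 𝒢 a b I J)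
    (D : Circuit 𝒢 a b J K) (𝓞 : Oracle a b) (ρ : Op I) :
    (C.comp D).run 𝓞 ρ = D.run 𝓞 (C.run 𝓞 ρ) := by
  rw [run_eq C, run_eq D, comp, run_build, acts_append, load_trans, acts_load, keep_trans,
    keep_acts, keep_compEmb_load]

theorem size_comp_le (C : Circuit 𝒢 a b I J) (D : Circuit 𝒢 a b J K) :
    (C.comp D).size ≤ C.size + D.size := by
  have h := card_rest_le D.inp
  rw [comp, size_build, Fintype.card_sum, List.length_append, List.length_map, List.length_map,
    size, size]
  omega

/-! ### Circuits side by side -/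

theorem load_kron {W V : Type} [Fintype I] [Fintype I₁] [Fintype W] [DecidableEq W] [Fintype V]
    [DecidableEq V] (f : I ↪ W) (g : I₁ ↪ V) (ρ : Op I) (σ : Op I₁) :
    load (f.sumMap g) (kron ρ σ) = kron (load f ρ) (load g σ) := by
  funext s t
  simp only [load, kron]
  have h : (∀ w, (∀ i, f.sumMap g i ≠ w) → s w = false ∧ t w = false) ↔
      (∀ w, (∀ i, f i ≠ w) → s (Sum.inl w) = false ∧ t (Sum.inl w) = false) ∧
      (∀ w, (∀ i, g i ≠ w) → s (Sum.inr w) = false ∧ t (Sum.inr w) = false) := by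
    simp [Function.Embedding.sumMap, Sum.forall]
  by_cases h1 : ∀ w, (∀ i, f i ≠ w) → s (Sum.inl w) = false ∧ t (Sum.inl w) = false
  · by_cases h2 : ∀ w, (∀ i, g i ≠ w) → s (Sum.inr w) = false ∧ t (Sum.inr w) = false
    · rw [if_pos (h.2 ⟨h1, h2⟩), if_pos h1, if_pos h2]
      rfl
    · rw [if_neg fun h' => h2 (h.1 h').2, if_neg h2, mul_zero]
  · rw [if_neg fun h' => h1 (h.1 h').1, if_neg h1, zero_mul]

theorem keep_kron {W V : Type} [Fintype J] [Fintype J₁] [Fintype W] [DecidableEq W] [Fintype V]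
    [DecidableEq V] (f : J ↪ W) (g : J₁ ↪ V) (ρ : Op W) (σ : Op V) :
    keep (f.sumMap g) (kron ρ σ) = kron (keep f ρ) (keep g σ) := by
  have key : (kronB W V).compr₂ (keepL (f.sumMap g)) =
      ((kronB J J₁).comp (keepL f)).compl₂ (keepL g) := by
    refine op_linearMap_ext fun s t => op_linearMap_ext fun s' t' => ?_
    change keep (f.sumMap g) (kron (bk s t) (bk s' t')) =
      kron (keep f (bk s t)) (keep g (bk s' t'))
    have h : (∀ w, (∀ j, f.sumMap g j ≠ w) → Sum.elim s s' w = Sum.elim t t' w) ↔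
        (∀ w, (∀ j, f j ≠ w) → s w = t w) ∧ (∀ w, (∀ j, g j ≠ w) → s' w = t' w) := by
      simp [Function.Embedding.sumMap, Sum.forall]
    rw [kron_bk, keep_bk, keep_bk, keep_bk]
    by_cases h1 : ∀ w, (∀ j, f j ≠ w) → s w = t w
    · by_cases h2 : ∀ w, (∀ j, g j ≠ w) → s' w = t' w
      · rw [if_pos (h.2 ⟨h1, h2⟩), if_pos h1, if_pos h2, kron_bk]
        congr 1 <;> funext j <;> cases j <;> rfl
      · rw [if_neg fun h' => h2 (h.1 h').2, if_neg h2, kron_zero_right]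
    · rw [if_neg fun h' => h1 (h.1 h').1, if_neg h1, kron_zero_left]
  exact LinearMap.congr_fun (LinearMap.congr_fun key ρ) σ

theorem acts_inl_kron {W V : Type} [Fintype W] [DecidableEq W] [Fintype V] [DecidableEq V]
    (𝓞 : Oracle a b) (gs : List (Gate 𝒢 a b W)) (ρ : Op W) (σ : Op V) :
    acts 𝓞 (gs.map (Gate.map Function.Embedding.inl)) (kron ρ σ) = kron (acts 𝓞 gs ρ) σ := by
  funext s t
  rw [acts_map_apply]
  have h : slice (Function.Embedding.inl : W ↪ W ⊕ V) s t (kron ρ σ) =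
      σ (fun v => s (Sum.inr v)) (fun v => t (Sum.inr v)) • ρ := by
    funext x y
    have h1 : ∀ (x : W → Bool) (s : W ⊕ V → Bool) w,
        Function.extend (Function.Embedding.inl : W ↪ W ⊕ V) x s (Sum.inl w) = x w :=
      fun x s w => extend_emb_apply (Function.Embedding.inl : W ↪ W ⊕ V) x s w
    have h2 : ∀ (x : W → Bool) (s : W ⊕ V → Bool) v,
        Function.extend (Function.Embedding.inl : W ↪ W ⊕ V) x s (Sum.inr v) = s (Sum.inr v) :=
      fun x s v => extend_emb_of_notMem _ _ _ (by simp)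
    simp only [slice, kron, h1, h2, Matrix.smul_apply, smul_eq_mul, mul_comm]
  rw [h, map_smul]
  simp [kron, mul_comm]

theorem acts_inr_kron {W V : Type} [Fintype W] [DecidableEq W] [Fintype V] [DecidableEq V]
    (𝓞 : Oracle a b) (gs : List (Gate 𝒢 a b V)) (ρ : Op W) (σ : Op V) :
    acts 𝓞 (gs.map (Gate.map Function.Embedding.inr)) (kron ρ σ) = kron ρ (acts 𝓞 gs σ) := by
  funext s t
  rw [acts_map_apply]
  have h : slice (Function.Embedding.inr : V ↪ W ⊕ V) s t (kron ρ σ) =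
      ρ (fun v => s (Sum.inl v)) (fun v => t (Sum.inl v)) • σ := by
    funext x y
    have h1 : ∀ (x : V → Bool) (s : W ⊕ V → Bool) w,
        Function.extend (Function.Embedding.inr : V ↪ W ⊕ V) x s (Sum.inr w) = x w :=
      fun x s w => extend_emb_apply (Function.Embedding.inr : V ↪ W ⊕ V) x s w
    have h2 : ∀ (x : V → Bool) (s : W ⊕ V → Bool) v,
        Function.extend (Function.Embedding.inr : V ↪ W ⊕ V) x s (Sum.inl v) = s (Sum.inl v) :=
      fun x s v => extend_emb_of_notMem _ _ _ (by simp)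
    simp only [slice, kron, h1, h2, Matrix.smul_apply, smul_eq_mul]
  rw [h, map_smul]
  simp [kron]

@[simp] theorem run_par_kron [Fintype I] [Fintype J] [Fintype I₁] [Fintype J₁]
    (C : Circuit 𝒢 a b I J) (D : Circuit 𝒢 a b I₁ J₁) (𝓞 : Oracle a b) (ρ : Op I) (σ : Op I₁) :
    (C.par D).run 𝓞 (kron ρ σ) = kron (C.run 𝓞 ρ) (D.run 𝓞 σ) := by
  rw [run_eq C, run_eq D]
  have h : C.par D = build (C.inp.sumMap D.inp) (C.out.sumMap D.out)
    (C.gates.map (Gate.map Function.Embedding.inl) ++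
      D.gates.map (Gate.map Function.Embedding.inr)) := rfl
  rw [h, run_build, acts_append, load_kron, acts_inl_kron, acts_inr_kron, keep_kron]

theorem size_par (C : Circuit 𝒢 a b I J) (D : Circuit 𝒢 a b I₁ J₁) :
    (C.par D).size = C.size + D.size := by
  have h : C.par D = build (C.inp.sumMap D.inp) (C.out.sumMap D.out)
    (C.gates.map (Gate.map Function.Embedding.inl) ++
      D.gates.map (Gate.map Function.Embedding.inr)) := rfl
  rw [h, size_build, Fintype.card_sum, List.length_append, List.length_map, List.length_map,
    size, size]
  omega

/-- The circuit that acts on the first of two registers. -/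
def onLeft (C : Circuit 𝒢 a b I J) (K : Type) [Fintype K] [DecidableEq K] :
    Circuit 𝒢 a b (I ⊕ K) (J ⊕ K) := C.par (ofGates [])

@[simp] theorem run_onLeft_kron [Fintype I] [Fintype J] [Fintype K] [DecidableEq K]
    (C : Circuit 𝒢 a b I J) (𝓞 : Oracle a b) (ρ : Op I) (σ : Op K) :
    (C.onLeft K).run 𝓞 (kron ρ σ) = kron (C.run 𝓞 ρ) σ := by
  simp [onLeft]

theorem size_onLeft [Fintype K] [DecidableEq K] (C : Circuit 𝒢 a b I J) :
    (C.onLeft K).size = C.size + Fintype.card K := by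
  simp [onLeft, size_par, size_ofGates]

/-- The circuit that acts on the second of two registers. -/
def onRight (C : Circuit 𝒢 a b I J) (K : Type) [Fintype K] [DecidableEq K] :
    Circuit 𝒢 a b (K ⊕ I) (K ⊕ J) := (ofGates []).par C

@[simp] theorem run_onRight_kron [Fintype I] [Fintype J] [Fintype K] [DecidableEq K]
    (C : Circuit 𝒢 a b I J) (𝓞 : Oracle a b) (ρ : Op I) (σ : Op K) :
    (C.onRight K).run 𝓞 (kron σ ρ) = kron σ (C.run 𝓞 ρ) := by
  simp [onRight]

theorem size_onRight [Fintype K] [DecidableEq K] (C : Circuit 𝒢 a b I J) :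
    (C.onRight K).size = C.size + Fintype.card K := by
  simp [onRight, size_par, size_ofGates, add_comm]

theorem run_sum [Fintype I] [Fintype J] {ι : Type} (C : Circuit 𝒢 a b I J) (𝓞 : Oracle a b)
    (S : Finset ι) (f : ι → Op I) : C.run 𝓞 (∑ i ∈ S, f i) = ∑ i ∈ S, C.run 𝓞 (f i) := by
  simp only [← runL_apply, map_sum]

theorem run_smul [Fintype I] [Fintype J] (C : Circuit 𝒢 a b I J) (𝓞 : Oracle a b)
    (c : ℂ) (ρ : Op I) : C.run 𝓞 (c • ρ) = c • C.run 𝓞 ρ := by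
  simp only [← runL_apply, map_smul]

end Circuit

/-! ### Changing the oracle of a circuit -/

namespace Gate

variable {𝒢 : Set (Matrix.unitaryGroup Bool ℂ)} {a b a' b' : ℕ} {W : Type}

/-- The same gate in a model with another oracle; queries have no counterpart. -/
def retarget : Gate 𝒢 a b W → Option (Gate 𝒢 a' b' W)
  | x i => some (x i)
  | h i => some (h i)
  | t i => some (t i)
  | cnot c i hc => some (cnot c i hc)
  | toffoli c d i hcd hc hd => some (toffoli c d i hcd hc hd)
  | single U hU i => some (single U hU i)
  | measure i => some (measure i)
  | query _ => none

theorem apply_of_retarget [Fintype W] [DecidableEq W] {g : Gate 𝒢 a b W} {g' : Gate 𝒢 a' b' W}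
    (h : g.retarget = some g') (𝓞 : Oracle a b) (𝓞' : Oracle a' b') (ρ : Op W) :
    g'.apply 𝓞' ρ = g.apply 𝓞 ρ := by
  cases g <;> simp only [retarget, Option.some.injEq, reduceCtorEq] at h <;> subst h <;> rfl

theorem apply_of_retarget_eq_none [Fintype W] [DecidableEq W] {g : Gate 𝒢 0 0 W}
    (h : (g.retarget : Option (Gate 𝒢 a' b' W)) = none) (𝓞 : Oracle 0 0) (ρ : Op W) :
    g.apply 𝓞 ρ = ρ := by
  cases g <;> simp only [retarget, reduceCtorEq] at h
  exact apply_query_zero _ _ _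

end Gate

namespace Circuit

variable {𝒢 : Set (Matrix.unitaryGroup Bool ℂ)} {a b : ℕ} {I J : Type}

/-- A circuit of the plain model, used in the oracle model. -/
def lift (C : Circuit 𝒢 0 0 I J) (a b : ℕ) : Circuit 𝒢 a b I J :=
  build C.inp C.out (C.gates.filterMap Gate.retarget)

/-- The gates dropped are queries of lengths `0` and `0`, which act as the identity. -/
theorem acts_filterMap_retarget {W : Type} [Fintype W] [DecidableEq W] (gs : List (Gate 𝒢 0 0 W))
    (𝓞 : Oracle a b) (𝓞' : Oracle 0 0) (ρ : Op W) :
    acts 𝓞 (gs.filterMap Gate.retarget) ρ = acts 𝓞' gs ρ := by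
  induction gs generalizing ρ with
  | nil => rfl
  | cons g gs ih =>
    rw [acts_cons]
    rcases h : (g.retarget : Option (Gate 𝒢 a b W)) with _ | g'
    · rw [List.filterMap_cons_none h, ih, Gate.apply_of_retarget_eq_none h]
    · rw [List.filterMap_cons_some h, acts_cons, ih, Gate.apply_of_retarget h 𝓞']

@[simp] theorem run_lift [Fintype I] [Fintype J] (C : Circuit 𝒢 0 0 I J) (𝓞 : Oracle a b)
    (ρ : Op I) : (C.lift a b).run 𝓞 ρ = C.run id ρ := by
  rw [lift, run_build, acts_filterMap_retarget _ _ id, run_eq]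

theorem size_lift_le (C : Circuit 𝒢 0 0 I J) : (C.lift a b).size ≤ C.size := by
  rw [lift, size_build, size]
  gcongr
  exact List.length_filterMap_le _ _

end Circuit

/-! ### Gates on basis operators -/

section gates

variable {𝒢 : Set (Matrix.unitaryGroup Bool ℂ)} {a b : ℕ} {W : Type} [Fintype W] [DecidableEq W]

theorem conjBy_basisMap_bk {g : (W → Bool) → (W → Bool)} (hg : Function.Involutive g)
    (s t : W → Bool) : conjBy (basisMap g) (bk s t) = bk (g s) (g t) := by
  funext u v
  rw [conjBy_basisMap_apply hg]
  have h : ∀ u s, g u = s ↔ u = g s := fun u s =>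
    ⟨fun h => by rw [← h, hg], fun h => by rw [h, hg]⟩
  by_cases h1 : u = g s ∧ v = g t
  · rw [bk_of_eq h1, bk_of_eq ⟨(h _ _).2 h1.1, (h _ _).2 h1.2⟩]
  · rw [bk_of_ne h1, bk_of_ne fun h2 => h1 ⟨(h _ _).1 h2.1, (h _ _).1 h2.2⟩]

theorem onWire_matX (i : W) :
    onWire matX i = basisMap fun s : W → Bool => Function.update s i (!s i) := by
  funext s t
  simp only [onWire, matX, basisMap]
  by_cases h : ∀ w, w ≠ i → s w = t w
  · rw [if_pos h]
    by_cases h1 : s i = t i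
    · rw [if_pos h1, if_neg]
      intro h2
      have := congrFun h2 i
      rw [Function.update_self, h1] at this
      cases h3 : t i <;> simp [h3] at this
    · rw [if_neg h1, if_pos]
      funext w
      by_cases hw : w = i
      · subst hw
        rw [Function.update_self]
        cases h3 : t w <;> cases h4 : s w <;> simp_all
      · rw [Function.update_of_ne hw, h w hw]
  · rw [if_neg h, if_neg]
    intro h2
    exact h fun w hw => by rw [h2, Function.update_of_ne hw]

namespace Gate

theorem apply_x_bk (𝓞 : Oracle a b) (i : W) (s t : W → Bool) :
    (x i : Gate 𝒢 a b W).apply 𝓞 (bk s t) =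
      bk (Function.update s i (!s i)) (Function.update t i (!t i)) := by
  change conjBy (onWire matX i) _ = _
  rw [onWire_matX, conjBy_basisMap_bk]
  intro s
  simp

theorem apply_cnot_bk (𝓞 : Oracle a b) (c i : W) (hc : c ≠ i) (s t : W → Bool) :
    (cnot c i hc : Gate 𝒢 a b W).apply 𝓞 (bk s t) =
      bk (Function.update s i (xor (s i) (s c))) (Function.update t i (xor (t i) (t c))) :=
  conjBy_basisMap_bk (cnot_involutive hc) s t

theorem apply_toffoli_bk (𝓞 : Oracle a b) (c d i : W) (hcd : c ≠ d) (hc : c ≠ i) (hd : d ≠ i)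
    (s t : W → Bool) : (toffoli c d i hcd hc hd : Gate 𝒢 a b W).apply 𝓞 (bk s t) =
      bk (Function.update s i (xor (s i) (s c && s d)))
        (Function.update t i (xor (t i) (t c && t d))) :=
  conjBy_basisMap_bk (toffoli_involutive hc hd) s t

theorem apply_query_ketbra (𝓞 : Oracle a b) (e : Fin a ⊕ Fin b ↪ W) (s : W → Bool) :
    (query e : Gate 𝒢 a b W).apply 𝓞 (ketbra s) = ketbra (xorAnswer 𝓞 e s) := by
  rw [apply_query, ketbra_eq_bk, ketbra_eq_bk, ← conjBy_basisMap_bk (xorAnswer_involutive 𝓞 e)]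
  congr 1
  funext u v
  rw [dephase]
  by_cases h : u = s ∧ v = s
  · rw [if_pos]
    intro k; rw [h.1, h.2]
  · rw [bk_of_ne h, ite_self]

end Gate

/-- The list of `CNOT` gates with controls `src j` and targets `tgt j`. -/
def cnotList {J : Type} (src : J → W) (tgt : J ↪ W) (h : ∀ j j', src j ≠ tgt j') (l : List J) :
    List (Gate 𝒢 a b W) := l.map fun j => Gate.cnot (src j) (tgt j) (h j j)

/-- No source is a target, so the gates do not influence each other's controls. Stating the result
through an unspecified map `F` lets the induction carry only its values on and off the treated
targets. -/
theorem acts_cnotList_bk_aux {J : Type} (src : J → W) (tgt : J ↪ W)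
    (h : ∀ j j', src j ≠ tgt j') (𝓞 : Oracle a b) (l : List J) (hl : l.Nodup) :
    ∃ F : (W → Bool) → (W → Bool),
      (∀ s t, acts 𝓞 (cnotList (𝒢 := 𝒢) src tgt h l) (bk s t) = bk (F s) (F t)) ∧
      (∀ s w, (∀ j ∈ l, tgt j ≠ w) → F s w = s w) ∧
      ∀ s, ∀ j ∈ l, F s (tgt j) = xor (s (tgt j)) (s (src j)) := by
  induction l with
  | nil => exact ⟨id, fun s t => rfl, fun _ _ _ => rfl, by simp⟩
  | cons j l ih =>
    obtain ⟨F, h1, h2, h3⟩ := ih hl.of_cons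
    have hj : j ∉ l := (List.nodup_cons.1 hl).1
    refine ⟨fun s => F (Function.update s (tgt j) (xor (s (tgt j)) (s (src j)))), ?_, ?_, ?_⟩
    · intro s t
      rw [cnotList, List.map_cons, acts_cons, Gate.apply_cnot_bk]
      exact h1 _ _
    · intro s w hw
      dsimp only
      rw [h2 _ _ fun j' hj' => hw j' (List.mem_cons_of_mem _ hj'), Function.update_of_ne]
      exact (hw j List.mem_cons_self).symm
    · intro s j' hj'
      dsimp only
      rcases List.mem_cons.1 hj' with rfl | hj'
      · rw [h2, Function.update_self]
        intro k hk hkj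
        exact hj (tgt.injective hkj ▸ hk)
      · rw [h3 _ j' hj', Function.update_of_ne (h j' j), Function.update_of_ne]
        intro hh
        exact hj (tgt.injective hh ▸ hj')

theorem acts_cnotList_bk {J : Type} [Fintype J] (src : J → W) (tgt : J ↪ W)
    (h : ∀ j j', src j ≠ tgt j') (𝓞 : Oracle a b) (s t : W → Bool) :
    acts 𝓞 (cnotList (𝒢 := 𝒢) src tgt h Finset.univ.toList) (bk s t) =
      bk (xorAt tgt (fun j => s (src j)) s) (xorAt tgt (fun j => t (src j)) t) := by
  obtain ⟨F, h1, h2, h3⟩ := acts_cnotList_bk_aux (𝒢 := 𝒢) src tgt h 𝓞 Finset.univ.toList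
    (Finset.nodup_toList _)
  have : ∀ s, F s = xorAt tgt (fun j => s (src j)) s := by
    intro s
    refine (eq_extend_iff tgt _ _ _).2 ⟨?_, fun w hw => h2 s w fun j _ => hw j⟩
    funext j
    exact h3 s j (by simp)
  rw [h1, this, this]

end gates

theorem dephase_of_eq {K W : Type} {f : K → W} {ρ : Op W} {s t : W → Bool}
    (h : ∀ k, s (f k) = t (f k)) : dephase f ρ s t = ρ s t := if_pos h

theorem dephase_of_ne {K W : Type} {f : K → W} {ρ : Op W} {s t : W → Bool}
    (h : ¬∀ k, s (f k) = t (f k)) : dephase f ρ s t = 0 := if_neg h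

theorem relabelL_apply {I J : Type} (e : I ≃ J) (ρ : Op I) : relabelL e ρ = relabel e ρ := rfl

theorem Circuit.size_ofEquiv {𝒢 : Set (Matrix.unitaryGroup Bool ℂ)} {a b : ℕ} {I J : Type}
    [Fintype J] [DecidableEq J] (e : I ≃ J) :
    (Circuit.ofEquiv e : Circuit 𝒢 a b I J).size = Fintype.card J := rfl

/-! ### Classical functions -/

/-- The string whose bits are copies of bits of `x` or constants. -/
def fan {U J : Type} (h : J → U ⊕ Bool) (x : U → Bool) : J → Bool := fun j => Sum.elim x id (h j)

section classical

variable {𝒢 : Set (Matrix.unitaryGroup Bool ℂ)} {a b : ℕ} {U V J K : Type}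
  [Fintype U] [DecidableEq U] [Fintype V] [DecidableEq V] [Fintype J] [DecidableEq J]
  [Fintype K] [DecidableEq K]

/-- The circuit that measures its input `x` and outputs `fan h x`. -/
noncomputable def fanCircuit (h : J → U ⊕ Bool) : Circuit 𝒢 a b U J :=
  Circuit.build (W := U ⊕ (Bool ⊕ J)) Function.Embedding.inl
    (Function.Embedding.inr.trans Function.Embedding.inr)
    -- The two wires indexed by `Bool` supply the constants: the one labelled `true` is flipped to
    -- `|1⟩`, the other stays `|0⟩`.
    (Gate.x (Sum.inr (Sum.inl true)) ::
      cnotList (fun j => Sum.elim Sum.inl (fun c => Sum.inr (Sum.inl c)) (h j))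
        (Function.Embedding.inr.trans Function.Embedding.inr)
        (fun j j' => by rcases h j with u | c <;> simp) Finset.univ.toList)

-- The copies are made by `CNOT`, and the input wires are then discarded. Discarding acts as a
-- measurement of the input, hence the zero for `s ≠ t`.
open Classical in
theorem run_fanCircuit_bk (h : J → U ⊕ Bool) (𝓞 : Oracle a b) (s t : U → Bool) :
    (fanCircuit h : Circuit 𝒢 a b U J).run 𝓞 (bk s t) =
      if s = t then ketbra (fan h s) else 0 := by
  have key : ∀ s : U → Bool, xorAt (Function.Embedding.inr.trans Function.Embedding.inr :
      J ↪ U ⊕ (Bool ⊕ J)) (fun j => Function.update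
        (ext0 (Function.Embedding.inl : U ↪ U ⊕ (Bool ⊕ J)) s) (Sum.inr (Sum.inl true))
        (!(ext0 (Function.Embedding.inl : U ↪ U ⊕ (Bool ⊕ J)) s) (Sum.inr (Sum.inl true)))
          (Sum.elim Sum.inl (fun c => Sum.inr (Sum.inl c)) (h j)))
      (Function.update (ext0 (Function.Embedding.inl : U ↪ U ⊕ (Bool ⊕ J)) s)
        (Sum.inr (Sum.inl true))
        (!(ext0 (Function.Embedding.inl : U ↪ U ⊕ (Bool ⊕ J)) s) (Sum.inr (Sum.inl true)))) =
      Sum.elim s (Sum.elim id (fan h s)) := by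
    intro s
    have h1 : ext0 (Function.Embedding.inl : U ↪ U ⊕ (Bool ⊕ J)) s =
        Sum.elim s fun _ => false := by
      symm
      refine (eq_extend_iff _ _ _ _).2 ⟨rfl, fun w hw => ?_⟩
      rcases w with w | w
      · exact absurd rfl (hw w)
      · rfl
    have h2 : Function.update (Sum.elim s fun _ => false : U ⊕ (Bool ⊕ J) → Bool)
        (Sum.inr (Sum.inl true)) (!(Sum.elim s fun _ => false : U ⊕ (Bool ⊕ J) → Bool)
          (Sum.inr (Sum.inl true))) = Sum.elim s (Sum.elim id fun _ => false) := by
      funext w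
      rcases w with w | w | w
      · simp
      · cases w <;> simp
      · simp
    rw [h1, h2]
    symm
    refine (eq_extend_iff _ _ _ _).2 ⟨?_, fun w hw => ?_⟩
    · funext j
      simp only [Function.Embedding.trans_apply, Function.Embedding.inr_apply, Sum.elim_inr,
        Bool.false_xor, fan]
      rcases h j with u | c <;> rfl
    · rcases w with w | w | w
      · rfl
      · rfl
      · exact absurd rfl (hw w)
  rw [fanCircuit, Circuit.run_build, load_bk, acts_cons, Gate.apply_x_bk, acts_cnotList_bk,
    key, key, keep_bk]
  by_cases hst : s = t
  · subst hst
    rw [if_pos rfl, if_pos fun _ _ => rfl, ketbra_eq_bk]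
    rfl
  · rw [if_neg hst, if_neg]
    intro h'
    apply hst
    funext u
    exact h' (Sum.inl u) (by simp)

@[simp] theorem run_fanCircuit_ketbra (h : J → U ⊕ Bool) (𝓞 : Oracle a b) (s : U → Bool) :
    (fanCircuit h : Circuit 𝒢 a b U J).run 𝓞 (ketbra s) = ketbra (fan h s) := by
  rw [ketbra_eq_bk, run_fanCircuit_bk, if_pos rfl]

theorem size_fanCircuit (h : J → U ⊕ Bool) :
    (fanCircuit h : Circuit 𝒢 a b U J).size = Fintype.card U + 2 * Fintype.card J + 3 := by
  rw [fanCircuit, Circuit.size_build]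
  simp [cnotList]
  omega

/-! ### Boolean functions with small circuits -/

variable (𝒢 a b) in
/-- Some circuit of size at most `n` computes the function `G`. -/
def Computes (G : (U → Bool) → (J → Bool)) (n : ℕ) : Prop :=
  ∃ C : Circuit 𝒢 a b U J, C.size ≤ n ∧ ∀ 𝓞 x, C.run 𝓞 (ketbra x) = ketbra (G x)

theorem Computes.mono {G : (U → Bool) → (J → Bool)} {m n : ℕ} (h : Computes 𝒢 a b G m)
    (hmn : m ≤ n) : Computes 𝒢 a b G n := by
  obtain ⟨C, h1, h2⟩ := h
  exact ⟨C, h1.trans hmn, h2⟩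

theorem computes_fan (h : J → U ⊕ Bool) :
    Computes 𝒢 a b (fan h) (Fintype.card U + 2 * Fintype.card J + 3) :=
  ⟨fanCircuit h, (size_fanCircuit h).le, fun 𝓞 x => run_fanCircuit_ketbra h 𝓞 x⟩

theorem Computes.comp {G : (U → Bool) → (V → Bool)} {H : (V → Bool) → (J → Bool)} {m n : ℕ}
    (hG : Computes 𝒢 a b G m) (hH : Computes 𝒢 a b H n) :
    Computes 𝒢 a b (fun x => H (G x)) (m + n) := by
  obtain ⟨C, h1, h2⟩ := hG
  obtain ⟨D, h3, h4⟩ := hH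
  exact ⟨C.comp D, (C.size_comp_le D).trans (add_le_add h1 h3), fun 𝓞 x => by
    rw [Circuit.run_comp, h2, h4]⟩

/-- The input is a basis state and may be duplicated; the two circuits then run side by side on the
copies. -/
theorem Computes.pair {G : (U → Bool) → (V → Bool)} {H : (U → Bool) → (J → Bool)} {m n : ℕ}
    (hG : Computes 𝒢 a b G m) (hH : Computes 𝒢 a b H n) :
    Computes 𝒢 a b (fun x => Sum.elim (G x) (H x)) (5 * Fintype.card U + 3 + m + n) := by
  obtain ⟨C, h1, h2⟩ := hG
  obtain ⟨D, h3, h4⟩ := hH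
  refine ⟨(fanCircuit (Sum.elim Sum.inl Sum.inl : U ⊕ U → U ⊕ Bool)).comp (C.par D), ?_, ?_⟩
  · refine (Circuit.size_comp_le _ _).trans ?_
    rw [size_fanCircuit, Circuit.size_par, Fintype.card_sum]
    omega
  · intro 𝓞 x
    have : fan (Sum.elim Sum.inl Sum.inl : U ⊕ U → U ⊕ Bool) x = Sum.elim x x := by
      funext u; cases u <;> rfl
    rw [Circuit.run_comp, run_fanCircuit_ketbra, this, ← kron_ketbra, Circuit.run_par_kron, h2,
      h4, kron_ketbra]

variable (𝒢 a b) in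
/-- Some circuit of size at most `n` computes the Boolean function `g`. -/
def ComputesBit (g : (U → Bool) → Bool) (n : ℕ) : Prop :=
  Computes 𝒢 a b (fun x (_ : Unit) => g x) n

theorem computesBit_var (u : U) :
    ComputesBit 𝒢 a b (fun x => x u) (5 * Fintype.card U + 10) :=
  (computes_fan (J := Unit) fun _ => Sum.inl u).mono (by simp; omega)

theorem computesBit_const (c : Bool) :
    ComputesBit 𝒢 a b (fun _ : U → Bool => c) (5 * Fintype.card U + 10) :=
  (computes_fan (U := U) (J := Unit) fun _ => Sum.inr c).mono (by simp; omega)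

theorem computes_xor : Computes 𝒢 a b
    (fun (x : Unit ⊕ Unit → Bool) (_ : Unit) => xor (x (Sum.inl ())) (x (Sum.inr ()))) 3 := by
  refine ⟨Circuit.build (W := Unit ⊕ Unit) (Function.Embedding.refl _) Function.Embedding.inl
    [Gate.cnot (Sum.inr ()) (Sum.inl ()) (by simp)], le_rfl, fun 𝓞 x => ?_⟩
  rw [Circuit.run_build, Circuit.load_refl, acts_cons, acts_nil, ketbra_eq_bk, Gate.apply_cnot_bk,
    keep_bk, if_pos fun _ _ => rfl, ketbra_eq_bk]
  simp

theorem computes_and : Computes 𝒢 a b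
    (fun (x : Unit ⊕ Unit → Bool) (_ : Unit) => x (Sum.inl ()) && x (Sum.inr ())) 4 := by
  refine ⟨Circuit.build (W := (Unit ⊕ Unit) ⊕ Unit) Function.Embedding.inl Function.Embedding.inr
    [Gate.toffoli (Sum.inl (Sum.inl ())) (Sum.inl (Sum.inr ())) (Sum.inr ()) (by simp) (by simp)
      (by simp)], le_rfl, fun 𝓞 x => ?_⟩
  rw [Circuit.run_build, acts_cons, acts_nil, ketbra_eq_bk, load_bk, Gate.apply_toffoli_bk,
    keep_bk, if_pos fun _ _ => rfl, ketbra_eq_bk]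
  have h1 : ∀ u, ext0 (Function.Embedding.inl : Unit ⊕ Unit ↪ (Unit ⊕ Unit) ⊕ Unit) x (Sum.inl u)
    = x u := fun u => ext0_apply (Function.Embedding.inl) x u
  have h2 : ∀ u, ext0 (Function.Embedding.inl : Unit ⊕ Unit ↪ (Unit ⊕ Unit) ⊕ Unit) x (Sum.inr u)
    = false := fun u => ext0_of_notMem _ _ (by simp)
  simp [h1, h2]

theorem ComputesBit.op {f g : (U → Bool) → Bool} {h : (Unit ⊕ Unit → Bool) → Bool} {m n : ℕ}
    (hf : ComputesBit 𝒢 a b f m) (hg : ComputesBit 𝒢 a b g n)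
    (hh : Computes 𝒢 a b (fun (x : Unit ⊕ Unit → Bool) (_ : Unit) => h x) 7) :
    ComputesBit 𝒢 a b (fun x => h (Sum.elim (fun _ => f x) fun _ => g x))
      (m + n + (5 * Fintype.card U + 10)) :=
  ((Computes.pair hf hg).comp hh).mono (by omega)

theorem ComputesBit.xor {f g : (U → Bool) → Bool} {m n : ℕ}
    (hf : ComputesBit 𝒢 a b f m) (hg : ComputesBit 𝒢 a b g n) :
    ComputesBit 𝒢 a b (fun x => Bool.xor (f x) (g x)) (m + n + (5 * Fintype.card U + 10)) :=
  hf.op (h := fun x => Bool.xor (x (Sum.inl ())) (x (Sum.inr ()))) hg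
    (computes_xor.mono (by norm_num))

theorem ComputesBit.and {f g : (U → Bool) → Bool} {m n : ℕ}
    (hf : ComputesBit 𝒢 a b f m) (hg : ComputesBit 𝒢 a b g n) :
    ComputesBit 𝒢 a b (fun x => f x && g x) (m + n + (5 * Fintype.card U + 10)) :=
  hf.op (h := fun x => x (Sum.inl ()) && x (Sum.inr ())) hg (computes_and.mono (by norm_num))

theorem ComputesBit.not {f : (U → Bool) → Bool} {m : ℕ} (hf : ComputesBit 𝒢 a b f m) :
    ComputesBit 𝒢 a b (fun x => !f x) (m + 2 * (5 * Fintype.card U + 10)) := by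
  have := (hf.xor (computesBit_const true)).mono (n := m + 2 * (5 * Fintype.card U + 10))
    (by omega)
  simpa [ComputesBit] using this

theorem ComputesBit.mono {f : (U → Bool) → Bool} {m n : ℕ} (h : ComputesBit 𝒢 a b f m)
    (hmn : m ≤ n) : ComputesBit 𝒢 a b f n := Computes.mono h hmn

/-- The conditional is the XOR of the exclusive terms `c && f` and `!c && g`. -/
theorem ComputesBit.cond {c f g : (U → Bool) → Bool} {k m n : ℕ}
    (hc : ComputesBit 𝒢 a b c k) (hf : ComputesBit 𝒢 a b f m) (hg : ComputesBit 𝒢 a b g n) :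
    ComputesBit 𝒢 a b (fun x => bif c x then f x else g x)
      (2 * k + m + n + 5 * (5 * Fintype.card U + 10)) := by
  have h := ((hc.and hf).xor (hc.not.and hg)).mono
    (n := 2 * k + m + n + 5 * (5 * Fintype.card U + 10)) (by omega)
  convert h using 2 with x
  cases c x <;> simp

theorem ComputesBit.all {ι : Type} (l : List ι) {f : ι → (U → Bool) → Bool} {n : ℕ}
    (hf : ∀ i, ComputesBit 𝒢 a b (f i) n) :
    ComputesBit 𝒢 a b (fun x => l.all fun i => f i x)
      ((l.length + 1) * (n + (5 * Fintype.card U + 10))) := by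
  induction l with
  | nil => exact (computesBit_const true).mono (by simp)
  | cons i l ih =>
    refine ((hf i).and ih).mono ?_
    rw [List.length_cons]
    ring_nf
    omega

theorem computes_fin {m n : ℕ} {G : (U → Bool) → (Fin m → Bool)}
    (hG : ∀ k, ComputesBit 𝒢 a b (fun x => G x k) n) :
    Computes 𝒢 a b G ((m + 1) * (n + 5 * Fintype.card U + 2 * m + 10)) := by
  induction m with
  | zero =>
    have h : Computes 𝒢 a b (fan fun j : Fin 0 => (j.elim0 : U ⊕ Bool))
        ((0 + 1) * (n + 5 * Fintype.card U + 2 * 0 + 10)) :=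
      (computes_fan (U := U) (J := Fin 0) fun j => j.elim0).mono (by simp; omega)
    have h' : G = fan fun j : Fin 0 => (j.elim0 : U ⊕ Bool) := by
      funext x
      exact Subsingleton.elim _ _
    rwa [h']
  | succ m ih =>
    have h1 := ih (G := fun x k => G x k.castSucc) fun k => hG k.castSucc
    have h2 : Computes 𝒢 a b (fun x (_ : Unit) => G x (Fin.last m)) n := hG (Fin.last m)
    -- The last bit is computed next to the others, and a fan reorders the wires. One bit at a time
    -- keeps the cost polynomial in `m`.
    have h3 := (h1.pair h2).comp (computes_fan (J := Fin (m + 1)) (U := Fin m ⊕ Unit)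
      fun k => Fin.lastCases (Sum.inl (Sum.inr ())) (fun k => Sum.inl (Sum.inl k)) k)
    have h4 : (fun x => fan (fun k => Fin.lastCases (Sum.inl (Sum.inr ()))
        (fun k => Sum.inl (Sum.inl k)) k) (Sum.elim (fun k : Fin m => G x k.castSucc)
          fun _ : Unit => G x (Fin.last m))) = G := by
      funext x k
      refine Fin.lastCases ?_ (fun k => ?_) k <;> simp [fan]
    rw [h4] at h3
    refine h3.mono ?_
    simp only [Fintype.card_sum, Fintype.card_fin, Fintype.card_unit]
    ring_nf
    omega

/-! ### Adjoining the output of a circuit without input -/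

omit [DecidableEq J] in
theorem relabel_sumEmpty (ρ : Op U) :
    relabel (Equiv.sumEmpty U (Fin 0)).symm ρ = kron ρ (ketbra Fin.elim0) := by
  funext s t
  have h : (fun j => s (Sum.inr j)) = Fin.elim0 ∧ (fun j => t (Sum.inr j)) = Fin.elim0 :=
    ⟨Subsingleton.elim _ _, Subsingleton.elim _ _⟩
  rw [kron, ketbra, if_pos h, mul_one]
  rfl

/-- Run a circuit without input next to the register `U`. -/
noncomputable def adjoin (C : Circuit 𝒢 a b (Fin 0) J) (U : Type) [Fintype U] [DecidableEq U] :
    Circuit 𝒢 a b U (U ⊕ J) :=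
  (Circuit.ofEquiv (Equiv.sumEmpty U (Fin 0)).symm).comp (C.onRight U)

@[simp] theorem run_adjoin (C : Circuit 𝒢 a b (Fin 0) J) (𝓞 : Oracle a b) (ρ : Op U) :
    (adjoin C U).run 𝓞 ρ = kron ρ (C.run 𝓞 (ketbra Fin.elim0)) := by
  rw [adjoin, Circuit.run_comp, Circuit.run_ofEquiv, relabel_sumEmpty, Circuit.run_onRight_kron]

theorem size_adjoin_le (C : Circuit 𝒢 a b (Fin 0) J) :
    (adjoin C U).size ≤ 2 * Fintype.card U + C.size := by
  refine (Circuit.size_comp_le _ _).trans ?_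
  rw [Circuit.size_onRight, Circuit.ofEquiv, Circuit.size_ofLoad]
  simp
  omega

/-- A circuit that outputs a random bit. -/
def coin : Circuit 𝒢 a b (Fin 0) (Fin 1) :=
  Circuit.build (W := Fin 1) ⟨Fin.elim0, fun i => i.elim0⟩ (Function.Embedding.refl _)
    [Gate.h 0, Gate.measure 0]

/-- After the Hadamard gate all four entries are `1 / 2`; the measurement deletes the two
off-diagonal ones. -/
theorem run_coin (𝓞 : Oracle a b) :
    (coin : Circuit 𝒢 a b (Fin 0) (Fin 1)).run 𝓞 (ketbra Fin.elim0) =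
      (2 : ℂ)⁻¹ • ∑ r : Fin 1 → Bool, ketbra r := by
  have h2 : ((Real.sqrt 2 : ℝ) : ℂ) * ((Real.sqrt 2 : ℝ) : ℂ) = 2 := by
    rw [← Complex.ofReal_mul, Real.mul_self_sqrt (by norm_num)]; norm_num
  rw [coin, Circuit.run_build, Circuit.keep_refl, acts_cons, acts_cons, acts_nil,
    Gate.apply_measure, ketbra_eq_bk, load_bk]
  have h0 : ext0 (⟨Fin.elim0, fun i => i.elim0⟩ : Fin 0 ↪ Fin 1) Fin.elim0 = fun _ => false := by
    funext w
    exact ext0_of_notMem _ _ fun i => i.elim0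
  rw [h0]
  funext s t
  have hsum : (∑ r : Fin 1 → Bool, ketbra r) s t = if s = t then 1 else 0 := by
    rw [Matrix.sum_apply]
    by_cases h : s = t
    · subst h
      simp [ketbra]
    · rw [if_neg h]
      refine Finset.sum_eq_zero fun r _ => ?_
      rw [ketbra, if_neg]
      rintro ⟨rfl, rfl⟩
      exact h rfl
  rw [Matrix.smul_apply, hsum]
  have hb : ∀ (u v : Fin 1 → Bool) (p q : Bool),
      bk (fun _ => false) (fun _ => false) (Function.update u 0 p) (Function.update v 0 q) =
        if p = false ∧ q = false then 1 else 0 := by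
    intro u v p q
    have h1 : ∀ (u : Fin 1 → Bool) p, Function.update u 0 p = (fun _ => false) ↔ p = false := by
      intro u p
      constructor
      · intro h; simpa using congrFun h 0
      · rintro rfl; funext i; rw [Subsingleton.elim i 0]; simp
    split_ifs with h
    · exact bk_of_eq ⟨(h1 _ _).2 h.1, (h1 _ _).2 h.2⟩
    · exact bk_of_ne fun h' => h ⟨(h1 _ _).1 h'.1, (h1 _ _).1 h'.2⟩
  by_cases h : s = t
  · subst h
    rw [dephase_of_eq fun _ => rfl]
    change conjBy (onWire matH 0) _ s s = _
    rw [conjBy_onWire_apply]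
    simp [hb, matH, ← mul_inv, h2]
  · rw [if_neg h, dephase_of_ne]
    · simp
    · intro h'
      apply h
      funext i
      rw [Subsingleton.elim i 0]
      exact h' ()

/-- Some circuit of size at most `5 m (m + 1)` outputs `m` random bits. -/
theorem exists_randomBits (m : ℕ) : ∃ C : Circuit 𝒢 a b (Fin 0) (Fin m), C.size ≤ 5 * m * (m + 1) ∧
    ∀ 𝓞, C.run 𝓞 (ketbra Fin.elim0) =
      ((Fintype.card (BitStr m) : ℕ) : ℂ)⁻¹ • ∑ r : BitStr m, ketbra r := by
  induction m with
  | zero =>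
    refine ⟨Circuit.ofGates [], by simp [Circuit.size_ofGates], fun 𝓞 => ?_⟩
    rw [Circuit.run_ofGates, acts_nil, Fintype.sum_unique, Fintype.card_unique]
    simp only [Nat.cast_one, inv_one, one_smul]
    congr 1
  | succ m ih =>
    obtain ⟨C, h1, h2⟩ := ih
    refine ⟨(C.comp (adjoin coin (Fin m))).comp (Circuit.ofEquiv finSumFinEquiv), ?_, fun 𝓞 => ?_⟩
    · have h3 := Circuit.size_comp_le (C.comp (adjoin coin (Fin m)))
        (Circuit.ofEquiv finSumFinEquiv)
      have h4 := Circuit.size_comp_le C (adjoin coin (Fin m))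
      have h5 := size_adjoin_le (U := Fin m) (coin : Circuit 𝒢 a b (Fin 0) (Fin 1))
      rw [coin, Circuit.size_build] at h5
      rw [Circuit.size_ofEquiv] at h3
      simp only [Fintype.card_fin, List.length_cons, List.length_nil] at *
      rw [← coin] at h5
      ring_nf at h1 h5 ⊢
      omega
    · rw [Circuit.run_comp, Circuit.run_comp, h2, run_adjoin, run_coin, Circuit.run_ofEquiv,
        kron_smul_left, kron_smul_right, kron_sum_left]
      simp only [kron_sum_right, kron_ketbra]
      rw [← relabelL_apply]
      simp only [map_smul, map_sum, relabelL_apply, relabel_ketbra, smul_smul]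
      congr 1
      · simp [pow_succ, mul_comm]
      · rw [← Finset.sum_product']
        refine Fintype.sum_equiv ((Equiv.sumArrowEquivProdArrow (Fin m) (Fin 1) Bool).symm.trans
          (finSumFinEquiv.arrowCongr (Equiv.refl Bool))) _ _ fun p => ?_
        rfl

end classical

/-! ### Mixtures of circuits -/

section mix

variable {𝒢 : Set (Matrix.unitaryGroup Bool ℂ)} {a b : ℕ} {I J : Type}
  [Fintype I] [DecidableEq I] [Fintype J] [DecidableEq J]

theorem keep_inl {I K : Type} [Fintype I] [DecidableEq I] [Fintype K] [DecidableEq K]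
    (ρ : Op (I ⊕ K)) : keep Function.Embedding.inl ρ = traceRight ρ := by
  funext s t
  rw [keep, traceRight, ← Finset.sum_filter
    (p := fun u : I ⊕ K → Bool => (fun j => u (Function.Embedding.inl j)) = s)]
  refine Finset.sum_bij' (fun u _ k => u (Sum.inr k)) (fun u _ => Sum.elim s u) ?_ ?_ ?_ ?_ ?_
  · simp
  · intro u _
    simp
  · intro u hu
    simp only [Finset.mem_filter, Finset.mem_univ, true_and] at hu
    exact (sum_fun_ext.2 ⟨hu, rfl⟩).symm
  · intro u _
    rfl
  · intro u hu
    simp only [Finset.mem_filter, Finset.mem_univ, true_and] at hu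
    congr 1
    · exact sum_fun_ext.2 ⟨hu, rfl⟩
    · symm
      refine (eq_extend_iff _ _ _ _).2 ⟨rfl, fun w hw => ?_⟩
      rcases w with w | w
      · exact absurd rfl (hw w)
      · rfl

/-- The gates that exchange the wires `inr (inl j)` and `inr (inr j)` if the wire `inl ()` is
set. -/
def cswapGates (l : List J) : List (Gate 𝒢 a b (Unit ⊕ (J ⊕ J))) :=
  l.flatMap fun j =>
    [Gate.cnot (Sum.inr (Sum.inr j)) (Sum.inr (Sum.inl j)) (by simp),
      Gate.toffoli (Sum.inl ()) (Sum.inr (Sum.inl j)) (Sum.inr (Sum.inr j)) (by simp) (by simp)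
        (by simp),
      Gate.cnot (Sum.inr (Sum.inr j)) (Sum.inr (Sum.inl j)) (by simp)]

/-- A swap is three XORs, and only the middle one needs the control: without it the two outer `CNOT`
gates cancel. -/
theorem acts_cswapGates_aux (𝓞 : Oracle a b) (l : List J) (hl : l.Nodup) :
    ∃ F : (Unit ⊕ (J ⊕ J) → Bool) → (Unit ⊕ (J ⊕ J) → Bool),
      (∀ s t, acts 𝓞 (cswapGates (𝒢 := 𝒢) l) (bk s t) = bk (F s) (F t)) ∧
      (∀ s, F s (Sum.inl ()) = s (Sum.inl ())) ∧
      (∀ s, ∀ j ∈ l, F s (Sum.inr (Sum.inl j)) =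
        if s (Sum.inl ()) then s (Sum.inr (Sum.inr j)) else s (Sum.inr (Sum.inl j))) ∧
      (∀ s, ∀ j ∈ l, F s (Sum.inr (Sum.inr j)) =
        if s (Sum.inl ()) then s (Sum.inr (Sum.inl j)) else s (Sum.inr (Sum.inr j))) ∧
      (∀ s, ∀ j ∉ l, F s (Sum.inr (Sum.inl j)) = s (Sum.inr (Sum.inl j))) ∧
      (∀ s, ∀ j ∉ l, F s (Sum.inr (Sum.inr j)) = s (Sum.inr (Sum.inr j))) := by
  induction l with
  | nil => exact ⟨id, fun s t => rfl, by simp⟩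
  | cons j l ih =>
    obtain ⟨F, h1, h2, h3, h4, h5, h6⟩ := ih hl.of_cons
    have hj : j ∉ l := (List.nodup_cons.1 hl).1
    let G : (Unit ⊕ (J ⊕ J) → Bool) → (Unit ⊕ (J ⊕ J) → Bool) := fun s =>
      Sum.elim (fun _ => s (Sum.inl ())) (Sum.elim
        (fun k => if k = j ∧ s (Sum.inl ()) then s (Sum.inr (Sum.inr k)) else s (Sum.inr (Sum.inl k)))
        (fun k => if k = j ∧ s (Sum.inl ()) then s (Sum.inr (Sum.inl k)) else s (Sum.inr (Sum.inr k))))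
    refine ⟨fun s => F (G s), ?_, ?_, ?_, ?_, ?_, ?_⟩
    · intro s t
      rw [cswapGates, List.flatMap_cons, acts_append, acts_cons, acts_cons, acts_cons, acts_nil,
        Gate.apply_cnot_bk, Gate.apply_toffoli_bk, Gate.apply_cnot_bk]
      refine (congrArg (acts 𝓞 (cswapGates (𝒢 := 𝒢) l)) (congrArg₂ bk ?_ ?_)).trans
        (h1 (G s) (G t))
      · funext w
        rcases w with w | w | w
        · simp [G]
        · by_cases hw : w = j
          · subst hw
            cases h : s (Sum.inl ()) <;> simp [G, h, Bool.xor_comm, Bool.xor_left_comm]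
          · simp [G, hw]
        · by_cases hw : w = j
          · subst hw
            cases h : s (Sum.inl ()) <;> simp [G, h, Bool.xor_comm, Bool.xor_left_comm]
          · simp [G, hw]
      · funext w
        rcases w with w | w | w
        · simp [G]
        · by_cases hw : w = j
          · subst hw
            cases h : t (Sum.inl ()) <;> simp [G, h, Bool.xor_comm, Bool.xor_left_comm]
          · simp [G, hw]
        · by_cases hw : w = j
          · subst hw
            cases h : t (Sum.inl ()) <;> simp [G, h, Bool.xor_comm, Bool.xor_left_comm]
          · simp [G, hw]
    · intro s
      dsimp only
      rw [h2]
      rfl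
    · intro s k hk
      dsimp only
      by_cases hkl : k ∈ l
      · have hkj : k ≠ j := fun h => hj (h ▸ hkl)
        rw [h3 _ _ hkl]
        simp [G, hkj]
      · have hkj : k = j := (List.mem_cons.1 hk).resolve_right hkl
        subst hkj
        rw [h5 _ _ hkl]
        simp [G]
    · intro s k hk
      dsimp only
      by_cases hkl : k ∈ l
      · have hkj : k ≠ j := fun h => hj (h ▸ hkl)
        rw [h4 _ _ hkl]
        simp [G, hkj]
      · have hkj : k = j := (List.mem_cons.1 hk).resolve_right hkl
        subst hkj
        rw [h6 _ _ hkl]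
        simp [G]
    · intro s k hk
      dsimp only
      rw [h5 _ _ fun h => hk (List.mem_cons_of_mem _ h)]
      have hkj : k ≠ j := fun h => hk (h ▸ List.mem_cons_self)
      simp [G, hkj]
    · intro s k hk
      dsimp only
      rw [h6 _ _ fun h => hk (List.mem_cons_of_mem _ h)]
      have hkj : k ≠ j := fun h => hk (h ▸ List.mem_cons_self)
      simp [G, hkj]

theorem acts_cswapGates (𝓞 : Oracle a b) (c : Bool) (ρ σ : Op J) :
    acts 𝓞 (cswapGates (𝒢 := 𝒢) Finset.univ.toList) (kron (ketbra fun _ => c) (kron ρ σ)) =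
      kron (ketbra fun _ => c) (bif c then kron σ ρ else kron ρ σ) := by
  obtain ⟨F, h1, h2, h3, h4, -, -⟩ := acts_cswapGates_aux (𝒢 := 𝒢) (J := J) 𝓞 Finset.univ.toList
    (Finset.nodup_toList _)
  have hF : ∀ (u v : J → Bool), F (Sum.elim (fun _ => c) (Sum.elim u v)) =
      Sum.elim (fun _ => c) (bif c then Sum.elim v u else Sum.elim u v) := by
    intro u v
    funext w
    rcases w with w | w | w
    · exact h2 _
    · rw [h3 _ w (by simp)]
      cases c <;> simp
    · rw [h4 _ w (by simp)]
      cases c <;> simp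
  have key : (kronB J J).compr₂ ((acts 𝓞 (cswapGates (𝒢 := 𝒢) Finset.univ.toList)) ∘ₗ
      kronB Unit (J ⊕ J) (ketbra fun _ => c)) =
      (bif c then (kronB J J).flip else kronB J J).compr₂
        (kronB Unit (J ⊕ J) (ketbra fun _ => c)) := by
    refine op_linearMap_ext fun s t => op_linearMap_ext fun s' t' => ?_
    change acts 𝓞 (cswapGates (𝒢 := 𝒢) Finset.univ.toList)
      (kron (ketbra fun _ => c) (kron (bk s t) (bk s' t'))) = kron (ketbra fun _ => c)
        ((bif c then (kronB J J).flip else kronB J J) (bk s t) (bk s' t'))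
    rw [kron_bk, ketbra_eq_bk, kron_bk, h1, hF, hF]
    cases c
    · change bk _ _ = kron _ (kron (bk s t) (bk s' t'))
      rw [kron_bk, kron_bk]
      rfl
    · change bk _ _ = kron _ (kron (bk s' t') (bk s t))
      rw [kron_bk, kron_bk]
      rfl
  have := LinearMap.congr_fun (LinearMap.congr_fun key ρ) σ
  refine this.trans ?_
  cases c <;> rfl

/-- Output a random one of two registers. -/
noncomputable def select : Circuit 𝒢 a b (J ⊕ J) J :=
  (adjoin coin (J ⊕ J)).comp
    ((Circuit.ofEquiv ((Equiv.sumComm (J ⊕ J) (Fin 1)).trans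
      (Equiv.sumCongr (Equiv.ofUnique (Fin 1) Unit) (Equiv.refl (J ⊕ J))))).comp
      ((Circuit.ofGates (cswapGates Finset.univ.toList)).comp
        (Circuit.ofKeep (Function.Embedding.inl.trans Function.Embedding.inr))))

theorem keep_inr_kron {I K : Type} [Fintype I] [DecidableEq I] [Fintype K] [DecidableEq K]
    (ρ : Op I) (σ : Op K) : keep Function.Embedding.inr (kron ρ σ) = tr ρ • σ := by
  have h1 : (Function.Embedding.inr : K ↪ I ⊕ K) =
      Function.Embedding.inl.trans (Equiv.sumComm K I).toEmbedding := by
    ext k; rfl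
  have h2 : keep (Equiv.sumComm K I).toEmbedding (kron ρ σ) = kron σ ρ := by
    have h3 : kron ρ σ = load (Equiv.sumComm K I).toEmbedding (kron σ ρ) := by
      rw [Circuit.load_equiv]
      funext s t
      simp [relabel, kron, mul_comm]
    rw [h3]
    have h5 : keepL (Equiv.sumComm K I).toEmbedding ∘ₗ loadL (Equiv.sumComm K I).toEmbedding =
        LinearMap.id := op_linearMap_ext fun s t => by
      change keep _ (load _ (bk s t)) = bk s t
      rw [load_bk, keep_bk, if_pos]
      · congr 1 <;> funext k <;> exact ext0_apply _ _ _
      · intro w hw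
        exact absurd ((Equiv.sumComm K I).apply_symm_apply w) (hw _)
    exact LinearMap.congr_fun h5 _
  rw [h1, keep_trans, h2, keep_inl, traceRight_kron]

/-- The coin controls a swap, after which one of the two registers is kept. The traces are the
factors left by the discarded register; they equal one for states, but the linear form retains them.
-/
theorem run_select (𝓞 : Oracle a b) (ρ σ : Op J) :
    (select : Circuit 𝒢 a b (J ⊕ J) J).run 𝓞 (kron ρ σ) =
      (2 : ℂ)⁻¹ • (tr σ • ρ + tr ρ • σ) := by
  have hsum : ∑ r : Fin 1 → Bool, ketbra r = ketbra (fun _ => false) + ketbra fun _ => true := by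
    rw [← Equiv.sum_comp (Equiv.funUnique (Fin 1) Bool).symm, Fintype.sum_bool, add_comm]
    rfl
  have hrel : ∀ c : Bool, relabel ((Equiv.sumComm (J ⊕ J) (Fin 1)).trans
      (Equiv.sumCongr (Equiv.ofUnique (Fin 1) Unit) (Equiv.refl (J ⊕ J))))
      (kron (kron ρ σ) (ketbra fun _ => c)) = kron (ketbra fun _ => c) (kron ρ σ) := by
    intro c
    funext s t
    rw [relabel, kron, kron, mul_comm]
    congr 1
    have h : ∀ s : Unit ⊕ (J ⊕ J) → Bool, ((fun _ : Fin 1 => s (Sum.inl ())) = fun _ => c) ↔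
        ((fun _ : Unit => s (Sum.inl ())) = fun _ => c) := fun s =>
      ⟨fun h => funext fun _ => congrFun h 0, fun h => funext fun _ => congrFun h ()⟩
    exact if_congr (and_congr (h s) (h t)) rfl rfl
  have hsum2 : (coin : Circuit 𝒢 a b (Fin 0) (Fin 1)).run 𝓞 (ketbra Fin.elim0) =
      ∑ c : Bool, (2 : ℂ)⁻¹ • ketbra fun _ => c := by
    rw [run_coin, hsum, Fintype.sum_bool, smul_add, add_comm]
  rw [select, Circuit.run_comp, run_adjoin, hsum2, kron_sum_right, Circuit.run_sum,
    Fintype.sum_bool]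
  simp only [kron_smul_right, Circuit.run_smul, Circuit.run_comp, Circuit.run_ofEquiv, hrel,
    Circuit.run_ofGates, acts_cswapGates, Circuit.run_ofKeep, keep_trans, keep_inr_kron,
    tr_ketbra, one_smul, cond_true, cond_false, keep_inl, traceRight_kron]
  rw [← smul_add, add_comm]

theorem size_select_le :
    (select : Circuit 𝒢 a b (J ⊕ J) J).size ≤ 15 * Fintype.card J + 20 := by
  have h1 : (cswapGates (Finset.univ : Finset J).toList :
      List (Gate 𝒢 a b (Unit ⊕ (J ⊕ J)))).length = 3 * Fintype.card J := by
    rw [cswapGates, List.length_flatMap]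
    simp [mul_comm]
  have h2 := size_adjoin_le (U := J ⊕ J) (coin : Circuit 𝒢 a b (Fin 0) (Fin 1))
  refine (Circuit.size_comp_le _ _).trans ?_
  refine (Nat.add_le_add h2 ((Circuit.size_comp_le _ _).trans
    (Nat.add_le_add_left (Circuit.size_comp_le _ _) _))).trans ?_
  rw [Circuit.size_ofEquiv, Circuit.size_ofGates, Circuit.size_ofKeep, h1, coin,
    Circuit.size_build]
  simp only [Fintype.card_sum, Fintype.card_fin, Fintype.card_unit, List.length_cons,
    List.length_nil]
  omega

/-- On classical inputs, some circuit runs a random one of `2 ^ m` circuits. -/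
theorem exists_mixture (m N : ℕ) (C : ℕ → Circuit 𝒢 a b I J) (hC : ∀ i, (C i).size ≤ N) :
    ∃ D : Circuit 𝒢 a b I J,
      D.size + (5 * Fintype.card I + 15 * Fintype.card J + 23) ≤
        2 ^ m * (N + (5 * Fintype.card I + 15 * Fintype.card J + 23)) ∧
      ∀ 𝓞 x, D.run 𝓞 (ketbra x) =
        ((2 : ℂ) ^ m)⁻¹ • ∑ i ∈ Finset.range (2 ^ m), (C i).run 𝓞 (ketbra x) := by
  induction m generalizing C with
  | zero =>
    refine ⟨C 0, ?_, fun 𝓞 x => by simp⟩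
    have := hC 0
    rw [pow_zero]
    omega
  | succ m ih =>
    obtain ⟨D, h1, h2⟩ := ih C hC
    obtain ⟨E, h3, h4⟩ := ih (fun i => C (2 ^ m + i)) fun i => hC _
    refine ⟨(fanCircuit (Sum.elim Sum.inl Sum.inl : I ⊕ I → I ⊕ Bool)).comp
      ((D.par E).comp select), ?_, fun 𝓞 x => ?_⟩
    -- Duplicating the input costs `5 * Fintype.card I + 3` and selecting `15 * Fintype.card J +
    -- 20`. Their sum is the constant added to the size, so that size plus constant at most doubles
    -- at each level.
    · have h5 := (Circuit.size_comp_le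
        (fanCircuit (Sum.elim Sum.inl Sum.inl : I ⊕ I → I ⊕ Bool)) ((D.par E).comp select)).trans
        (Nat.add_le_add_left ((Circuit.size_comp_le (D.par E) select).trans
          (Nat.add_le_add_left size_select_le _)) _)
      rw [size_fanCircuit, Circuit.size_par, Fintype.card_sum] at h5
      rw [pow_succ]
      have h6 : 2 ^ m * 2 * (N + (5 * Fintype.card I + 15 * Fintype.card J + 23)) =
        2 * (2 ^ m * (N + (5 * Fintype.card I + 15 * Fintype.card J + 23))) := by ring
      omega
    · have : fan (Sum.elim Sum.inl Sum.inl : I ⊕ I → I ⊕ Bool) x = Sum.elim x x := by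
        funext u; cases u <;> rfl
      rw [Circuit.run_comp, run_fanCircuit_ketbra, this, ← kron_ketbra, Circuit.run_comp,
        Circuit.run_par_kron, run_select, Circuit.tr_run, Circuit.tr_run, tr_ketbra, one_smul,
        one_smul, h2, h4, ← smul_add, smul_smul, pow_succ (2 : ℂ) m, pow_succ 2 m,
        Nat.mul_two, Finset.sum_range_add, mul_inv, mul_comm]

end mix

/-! ### Executions with recorded queries

An execution of a sequence of gates in which every query is answered, and recorded in a database, by
an `Answerer`; the value of the execution is expressed through a function `κ` of the final database
and the final state. -/

namespace Gate

variable {𝒢 : Set (Matrix.unitaryGroup Bool ℂ)} {a b : ℕ} {W : Type}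

/-- Whether a gate is an oracle query. -/
def isQuery : Gate 𝒢 a b W → Bool
  | query _ => true
  | _ => false

theorem exists_of_isQuery {g : Gate 𝒢 a b W} (h : g.isQuery = true) : ∃ e, g = query e := by
  cases g with
  | query e => exact ⟨e, rfl⟩
  | _ => simp [isQuery] at h

theorem apply_of_not_isQuery [Fintype W] [DecidableEq W] {g : Gate 𝒢 a b W}
    (h : g.isQuery = false) (𝓞 𝓞' : Oracle a b) (ρ : Op W) : g.apply 𝓞 ρ = g.apply 𝓞' ρ := by
  cases g with
  | query e => simp [isQuery] at h
  | _ => rfl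

end Gate

/-- A way to answer queries from a database of type `D` with the help of randomness from `R`. -/
structure Answerer (a b : ℕ) (R D : Type) where
  ans : D → BitStr a → R → BitStr b
  nxt : D → BitStr a → R → D

/-- XOR the string `y` into the answer wires. -/
noncomputable def writeAnswer {a b : ℕ} {W : Type} [Fintype W] [DecidableEq W]
    (e : Fin a ⊕ Fin b ↪ W) (y : BitStr b) (ρ : Op W) : Op W :=
  conjBy (basisMap (xorAt (answerEmb e) y)) ρ

/-- The block of `ρ` in which the query wires hold the string `q`. -/
noncomputable def queryBlock {a b : ℕ} {W : Type} (e : Fin a ⊕ Fin b ↪ W) (q : BitStr a)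
    (ρ : Op W) : Op W := projOn (fun i => e (Sum.inl i)) q ρ

section run

variable {𝒢 : Set (Matrix.unitaryGroup Bool ℂ)} {a b : ℕ} {W : Type} [Fintype W] [DecidableEq W]
  {R D : Type} [Fintype R] {M M' : Type} [AddCommGroup M] [Module ℝ M] [AddCommGroup M']
  [Module ℝ M']

theorem sum_tr_queryBlock (e : Fin a ⊕ Fin b ↪ W) (ρ : Op W) :
    ∑ q, tr (queryBlock e q ρ) = tr ρ := by
  have h : ∀ σ : Op W, tr σ = trL σ := fun _ => rfl
  simp only [h, ← map_sum, queryBlock, ← dephase_eq_sum]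
  exact tr_dephase _ ρ

theorem tr_writeAnswer (e : Fin a ⊕ Fin b ↪ W) (y : BitStr b) (ρ : Op W) :
    tr (writeAnswer e y ρ) = tr ρ := tr_conjBy_basisMap (xorAt_involutive _ _) ρ

theorem PSD.writeAnswer_queryBlock (e : Fin a ⊕ Fin b ↪ W) (y : BitStr b) (q : BitStr a)
    {ρ : Op W} (h : PSD ρ) : PSD (writeAnswer e y (queryBlock e q ρ)) :=
  PSD.conjBy_basisMap _ (h.projOn _ q)

/-- Once the query wires have been measured, the oracle acts on block `q` by XORing the fixed string
`𝓞 q`. In this form the source of the answer can be exchanged for any other. -/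
theorem apply_query_eq_sum (𝓞 : Oracle a b) (e : Fin a ⊕ Fin b ↪ W) (ρ : Op W) :
    (Gate.query e : Gate 𝒢 a b W).apply 𝓞 ρ = ∑ q, writeAnswer e (𝓞 q) (queryBlock e q ρ) := by
  funext s t
  rw [Gate.apply_query, conjBy_basisMap_apply (xorAnswer_involutive 𝓞 e), Matrix.sum_apply]
  have h : ∀ q, writeAnswer e (𝓞 q) (queryBlock e q ρ) s t =
      queryBlock e q ρ (xorAt (answerEmb e) (𝓞 q) s) (xorAt (answerEmb e) (𝓞 q) t) :=
    fun q => conjBy_basisMap_apply (xorAt_involutive _ _) _ _ _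
  simp only [h]
  by_cases hst : ∀ i, s (e (Sum.inl i)) = t (e (Sum.inl i))
  · rw [dephase_of_eq, Finset.sum_eq_single fun i => s (e (Sum.inl i))]
    · rw [queryBlock, projOn, if_pos]
      · simp only [xorAnswer_eq, hst]
      · simp only [xorAt_query, hst, and_self]
    · intro q _ hq
      rw [queryBlock, projOn, if_neg]
      intro h'
      apply hq
      rw [← h'.1]
      simp only [xorAt_query]
    · simp
    · simpa only [xorAnswer_eq, xorAt_query] using hst
  · rw [dephase_of_ne]
    · symm
      refine Finset.sum_eq_zero fun q _ => ?_
      rw [queryBlock, projOn, if_neg]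
      rintro ⟨h1, h2⟩
      apply hst
      intro i
      have h3 := congrFun h1 i
      have h4 := congrFun h2 i
      simp only [xorAt_query] at h3 h4
      rw [h3, h4]
    · simpa only [xorAnswer_eq, xorAt_query] using hst

/-- The execution of one gate. -/
noncomputable def stepE (𝒜 : Answerer a b R D) (g : Gate 𝒢 a b W) (κ : D → Op W → M) (d : D)
    (ρ : Op W) : M :=
  match g with
  | .query e => (Fintype.card R : ℝ)⁻¹ • ∑ r, ∑ q,
      κ (𝒜.nxt d q r) (writeAnswer e (𝒜.ans d q r) (queryBlock e q ρ))
  | g => κ d (g.apply (fun _ _ => false) ρ)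

theorem stepE_query (𝒜 : Answerer a b R D) (e : Fin a ⊕ Fin b ↪ W) (κ : D → Op W → M) (d : D)
    (ρ : Op W) : stepE 𝒜 (.query e : Gate 𝒢 a b W) κ d ρ = (Fintype.card R : ℝ)⁻¹ • ∑ r, ∑ q,
      κ (𝒜.nxt d q r) (writeAnswer e (𝒜.ans d q r) (queryBlock e q ρ)) := rfl

theorem stepE_of_not_isQuery (𝒜 : Answerer a b R D) {g : Gate 𝒢 a b W} (h : g.isQuery = false)
    (κ : D → Op W → M) (d : D) (ρ : Op W) (𝓞 : Oracle a b) :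
    stepE 𝒜 g κ d ρ = κ d (g.apply 𝓞 ρ) := by
  rw [Gate.apply_of_not_isQuery h 𝓞 fun _ _ => false]
  cases g <;> first | rfl | simp [Gate.isQuery] at h

/-- The execution of a sequence of gates. -/
noncomputable def runE (𝒜 : Answerer a b R D) (gs : List (Gate 𝒢 a b W)) (κ : D → Op W → M) :
    D → Op W → M := gs.foldr (stepE 𝒜) κ

@[simp] theorem runE_nil (𝒜 : Answerer a b R D) (κ : D → Op W → M) :
    runE 𝒜 ([] : List (Gate 𝒢 a b W)) κ = κ := rfl

@[simp] theorem runE_cons (𝒜 : Answerer a b R D) (g : Gate 𝒢 a b W) (gs : List (Gate 𝒢 a b W))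
    (κ : D → Op W → M) : runE 𝒜 (g :: gs) κ = stepE 𝒜 g (runE 𝒜 gs κ) := rfl

theorem map_stepE (L : M →ₗ[ℝ] M') (𝒜 : Answerer a b R D) (g : Gate 𝒢 a b W)
    (κ : D → Op W → M) (d : D) (ρ : Op W) :
    L (stepE 𝒜 g κ d ρ) = stepE 𝒜 g (fun d ρ => L (κ d ρ)) d ρ := by
  rcases h : g.isQuery with _ | _
  · rw [stepE_of_not_isQuery 𝒜 h _ _ _ fun _ _ => false,
      stepE_of_not_isQuery 𝒜 h _ _ _ fun _ _ => false]
  · obtain ⟨e, rfl⟩ := Gate.exists_of_isQuery h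
    simp only [stepE_query, map_smul, map_sum]

/-- An execution is linear in its continuation `κ`. This serves both to append further circuits to a
recorded execution and to read off probabilities. -/
theorem map_runE (L : M →ₗ[ℝ] M') (𝒜 : Answerer a b R D) (gs : List (Gate 𝒢 a b W))
    (κ : D → Op W → M) (d : D) (ρ : Op W) :
    L (runE 𝒜 gs κ d ρ) = runE 𝒜 gs (fun d ρ => L (κ d ρ)) d ρ := by
  induction gs generalizing d ρ with
  | nil => rfl
  | cons g gs ih =>
    rw [runE_cons, map_stepE, runE_cons]
    congr 1
    funext d ρ
    exact ih d ρ

variable [Nonempty R]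

theorem stepE_tr (𝒜 : Answerer a b R D) (g : Gate 𝒢 a b W) (c : ℝ) (d : D) (ρ : Op W) :
    stepE 𝒜 g (fun _ σ => c * (tr σ).re) d ρ = c * (tr ρ).re := by
  rcases h : g.isQuery with _ | _
  · rw [stepE_of_not_isQuery 𝒜 h _ _ _ fun _ _ => false, Gate.tr_apply]
  · obtain ⟨e, rfl⟩ := Gate.exists_of_isQuery h
    simp only [stepE_query, tr_writeAnswer, ← Finset.mul_sum, ← Complex.re_sum, sum_tr_queryBlock,
      Finset.sum_const, Finset.card_univ, nsmul_eq_mul, smul_eq_mul]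
    have : (Fintype.card R : ℝ) ≠ 0 := Nat.cast_ne_zero.2 Fintype.card_ne_zero
    field_simp

theorem runE_tr (𝒜 : Answerer a b R D) (gs : List (Gate 𝒢 a b W)) (c : ℝ) (d : D) (ρ : Op W) :
    runE 𝒜 gs (fun _ σ => c * (tr σ).re) d ρ = c * (tr ρ).re := by
  induction gs generalizing d ρ with
  | nil => rfl
  | cons g gs ih =>
    have : runE 𝒜 gs (fun _ σ => c * (tr σ).re) = fun _ σ => c * (tr σ).re := by
      funext d ρ
      exact ih d ρ
    rw [runE_cons, this, stepE_tr]

end run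

/-! ### Databases as lists of queries and answers -/

/-- A list of queries with their answers. -/
abbrev Records (a b : ℕ) : Type := List (BitStr a × BitStr b)

/-- The answerer that records every query. -/
def recording {a b : ℕ} {R : Type} (ans : Records a b → BitStr a → R → BitStr b) :
    Answerer a b R (Records a b) where
  ans := ans
  nxt d q r := (q, ans d q r) :: d

/-- Answer by the oracle. -/
def realA {a b : ℕ} (𝓞 : Oracle a b) : Answerer a b Unit (Records a b) :=
  recording fun _ q _ => 𝓞 q

/-- Answer from the records and the background records `d₁`, and at random if there is no record. -/
def lazyA {a b : ℕ} (d₁ : Records a b) : Answerer a b (BitStr b) (Records a b) :=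
  recording fun d q r => (List.lookup q (d ++ d₁)).getD r

/-- The oracle overridden by the records. -/
def override {a b : ℕ} (d : Records a b) (𝓞 : Oracle a b) : Oracle a b :=
  fun q => (List.lookup q d).getD (𝓞 q)

/-- The average over all oracles. -/
noncomputable def oavg {a b : ℕ} {M : Type} [AddCommGroup M] [Module ℝ M] (g : Oracle a b → M) :
    M := (Fintype.card (Oracle a b) : ℝ)⁻¹ • ∑ 𝓞, g 𝓞

theorem oavg_const {a b : ℕ} {M : Type} [AddCommGroup M] [Module ℝ M] (m : M) :
    oavg (fun _ : Oracle a b => m) = m := by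
  rw [oavg, Finset.sum_const, Finset.card_univ, ← Nat.cast_smul_eq_nsmul ℝ, smul_smul,
    inv_mul_cancel₀ (Nat.cast_ne_zero.2 Fintype.card_ne_zero), one_smul]

theorem map_oavg {a b : ℕ} {M M' : Type} [AddCommGroup M] [Module ℝ M] [AddCommGroup M']
    [Module ℝ M'] (L : M →ₗ[ℝ] M') (g : Oracle a b → M) : L (oavg g) = oavg fun 𝓞 => L (g 𝓞) := by
  simp only [oavg, map_smul, map_sum]

theorem oavg_sum {a b : ℕ} {M ι : Type} [AddCommGroup M] [Module ℝ M] (S : Finset ι)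
    (g : ι → Oracle a b → M) : ∑ i ∈ S, oavg (g i) = oavg fun 𝓞 => ∑ i ∈ S, g i 𝓞 := by
  simp only [oavg, ← Finset.smul_sum]
  rw [Finset.sum_comm]

theorem oavg_smul {a b : ℕ} {M : Type} [AddCommGroup M] [Module ℝ M] (c : ℝ)
    (g : Oracle a b → M) : c • oavg g = oavg fun 𝓞 => c • g 𝓞 := by
  simp only [oavg, ← Finset.smul_sum, smul_comm c]

theorem oracleAvg_eq_oavg {a b : ℕ} (g : Oracle a b → ℝ) : oracleAvg g = oavg g := by
  rw [oracleAvg, oavg, smul_eq_mul, div_eq_inv_mul]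

/-- Resampling one value of a uniform function leaves it uniform: exchanging `r` with the value of
`𝓞` at `q` is an involution on pairs. -/
theorem avg_update {a b : ℕ} {M : Type} [AddCommGroup M] [Module ℝ M] (q : BitStr a)
    (F : Oracle a b → M) :
    (Fintype.card (BitStr b) : ℝ)⁻¹ • ∑ r, oavg (fun 𝓞 => F (Function.update 𝓞 q r)) = oavg F := by
  have h : ∑ r : BitStr b, ∑ 𝓞 : Oracle a b, F (Function.update 𝓞 q r) =
      ∑ _r : BitStr b, ∑ 𝓞 : Oracle a b, F 𝓞 := by
    rw [← Finset.sum_product', ← Finset.sum_product']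
    refine Finset.sum_bij' (fun p _ => (p.2 q, Function.update p.2 q p.1))
      (fun p _ => (p.2 q, Function.update p.2 q p.1)) ?_ ?_ ?_ ?_ ?_ <;> simp
  simp only [oavg, ← Finset.smul_sum, h]
  rw [Finset.sum_const, Finset.card_univ, ← Nat.cast_smul_eq_nsmul ℝ, smul_comm, smul_smul,
    smul_smul, mul_assoc, inv_mul_cancel₀ (Nat.cast_ne_zero.2 Fintype.card_ne_zero), mul_one]

/-- This is the step of lazy sampling for one query. If `q` is recorded, the overridden oracle
already has that value; if not, the fresh string can serve as the oracle's value at `q`, by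
`avg_update`. -/
theorem avg_lookup {a b : ℕ} {M : Type} [AddCommGroup M] [Module ℝ M] (d : Records a b)
    (q : BitStr a) (h : BitStr b → Oracle a b → M) :
    (Fintype.card (BitStr b) : ℝ)⁻¹ • ∑ r, oavg (fun 𝓞 => h ((List.lookup q d).getD r)
      (override ((q, (List.lookup q d).getD r) :: d) 𝓞)) =
      oavg fun 𝓞 => h (override d 𝓞 q) (override d 𝓞) := by
  rcases hq : List.lookup q d with _ | y
  · have h1 : ∀ 𝓞 r, override ((q, r) :: d) 𝓞 = override d (Function.update 𝓞 q r) := by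
      intro 𝓞 r
      funext q'
      simp only [override, List.lookup_cons]
      by_cases hqq : q' = q
      · subst hqq; simp [hq]
      · simp [hqq, beq_false_of_ne hqq]
    have h2 : ∀ 𝓞, override d 𝓞 q = 𝓞 q := fun 𝓞 => by simp [override, hq]
    simp only [Option.getD_none, h1]
    rw [← avg_update q]
    simp only [h2, Function.update_self]
  · have h1 : ∀ 𝓞, override ((q, y) :: d) 𝓞 = override d 𝓞 := by
      intro 𝓞
      funext q'
      simp only [override, List.lookup_cons]
      by_cases hqq : q' = q
      · subst hqq; simp [hq]
      · simp [beq_false_of_ne hqq]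
    have h2 : ∀ 𝓞, override d 𝓞 q = y := fun 𝓞 => by simp [override, hq]
    simp only [Option.getD_some, h1, h2]
    rw [Finset.sum_const, Finset.card_univ, ← Nat.cast_smul_eq_nsmul ℝ, smul_smul,
      inv_mul_cancel₀ (Nat.cast_ne_zero.2 Fintype.card_ne_zero), one_smul]

section records

variable {𝒢 : Set (Matrix.unitaryGroup Bool ℂ)} {a b : ℕ} {W : Type} [Fintype W] [DecidableEq W]
  {R : Type} [Fintype R] {M M' : Type} [AddCommGroup M] [Module ℝ M] [AddCommGroup M']
  [Module ℝ M']

/-- Lazy sampling of the oracle is the same as sampling it in advance. -/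
theorem runE_lazy (d₁ : Records a b) (gs : List (Gate 𝒢 a b W)) {κ : Records a b → Op W → M}
    {κr : Oracle a b → Records a b → Op W → M}
    (h : ∀ d ρ, κ d ρ = oavg fun 𝓞 => κr (override (d ++ d₁) 𝓞) d ρ) (d : Records a b) (ρ : Op W) :
    runE (lazyA d₁) gs κ d ρ = oavg fun 𝓞 =>
      runE (realA (override (d ++ d₁) 𝓞)) gs (κr (override (d ++ d₁) 𝓞)) d ρ := by
  induction gs generalizing d ρ with
  | nil => exact h d ρ
  | cons g gs ih =>
    simp only [runE_cons]
    rcases hg : g.isQuery with _ | _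
    · simp only [stepE_of_not_isQuery _ hg _ _ _ fun _ _ => false, ih]
    · obtain ⟨e, rfl⟩ := Gate.exists_of_isQuery hg
      simp only [stepE_query, ih]
      simp only [Fintype.card_unit, Nat.cast_one, inv_one, one_smul, Finset.univ_unique,
        Finset.sum_singleton]
      -- The identity is proved for each queried string separately, so the sum over `q` has to be
      -- outermost.
      rw [Finset.sum_comm, Finset.smul_sum, ← oavg_sum]
      refine Finset.sum_congr rfl fun q _ => ?_
      exact avg_lookup (d ++ d₁) q fun y 𝓞 =>
        runE (realA 𝓞) gs (κr 𝓞) ((q, y) :: d) (writeAnswer e y (queryBlock e q ρ))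

/-- Query gates measure their query wires in any case. If the continuation ignores the records and
is linear, summing over the queried strings recovers the original action. -/
theorem runE_real (𝓞 : Oracle a b) (gs : List (Gate 𝒢 a b W)) (κ : Op W →ₗ[ℝ] M)
    (d : Records a b) (ρ : Op W) :
    runE (realA 𝓞) gs (fun _ σ => κ σ) d ρ = κ (acts 𝓞 gs ρ) := by
  induction gs generalizing d ρ with
  | nil => rfl
  | cons g gs ih =>
    have h1 : runE (realA 𝓞) gs (fun _ σ => κ σ) = fun _ σ => κ (acts 𝓞 gs σ) := by
      funext d ρ
      exact ih d ρ
    rw [runE_cons, h1, acts_cons]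
    rcases hg : g.isQuery with _ | _
    · rw [stepE_of_not_isQuery _ hg _ _ _ 𝓞]
    · obtain ⟨e, rfl⟩ := Gate.exists_of_isQuery hg
      rw [stepE_query, apply_query_eq_sum, map_sum, map_sum]
      simp [realA, recording]

theorem stepE_mono (ans : Records a b → BitStr a → R → BitStr b) (g : Gate 𝒢 a b W)
    {κ κ' : Records a b → Op W → ℝ} (d : Records a b) {ρ : Op W} (hρ : PSD ρ)
    (h : ∀ d' σ, d <:+ d' → d'.length ≤ d.length + 1 → PSD σ → κ d' σ ≤ κ' d' σ) :
    stepE (recording ans) g κ d ρ ≤ stepE (recording ans) g κ' d ρ := by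
  rcases hg : g.isQuery with _ | _
  · rw [stepE_of_not_isQuery _ hg _ _ _ fun _ _ => false,
      stepE_of_not_isQuery _ hg _ _ _ fun _ _ => false]
    exact h _ _ List.suffix_rfl (by simp) (hρ.apply _ g)
  · obtain ⟨e, rfl⟩ := Gate.exists_of_isQuery hg
    simp only [stepE_query, smul_eq_mul]
    refine mul_le_mul_of_nonneg_left ?_ (by positivity)
    refine Finset.sum_le_sum fun r _ => Finset.sum_le_sum fun q _ => ?_
    exact h _ _ (List.suffix_cons _ _) (by simp [recording]) (hρ.writeAnswer_queryBlock e _ q)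

/-- All weights are nonnegative and every branch state stays positive, so an inequality is needed
only on positive operators. The bound on the length of `d'` will limit the number of queries of
`CP`. -/
theorem runE_mono (ans : Records a b → BitStr a → R → BitStr b) (gs : List (Gate 𝒢 a b W))
    {κ κ' : Records a b → Op W → ℝ} (d : Records a b) {ρ : Op W} (hρ : PSD ρ)
    (h : ∀ d' σ, d <:+ d' → d'.length ≤ d.length + gs.length → PSD σ → κ d' σ ≤ κ' d' σ) :
    runE (recording ans) gs κ d ρ ≤ runE (recording ans) gs κ' d ρ := by
  induction gs generalizing d ρ with
  | nil => exact h d ρ List.suffix_rfl (by simp) hρ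
  | cons g gs ih =>
    refine stepE_mono ans g d hρ fun d' σ h1 h2 h3 => ih d' h3 fun d'' τ h4 h5 h6 => ?_
    refine h d'' τ (h1.trans h4) ?_ h6
    rw [List.length_cons]
    omega

/-! ### Hits on the background records -/

/-- The number of queries recorded in `d₁` that are also recorded in `d`. -/
def hits (d₁ d : Records a b) : ℕ :=
  ((d₁.map Prod.fst).toFinset.filter fun q => q ∈ d.map Prod.fst).card

theorem hits_mono (d₁ : Records a b) {d d' : Records a b} (h : d <:+ d') :
    hits d₁ d ≤ hits d₁ d' := by
  refine Finset.card_le_card fun q hq => ?_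
  rw [Finset.mem_filter] at hq ⊢
  exact ⟨hq.1, (h.map Prod.fst).subset hq.2⟩

theorem hits_le (d₁ d : Records a b) : hits d₁ d ≤ d₁.length :=
  (Finset.card_filter_le _ _).trans ((List.toFinset_card_le _).trans (by simp))

theorem hits_nil (d₁ : Records a b) : hits d₁ [] = 0 := by
  simp [hits]

theorem hits_cons_of_mem (d₁ : Records a b) {d : Records a b} {q : BitStr a} (y : BitStr b)
    (h : q ∈ d.map Prod.fst ∨ q ∉ d₁.map Prod.fst) : hits d₁ ((q, y) :: d) = hits d₁ d := by
  refine congrArg Finset.card (Finset.filter_congr fun q' hq' => ?_)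
  rw [List.mem_toFinset] at hq'
  simp only [List.map_cons, List.mem_cons]
  constructor
  · rintro (rfl | h1)
    · exact h.resolve_right fun h2 => h2 hq'
    · exact h1
  · exact Or.inr

theorem hits_cons_of_notMem (d₁ : Records a b) {d : Records a b} {q : BitStr a} (y : BitStr b)
    (h : q ∉ d.map Prod.fst) (h1 : q ∈ d₁.map Prod.fst) :
    hits d₁ d + 1 ≤ hits d₁ ((q, y) :: d) := by
  refine Finset.card_lt_card (Finset.ssubset_iff_subset_ne.2 ⟨fun q' hq' => ?_, fun h2 => ?_⟩)
  · rw [Finset.mem_filter] at hq' ⊢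
    exact ⟨hq'.1, List.mem_cons_of_mem _ hq'.2⟩
  · have : q ∈ (d₁.map Prod.fst).toFinset.filter fun q' => q' ∈ ((q, y) :: d).map Prod.fst := by
      simp only [Finset.mem_filter, List.mem_toFinset]
      exact ⟨h1, by simp⟩
    rw [← h2] at this
    exact h (Finset.mem_filter.1 this).2

theorem lookup_eq_none_iff_notMem {d : Records a b} {q : BitStr a} :
    List.lookup q d = none ↔ q ∉ d.map Prod.fst := by
  rw [List.lookup_eq_none_iff]
  simp only [List.mem_map, not_exists, not_and, bne_iff_ne, ne_eq]
  exact ⟨fun h p hp hq => h p hp hq.symm, fun h p hp hq => h p hp hq.symm⟩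

theorem lookup_append_eq (d d₁ : Records a b) (q : BitStr a) :
    List.lookup q (d ++ d₁) = (List.lookup q d).or (List.lookup q d₁) :=
  List.lookup_append

/-- Without the background records, the value of an execution drops by at most the expected
number of background records that are hit for the first time. -/
theorem runE_lazy_le (d₁ : Records a b) (gs : List (Gate 𝒢 a b W))
    {κ : Records a b → Op W → ℝ} (h0 : ∀ d σ, PSD σ → 0 ≤ κ d σ)
    (h1 : ∀ d σ, PSD σ → κ d σ ≤ (tr σ).re) (d : Records a b) {ρ : Op W} (hρ : PSD ρ) :
    runE (lazyA d₁) gs κ d ρ ≤ runE (lazyA []) gs κ d ρ +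
      runE (lazyA d₁) gs (fun d' σ => ((hits d₁ d' : ℝ) - hits d₁ d) * (tr σ).re) d ρ := by
  induction gs generalizing d ρ with
  | nil => simp
  | cons g gs ih =>
    simp only [runE_cons]
    rcases hg : g.isQuery with _ | _
    · simp only [stepE_of_not_isQuery _ hg _ _ _ fun _ _ => false]
      exact ih d (hρ.apply _ g)
    · obtain ⟨e, rfl⟩ := Gate.exists_of_isQuery hg
      simp only [stepE_query, smul_eq_mul]
      rw [← mul_add, ← Finset.sum_add_distrib]
      refine mul_le_mul_of_nonneg_left (Finset.sum_le_sum fun r _ => ?_) (by positivity)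
      rw [← Finset.sum_add_distrib]
      refine Finset.sum_le_sum fun q _ => ?_
      -- In this case the background is irrelevant to the answer: either an own record takes
      -- precedence or the background has no entry.
      by_cases hq : q ∈ d.map Prod.fst ∨ q ∉ d₁.map Prod.fst
      · have hans : (lazyA d₁).ans d q r = (lazyA []).ans d q r := by
          simp only [lazyA, recording, List.append_nil, lookup_append_eq]
          rcases hq with hq | hq
          · rcases h : List.lookup q d with _ | y
            · exact absurd hq (lookup_eq_none_iff_notMem.1 h)
            · rfl
          · rw [lookup_eq_none_iff_notMem.2 hq, Option.or_none]
        have hnxt : (lazyA d₁).nxt d q r = (lazyA []).nxt d q r := by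
          change (q, (lazyA d₁).ans d q r) :: d = (q, (lazyA []).ans d q r) :: d
          rw [hans]
        have hh : hits d₁ d = hits d₁ ((lazyA d₁).nxt d q r) := (hits_cons_of_mem d₁ _ hq).symm
        rw [hh, ← hnxt, ← hans]
        exact ih _ (hρ.writeAnswer_queryBlock e _ q)
      -- At a first hit the two executions may part ways. The value lost is at most the trace of the
      -- branch, and the potential has just risen by at least one on that same branch.
      · rw [not_or, not_not] at hq
        have hσ := hρ.writeAnswer_queryBlock e ((lazyA d₁).ans d q r) q
        have hh : hits d₁ d + 1 ≤ hits d₁ ((lazyA d₁).nxt d q r) :=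
          hits_cons_of_notMem d₁ _ hq.1 hq.2
        have hp : 0 ≤ runE (lazyA []) gs κ ((lazyA []).nxt d q r)
            (writeAnswer e ((lazyA []).ans d q r) (queryBlock e q ρ)) := by
          have h2 := runE_mono (fun d q r => (List.lookup q (d ++ [])).getD r) gs (κ := fun _ σ =>
            0 * (tr σ).re) (κ' := κ) ((lazyA []).nxt d q r)
            (hρ.writeAnswer_queryBlock e ((lazyA []).ans d q r) q)
            fun d' σ _ _ hs => by rw [zero_mul]; exact h0 d' σ hs
          rw [runE_tr, zero_mul] at h2
          exact h2
        refine le_trans ?_ (le_add_of_nonneg_left hp)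
        refine runE_mono _ gs _ hσ fun d' σ hd _ hs => (h1 d' σ hs).trans ?_
        have h3 := hits_mono d₁ hd
        have h4 : (1 : ℝ) ≤ (hits d₁ d' : ℝ) - hits d₁ d := by
          rw [le_sub_iff_add_le, add_comm]
          exact_mod_cast hh.trans h3
        have h5 := hs.tr_re_nonneg
        nlinarith

end records

/-! ### Executions of circuits with recorded queries -/

namespace Gate

/-- The number of queries in a list of gates. -/
def qcount {𝒢 : Set (Matrix.unitaryGroup Bool ℂ)} {a b : ℕ} {W : Type}
    (gs : List (Gate 𝒢 a b W)) : ℕ := gs.countP isQuery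

end Gate

section linear

variable {𝒢 : Set (Matrix.unitaryGroup Bool ℂ)} {a b : ℕ} {W : Type} [Fintype W] [DecidableEq W]
  {R D : Type} [Fintype R] {M M' : Type} [AddCommGroup M] [Module ℝ M] [AddCommGroup M']
  [Module ℝ M']

theorem stepE_add (𝒜 : Answerer a b R D) (g : Gate 𝒢 a b W) (κ κ' : D → Op W → M) (d : D)
    (ρ : Op W) :
    stepE 𝒜 g (fun d σ => κ d σ + κ' d σ) d ρ = stepE 𝒜 g κ d ρ + stepE 𝒜 g κ' d ρ := by
  rcases h : g.isQuery with _ | _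
  · simp only [stepE_of_not_isQuery 𝒜 h _ _ _ fun _ _ => false]
  · obtain ⟨e, rfl⟩ := Gate.exists_of_isQuery h
    simp only [stepE_query, Finset.sum_add_distrib, smul_add]

theorem runE_add (𝒜 : Answerer a b R D) (gs : List (Gate 𝒢 a b W)) (κ κ' : D → Op W → M) (d : D)
    (ρ : Op W) :
    runE 𝒜 gs (fun d σ => κ d σ + κ' d σ) d ρ = runE 𝒜 gs κ d ρ + runE 𝒜 gs κ' d ρ := by
  induction gs generalizing d ρ with
  | nil => rfl
  | cons g gs ih =>
    have : runE 𝒜 gs (fun d σ => κ d σ + κ' d σ) =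
        fun d σ => runE 𝒜 gs κ d σ + runE 𝒜 gs κ' d σ := by
      funext d ρ
      exact ih d ρ
    rw [runE_cons, this, stepE_add, runE_cons, runE_cons]

theorem runE_zero (𝒜 : Answerer a b R D) (gs : List (Gate 𝒢 a b W)) (d : D) (ρ : Op W) :
    runE 𝒜 gs (fun _ _ => (0 : M)) d ρ = 0 := by
  have h := runE_add 𝒜 gs (fun _ _ => (0 : M)) (fun _ _ => 0) d ρ
  simp only [add_zero] at h
  exact left_eq_add.1 h

/-- Only queries lengthen the database. Circuits treat databases correctly only up to the capacity
of their register, so continuations may have to be compared on short databases alone. -/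
theorem runE_congr (ans : Records a b → BitStr a → R → BitStr b) (gs : List (Gate 𝒢 a b W))
    {κ κ' : Records a b → Op W → M} (d : Records a b) (ρ : Op W)
    (h : ∀ d' σ, d'.length ≤ d.length + Gate.qcount gs → κ d' σ = κ' d' σ) :
    runE (recording ans) gs κ d ρ = runE (recording ans) gs κ' d ρ := by
  induction gs generalizing d ρ with
  | nil => exact h d ρ (by simp)
  | cons g gs ih =>
    rw [runE_cons, runE_cons]
    rcases hg : g.isQuery with _ | _
    · rw [stepE_of_not_isQuery _ hg _ _ _ fun _ _ => false,
        stepE_of_not_isQuery _ hg _ _ _ fun _ _ => false]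
      refine ih d _ fun d' σ hd => h d' σ (hd.trans ?_)
      rw [Gate.qcount, Gate.qcount, List.countP_cons]
      omega
    · obtain ⟨e, rfl⟩ := Gate.exists_of_isQuery hg
      rw [stepE_query, stepE_query]
      congr 1
      refine Finset.sum_congr rfl fun r _ => Finset.sum_congr rfl fun q _ => ?_
      refine ih _ _ fun d' σ hd => h d' σ (hd.trans ?_)
      rw [Gate.qcount, Gate.qcount, List.countP_cons, if_pos hg]
      simp only [recording, List.length_cons]
      omega

end linear

section circE

variable {𝒢 : Set (Matrix.unitaryGroup Bool ℂ)} {a b : ℕ} {I J : Type} [Fintype I] [Fintype J]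
  {R D : Type} [Fintype R] {M M' : Type} [AddCommGroup M] [Module ℝ M] [AddCommGroup M']
  [Module ℝ M']

/-- The number of queries of a circuit. -/
def Circuit.qcount {𝒢 : Set (Matrix.unitaryGroup Bool ℂ)} {a b : ℕ} {I J : Type}
    (C : Circuit 𝒢 a b I J) : ℕ := Gate.qcount C.gates

/-- The execution of a circuit. -/
noncomputable def circE (𝒜 : Answerer a b R D) (C : Circuit 𝒢 a b I J) (κ : D → Op J → M) (d : D)
    (ρ : Op I) : M :=
  runE 𝒜 C.gates (fun d σ => κ d (keep C.out σ)) d (load C.inp ρ)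

theorem map_circE (L : M →ₗ[ℝ] M') (𝒜 : Answerer a b R D) (C : Circuit 𝒢 a b I J)
    (κ : D → Op J → M) (d : D) (ρ : Op I) :
    L (circE 𝒜 C κ d ρ) = circE 𝒜 C (fun d σ => L (κ d σ)) d ρ :=
  map_runE _ _ _ _ _ _

theorem circE_add (𝒜 : Answerer a b R D) (C : Circuit 𝒢 a b I J) (κ κ' : D → Op J → M) (d : D)
    (ρ : Op I) :
    circE 𝒜 C (fun d σ => κ d σ + κ' d σ) d ρ = circE 𝒜 C κ d ρ + circE 𝒜 C κ' d ρ :=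
  runE_add _ _ _ _ _ _

theorem circE_sum {ι : Type} (𝒜 : Answerer a b R D) (C : Circuit 𝒢 a b I J) (S : Finset ι)
    (κ : ι → D → Op J → M) (d : D) (ρ : Op I) :
    circE 𝒜 C (fun d σ => ∑ i ∈ S, κ i d σ) d ρ = ∑ i ∈ S, circE 𝒜 C (κ i) d ρ := by
  classical
  induction S using Finset.induction_on with
  | empty => exact runE_zero _ _ _ _
  | insert i S hi ih =>
    simp only [Finset.sum_insert hi]
    rw [circE_add, ih]

theorem circE_tr [Nonempty R] (𝒜 : Answerer a b R D) (C : Circuit 𝒢 a b I J) (c : ℝ) (d : D)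
    (ρ : Op I) : circE 𝒜 C (fun _ σ => c * (tr σ).re) d ρ = c * (tr ρ).re := by
  simp only [circE, tr_keep, runE_tr, tr_load]

theorem circE_congr (ans : Records a b → BitStr a → R → BitStr b) (C : Circuit 𝒢 a b I J)
    {κ κ' : Records a b → Op J → M} (d : Records a b) (ρ : Op I)
    (h : ∀ d' σ, d'.length ≤ d.length + C.qcount → κ d' σ = κ' d' σ) :
    circE (recording ans) C κ d ρ = circE (recording ans) C κ' d ρ :=
  runE_congr _ _ _ _ fun d' _ hd => h d' _ hd

theorem circE_mono (ans : Records a b → BitStr a → R → BitStr b) (C : Circuit 𝒢 a b I J)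
    {κ κ' : Records a b → Op J → ℝ} (d : Records a b) {ρ : Op I} (hρ : PSD ρ)
    (h : ∀ d' σ, d'.length ≤ d.length + C.gates.length → PSD σ → κ d' σ ≤ κ' d' σ) :
    circE (recording ans) C κ d ρ ≤ circE (recording ans) C κ' d ρ :=
  runE_mono _ _ _ (hρ.load _) fun d' _ _ hd hs => h d' _ hd (hs.keep _)

theorem circE_lazy (d₁ : Records a b) (C : Circuit 𝒢 a b I J) {κ : Records a b → Op J → M}
    {κr : Oracle a b → Records a b → Op J → M}
    (h : ∀ d ρ, κ d ρ = oavg fun 𝓞 => κr (override (d ++ d₁) 𝓞) d ρ) (d : Records a b) (ρ : Op I) :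
    circE (lazyA d₁) C κ d ρ = oavg fun 𝓞 =>
      circE (realA (override (d ++ d₁) 𝓞)) C (κr (override (d ++ d₁) 𝓞)) d ρ :=
  runE_lazy d₁ C.gates (κr := fun 𝓞 d σ => κr 𝓞 d (keep C.out σ)) (fun d _ => h d _) d _

theorem circE_real (𝓞 : Oracle a b) (C : Circuit 𝒢 a b I J) (κ : Op J →ₗ[ℝ] M)
    (d : Records a b) (ρ : Op I) :
    circE (realA 𝓞) C (fun _ σ => κ σ) d ρ = κ (C.run 𝓞 ρ) := by
  rw [Circuit.run_eq]
  exact runE_real 𝓞 C.gates (κ ∘ₗ (keepL C.out).restrictScalars ℝ) d _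

/-- Trace preservation turns the initial potential into a separate summand. With a potential before
on the left and a potential after on the right, the inequality is ready to telescope. -/
theorem circE_lazy_le (d₁ : Records a b) (C : Circuit 𝒢 a b I J)
    {κ : Records a b → Op J → ℝ} (h0 : ∀ d σ, PSD σ → 0 ≤ κ d σ)
    (h1 : ∀ d σ, PSD σ → κ d σ ≤ (tr σ).re) (d : Records a b) {ρ : Op I} (hρ : PSD ρ) :
    circE (lazyA d₁) C κ d ρ + hits d₁ d * (tr ρ).re ≤ circE (lazyA []) C κ d ρ +
      circE (lazyA d₁) C (fun d' σ => hits d₁ d' * (tr σ).re) d ρ := by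
  have h := runE_lazy_le d₁ C.gates (κ := fun d σ => κ d (keep C.out σ))
    (fun d σ hs => h0 d _ (hs.keep _))
    (fun d σ hs => (h1 d _ (hs.keep _)).trans_eq (by rw [tr_keep])) d (hρ.load C.inp)
  have h2 := runE_add (lazyA d₁) C.gates
    (fun d' σ => ((hits d₁ d' : ℝ) - hits d₁ d) * (tr σ).re) (fun _ σ => hits d₁ d * (tr σ).re) d
    (load C.inp ρ)
  rw [runE_tr, tr_load] at h2
  simp only [← add_mul, sub_add_cancel] at h2
  simp only [circE, tr_keep]
  rw [h2]
  linarith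

end circE

/-! ### Repeated evaluations -/

section rounds

variable {𝒢 : Set (Matrix.unitaryGroup Bool ℂ)} {a b : ℕ} {Z J K : Type} [Fintype Z] [DecidableEq Z]
  [Fintype J] [DecidableEq J] [Fintype K] [DecidableEq K]
  {R D : Type} [Fintype R] {M M' : Type} [AddCommGroup M] [Module ℝ M] [AddCommGroup M']
  [Module ℝ M']

/-- The evaluation of a program on an input sampled with the weights `w`. -/
noncomputable def evalE (𝒜 : Answerer a b R D) (C : Circuit 𝒢 a b (Z ⊕ K) J)
    (w : (K → Bool) → ℝ) (κ : (K → Bool) → D → Op J → M) (d : D) (ρ : Op Z) : M :=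
  ∑ x, w x • circE 𝒜 C (κ x) d (attach ρ x)

/-- The evaluation of a program, after which the value is discarded. -/
noncomputable def roundE (𝒜 : Answerer a b R D) (C : Circuit 𝒢 a b (Z ⊕ K) (Z ⊕ J))
    (w : (K → Bool) → ℝ) (κ : D → Op Z → M) : D → Op Z → M :=
  evalE 𝒜 C w fun _ d σ => κ d (traceRight σ)

theorem map_evalE (L : M →ₗ[ℝ] M') (𝒜 : Answerer a b R D) (C : Circuit 𝒢 a b (Z ⊕ K) J)
    (w : (K → Bool) → ℝ) (κ : (K → Bool) → D → Op J → M) (d : D) (ρ : Op Z) :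
    L (evalE 𝒜 C w κ d ρ) = evalE 𝒜 C w (fun x d σ => L (κ x d σ)) d ρ := by
  simp only [evalE, map_sum, map_smul, map_circE]

theorem map_roundE (L : M →ₗ[ℝ] M') (𝒜 : Answerer a b R D) (C : Circuit 𝒢 a b (Z ⊕ K) (Z ⊕ J))
    (w : (K → Bool) → ℝ) (κ : D → Op Z → M) (d : D) (ρ : Op Z) :
    L (roundE 𝒜 C w κ d ρ) = roundE 𝒜 C w (fun d σ => L (κ d σ)) d ρ :=
  map_evalE _ _ _ _ _ _ _

/-- In continuation form the innermost application of `roundE` is the round run last. The inductions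
over rounds therefore absorb the last round into `κ`. -/
theorem map_iterate_roundE (L : M →ₗ[ℝ] M') (𝒜 : Answerer a b R D)
    (C : Circuit 𝒢 a b (Z ⊕ K) (Z ⊕ J)) (w : (K → Bool) → ℝ) (i : ℕ) (κ : D → Op Z → M) (d : D)
    (ρ : Op Z) :
    L ((roundE 𝒜 C w)^[i] κ d ρ) = (roundE 𝒜 C w)^[i] (fun d σ => L (κ d σ)) d ρ := by
  induction i generalizing κ with
  | zero => rfl
  | succ i ih =>
    rw [Function.iterate_succ_apply, ih, Function.iterate_succ_apply]
    simp only [map_roundE]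

theorem roundE_add (𝒜 : Answerer a b R D) (C : Circuit 𝒢 a b (Z ⊕ K) (Z ⊕ J))
    (w : (K → Bool) → ℝ) (κ κ' : D → Op Z → M) (d : D) (ρ : Op Z) :
    roundE 𝒜 C w (fun d σ => κ d σ + κ' d σ) d ρ = roundE 𝒜 C w κ d ρ + roundE 𝒜 C w κ' d ρ := by
  simp only [roundE, evalE, circE_add, smul_add, Finset.sum_add_distrib]

theorem iterate_roundE_add (𝒜 : Answerer a b R D) (C : Circuit 𝒢 a b (Z ⊕ K) (Z ⊕ J))
    (w : (K → Bool) → ℝ) (i : ℕ) (κ κ' : D → Op Z → M) (d : D) (ρ : Op Z) :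
    (roundE 𝒜 C w)^[i] (fun d σ => κ d σ + κ' d σ) d ρ =
      (roundE 𝒜 C w)^[i] κ d ρ + (roundE 𝒜 C w)^[i] κ' d ρ := by
  induction i generalizing κ κ' with
  | zero => rfl
  | succ i ih =>
    simp only [Function.iterate_succ_apply]
    rw [← ih]
    refine congrArg (fun κ => (roundE 𝒜 C w)^[i] κ d ρ) ?_
    funext d σ
    exact roundE_add _ _ _ _ _ _ _

theorem evalE_congr (ans : Records a b → BitStr a → R → BitStr b) (C : Circuit 𝒢 a b (Z ⊕ K) J)
    (w : (K → Bool) → ℝ) {κ κ' : (K → Bool) → Records a b → Op J → M} (d : Records a b) (ρ : Op Z)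
    (h : ∀ x d' σ, d'.length ≤ d.length + C.qcount → κ x d' σ = κ' x d' σ) :
    evalE (recording ans) C w κ d ρ = evalE (recording ans) C w κ' d ρ :=
  Finset.sum_congr rfl fun x _ => congrArg (w x • ·) (circE_congr _ _ _ _ (h x))

theorem iterate_roundE_congr (ans : Records a b → BitStr a → R → BitStr b)
    (C : Circuit 𝒢 a b (Z ⊕ K) (Z ⊕ J)) (w : (K → Bool) → ℝ) (i : ℕ)
    {κ κ' : Records a b → Op Z → M} (d : Records a b) (ρ : Op Z)
    (h : ∀ d' σ, d'.length ≤ d.length + i * C.qcount → κ d' σ = κ' d' σ) :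
    (roundE (recording ans) C w)^[i] κ d ρ = (roundE (recording ans) C w)^[i] κ' d ρ := by
  induction i generalizing κ κ' with
  | zero => exact h d ρ (by omega)
  | succ i ih =>
    simp only [Function.iterate_succ_apply]
    refine ih fun d' σ hd => evalE_congr _ _ _ _ _ fun x d'' τ hd' => h d'' _ ?_
    rw [add_mul, one_mul]
    omega

theorem evalE_mono (ans : Records a b → BitStr a → R → BitStr b) (C : Circuit 𝒢 a b (Z ⊕ K) J)
    {w : (K → Bool) → ℝ} (hw : ∀ x, 0 ≤ w x) {κ κ' : (K → Bool) → Records a b → Op J → ℝ}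
    (d : Records a b) {ρ : Op Z} (hρ : PSD ρ) (h : ∀ x d' σ, PSD σ → κ x d' σ ≤ κ' x d' σ) :
    evalE (recording ans) C w κ d ρ ≤ evalE (recording ans) C w κ' d ρ :=
  Finset.sum_le_sum fun x _ => mul_le_mul_of_nonneg_left
    (circE_mono _ _ _ (hρ.attach x) fun d' σ _ hs => h x d' σ hs) (hw x)

theorem iterate_roundE_mono (ans : Records a b → BitStr a → R → BitStr b)
    (C : Circuit 𝒢 a b (Z ⊕ K) (Z ⊕ J)) {w : (K → Bool) → ℝ} (hw : ∀ x, 0 ≤ w x) (i : ℕ)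
    {κ κ' : Records a b → Op Z → ℝ} (d : Records a b) {ρ : Op Z} (hρ : PSD ρ)
    (h : ∀ d' σ, PSD σ → κ d' σ ≤ κ' d' σ) :
    (roundE (recording ans) C w)^[i] κ d ρ ≤ (roundE (recording ans) C w)^[i] κ' d ρ := by
  induction i generalizing κ κ' with
  | zero => exact h d ρ hρ
  | succ i ih =>
    simp only [Function.iterate_succ_apply]
    exact ih fun d' σ hs => evalE_mono _ _ hw _ hs fun x d'' τ ht => h d'' _ ht.traceRight

theorem tr_attach (ρ : Op Z) (x : K → Bool) : tr (attach ρ x) = tr ρ := by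
  rw [attach_eq_kron, tr_kron, tr_ketbra, mul_one]

theorem roundE_tr [Nonempty R] (𝒜 : Answerer a b R D) (C : Circuit 𝒢 a b (Z ⊕ K) (Z ⊕ J))
    {w : (K → Bool) → ℝ} (hw : ∑ x, w x = 1) (c : ℝ) :
    roundE 𝒜 C w (fun _ σ => c * (tr σ).re) = fun _ σ => c * (tr σ).re := by
  funext d ρ
  simp only [roundE, evalE, tr_traceRight, circE_tr, tr_attach, smul_eq_mul]
  rw [← Finset.sum_mul, hw, one_mul]

theorem iterate_roundE_tr [Nonempty R] (𝒜 : Answerer a b R D) (C : Circuit 𝒢 a b (Z ⊕ K) (Z ⊕ J))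
    {w : (K → Bool) → ℝ} (hw : ∑ x, w x = 1) (c : ℝ) (i : ℕ) :
    (roundE 𝒜 C w)^[i] (fun _ σ => c * (tr σ).re) = fun _ σ => c * (tr σ).re :=
  Function.iterate_fixed (roundE_tr 𝒜 C hw c) i

theorem evalE_lazy (d₁ : Records a b) (C : Circuit 𝒢 a b (Z ⊕ K) J) (w : (K → Bool) → ℝ)
    {κ : (K → Bool) → Records a b → Op J → M}
    {κr : Oracle a b → (K → Bool) → Records a b → Op J → M}
    (h : ∀ x d ρ, κ x d ρ = oavg fun 𝓞 => κr (override (d ++ d₁) 𝓞) x d ρ) (d : Records a b)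
    (ρ : Op Z) :
    evalE (lazyA d₁) C w κ d ρ = oavg fun 𝓞 =>
      evalE (realA (override (d ++ d₁) 𝓞)) C w (κr (override (d ++ d₁) 𝓞)) d ρ := by
  simp only [evalE]
  rw [← oavg_sum]
  refine Finset.sum_congr rfl fun x _ => ?_
  rw [circE_lazy d₁ C (κr := fun 𝓞 => κr 𝓞 x) (h x), oavg_smul]

theorem iterate_roundE_lazy (d₁ : Records a b) (C : Circuit 𝒢 a b (Z ⊕ K) (Z ⊕ J))
    (w : (K → Bool) → ℝ) (i : ℕ) {κ : Records a b → Op Z → M}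
    {κr : Oracle a b → Records a b → Op Z → M}
    (h : ∀ d ρ, κ d ρ = oavg fun 𝓞 => κr (override (d ++ d₁) 𝓞) d ρ) (d : Records a b) (ρ : Op Z) :
    (roundE (lazyA d₁) C w)^[i] κ d ρ = oavg fun 𝓞 =>
      (roundE (realA (override (d ++ d₁) 𝓞)) C w)^[i] (κr (override (d ++ d₁) 𝓞)) d ρ := by
  induction i generalizing κ κr with
  | zero => exact h d ρ
  | succ i ih =>
    simp only [Function.iterate_succ_apply]
    exact ih (κr := fun 𝓞 => roundE (realA 𝓞) C w (κr 𝓞))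
      fun d ρ => evalE_lazy d₁ C w (κr := fun 𝓞 _ d σ => κr 𝓞 d (traceRight σ))
        (fun _ d _ => h d _) d ρ

/-- The state after the evaluation of a program on a random input. -/
noncomputable def roundL (𝓞 : Oracle a b) (C : Circuit 𝒢 a b (Z ⊕ K) (Z ⊕ J))
    (w : (K → Bool) → ℝ) : Op Z →ₗ[ℂ] Op Z :=
  ∑ x, (w x : ℂ) • traceRightL ∘ₗ C.runL 𝓞 ∘ₗ (kronB Z K).flip (ketbra x)

theorem roundL_apply (𝓞 : Oracle a b) (C : Circuit 𝒢 a b (Z ⊕ K) (Z ⊕ J))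
    (w : (K → Bool) → ℝ) (ρ : Op Z) :
    roundL 𝓞 C w ρ = ∑ x, (w x : ℂ) • traceRight (C.run 𝓞 (attach ρ x)) := by
  rw [roundL, LinearMap.sum_apply]
  refine Finset.sum_congr rfl fun x _ => ?_
  rw [attach_eq_kron, ← Circuit.runL_apply]
  rfl

theorem evalE_real (𝓞 : Oracle a b) (C : Circuit 𝒢 a b (Z ⊕ K) J) (w : (K → Bool) → ℝ)
    (κ : (K → Bool) → Op J →ₗ[ℝ] M) (d : Records a b) (ρ : Op Z) :
    evalE (realA 𝓞) C w (fun x _ σ => κ x σ) d ρ = ∑ x, w x • κ x (C.run 𝓞 (attach ρ x)) := by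
  simp only [evalE, circE_real]

theorem roundE_real (𝓞 : Oracle a b) (C : Circuit 𝒢 a b (Z ⊕ K) (Z ⊕ J)) (w : (K → Bool) → ℝ)
    (κ : Op Z →ₗ[ℝ] M) (d : Records a b) (ρ : Op Z) :
    roundE (realA 𝓞) C w (fun _ σ => κ σ) d ρ = κ (roundL 𝓞 C w ρ) := by
  rw [roundL_apply, map_sum]
  refine (evalE_real 𝓞 C w (fun _ => κ ∘ₗ traceRightL.restrictScalars ℝ) d ρ).trans ?_
  refine Finset.sum_congr rfl fun x _ => ?_
  rw [Complex.coe_smul, map_smul]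
  rfl

theorem iterate_roundE_real (𝓞 : Oracle a b) (C : Circuit 𝒢 a b (Z ⊕ K) (Z ⊕ J))
    (w : (K → Bool) → ℝ) (i : ℕ) (κ : Op Z →ₗ[ℝ] M) (d : Records a b) (ρ : Op Z) :
    (roundE (realA 𝓞) C w)^[i] (fun _ σ => κ σ) d ρ = κ ((roundL 𝓞 C w)^[i] ρ) := by
  induction i generalizing κ with
  | zero => rfl
  | succ i ih =>
    rw [Function.iterate_succ_apply, Function.iterate_succ_apply']
    have h : roundE (realA 𝓞) C w (fun _ σ => κ σ) =
        fun _ σ => (κ ∘ₗ (roundL 𝓞 C w).restrictScalars ℝ) σ := by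
      funext d ρ
      exact roundE_real 𝓞 C w κ d ρ
    rw [h, ih]
    rfl

/-- Evaluating for the value and running a round for its effect on the potential use the same
circuit on the same inputs, so the potential after the evaluation is the one found by the next
round. -/
theorem evalE_lazy_le (d₁ : Records a b) (C : Circuit 𝒢 a b (Z ⊕ K) (Z ⊕ J))
    {w : (K → Bool) → ℝ} (hw0 : ∀ x, 0 ≤ w x) (hw1 : ∑ x, w x = 1)
    {κ : (K → Bool) → Records a b → Op (Z ⊕ J) → ℝ} (h0 : ∀ x d σ, PSD σ → 0 ≤ κ x d σ)
    (h1 : ∀ x d σ, PSD σ → κ x d σ ≤ (tr σ).re) (d : Records a b) {ρ : Op Z} (hρ : PSD ρ) :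
    evalE (lazyA d₁) C w κ d ρ + hits d₁ d * (tr ρ).re ≤ evalE (lazyA []) C w κ d ρ +
      roundE (lazyA d₁) C w (fun d' σ => hits d₁ d' * (tr σ).re) d ρ := by
  have h : (hits d₁ d : ℝ) * (tr ρ).re = ∑ x, w x • (hits d₁ d * (tr ρ).re) := by
    rw [← Finset.sum_smul, hw1, one_smul]
  rw [h]
  simp only [roundE, evalE, tr_traceRight]
  rw [← Finset.sum_add_distrib, ← Finset.sum_add_distrib]
  refine Finset.sum_le_sum fun x _ => ?_
  rw [← smul_add, ← smul_add]
  refine mul_le_mul_of_nonneg_left ?_ (hw0 x)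
  have h2 := circE_lazy_le d₁ C (h0 x) (h1 x) d (hρ.attach x)
  rwa [tr_attach] at h2

/-- For the evaluations after `0, …, k - 1` earlier ones together, the loss that results from
dropping the background records is at most their number. -/
theorem sum_evalE_lazy_le (d₁ : Records a b) (C : Circuit 𝒢 a b (Z ⊕ K) (Z ⊕ J))
    {w : (K → Bool) → ℝ} (hw0 : ∀ x, 0 ≤ w x) (hw1 : ∑ x, w x = 1)
    {κ : (K → Bool) → Records a b → Op (Z ⊕ J) → ℝ} (h0 : ∀ x d σ, PSD σ → 0 ≤ κ x d σ)
    (h1 : ∀ x d σ, PSD σ → κ x d σ ≤ (tr σ).re) (k : ℕ) {ρ : Op Z} (hρ : PSD ρ) :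
    ∑ i ∈ Finset.range k, (roundE (lazyA d₁) C w)^[i] (evalE (lazyA d₁) C w κ) [] ρ ≤
      ∑ i ∈ Finset.range k, (roundE (lazyA d₁) C w)^[i] (evalE (lazyA []) C w κ) [] ρ +
        d₁.length * (tr ρ).re := by
  -- Both sides are preceded by `i` rounds with the full records; the potential stands at `i` on the
  -- left and at `i + 1` on the right.
  have key : ∀ i, (roundE (lazyA d₁) C w)^[i] (evalE (lazyA d₁) C w κ) [] ρ +
      (roundE (lazyA d₁) C w)^[i] (fun d σ => hits d₁ d * (tr σ).re) [] ρ ≤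
      (roundE (lazyA d₁) C w)^[i] (evalE (lazyA []) C w κ) [] ρ +
      (roundE (lazyA d₁) C w)^[i + 1] (fun d σ => hits d₁ d * (tr σ).re) [] ρ := by
    intro i
    rw [Function.iterate_succ_apply, ← iterate_roundE_add, ← iterate_roundE_add]
    exact iterate_roundE_mono _ C hw0 i _ hρ fun d σ hs => evalE_lazy_le d₁ C hw0 hw1 h0 h1 d hs
  have h2 : ∑ i ∈ Finset.range k, (roundE (lazyA d₁) C w)^[i] (evalE (lazyA d₁) C w κ) [] ρ ≤
      ∑ i ∈ Finset.range k, (roundE (lazyA d₁) C w)^[i] (evalE (lazyA []) C w κ) [] ρ +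
        (roundE (lazyA d₁) C w)^[k] (fun d σ => hits d₁ d * (tr σ).re) [] ρ := by
    induction k with
    | zero => simp [hits_nil]
    | succ k ih =>
      rw [Finset.sum_range_succ, Finset.sum_range_succ]
      have := key k
      linarith
  refine h2.trans (add_le_add_right ?_ _)
  -- The final potential never exceeds the number of background records, and the rounds preserve the
  -- trace.
  have h3 := iterate_roundE_mono (fun d q r => (List.lookup q (d ++ d₁)).getD r) C hw0 k
    (κ := fun d σ => hits d₁ d * (tr σ).re) (κ' := fun _ σ => d₁.length * (tr σ).re) [] hρ
    fun d σ hs => mul_le_mul_of_nonneg_right (Nat.cast_le.2 (hits_le d₁ d)) hs.tr_re_nonneg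
  rw [iterate_roundE_tr _ C hw1] at h3
  exact h3

end rounds

/-! ### Circuits that record their queries -/

section relabel

variable {I J K : Type}

/-- Exchange of the last two of three registers. -/
def rightComm (I J K : Type) : (I ⊕ J) ⊕ K ≃ (I ⊕ K) ⊕ J where
  toFun := Sum.elim (Sum.elim (Sum.inl ∘ Sum.inl) Sum.inr) (Sum.inl ∘ Sum.inr)
  invFun := Sum.elim (Sum.elim (Sum.inl ∘ Sum.inl) Sum.inr) (Sum.inl ∘ Sum.inr)
  left_inv := by rintro ((_ | _) | _) <;> rfl
  right_inv := by rintro ((_ | _) | _) <;> rfl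

theorem relabel_rightComm (ρ : Op I) (σ : Op J) (τ : Op K) :
    relabel (rightComm I J K) (kron (kron ρ σ) τ) = kron (kron ρ τ) σ := by
  funext s t
  exact mul_right_comm _ _ _

theorem relabel_sumAssoc (ρ : Op I) (σ : Op J) (τ : Op K) :
    relabel (Equiv.sumAssoc I J K) (kron (kron ρ σ) τ) = kron ρ (kron σ τ) := by
  funext s t
  exact mul_assoc _ _ _

theorem relabel_sumAssoc_symm (ρ : Op I) (σ : Op J) (τ : Op K) :
    relabel (Equiv.sumAssoc I J K).symm (kron ρ (kron σ τ)) = kron (kron ρ σ) τ := by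
  funext s t
  exact (mul_assoc _ _ _).symm

end relabel

theorem Gate.exists_retarget {𝒢 : Set (Matrix.unitaryGroup Bool ℂ)} {a b a' b' : ℕ} {W : Type}
    {g : Gate 𝒢 a b W} (h : g.isQuery = false) :
    ∃ g' : Gate 𝒢 a' b' W, g.retarget = some g' := by
  cases g with
  | query e => simp [isQuery] at h
  | _ => exact ⟨_, rfl⟩

section record

variable {𝒢 : Set (Matrix.unitaryGroup Bool ℂ)} {a b a' b' : ℕ} {W X : Type}
  [Fintype W] [DecidableEq W] [Fintype X] [DecidableEq X]

/-- The circuit that measures the query wires and copies the result to a new register. -/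
noncomputable def copyQuery (e : Fin a ⊕ Fin b ↪ W) : Circuit 𝒢 a' b' W (W ⊕ Fin a) :=
  (Circuit.build (W := W ⊕ Fin a) Function.Embedding.inl (Function.Embedding.refl _)
    (cnotList (fun i => Sum.inl (e (Sum.inl i))) Function.Embedding.inr (by simp)
      Finset.univ.toList)).comp
    ((fanCircuit Sum.inl).onRight W)

/-- The `CNOT` gates correlate the new register with the query wires; measuring the new register
then measures the query wires too. -/
theorem run_copyQuery (e : Fin a ⊕ Fin b ↪ W) (𝓞 : Oracle a' b') (ρ : Op W) :
    (copyQuery e : Circuit 𝒢 a' b' W (W ⊕ Fin a)).run 𝓞 ρ =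
      ∑ q, kron (queryBlock e q ρ) (ketbra q) := by
  classical
  let blockL (q : BitStr a) : Op W →ₗ[ℂ] Op W :=
    { toFun := queryBlock e q
      map_add' := fun ρ σ => by
        funext s t
        simp only [queryBlock, projOn, Matrix.add_apply]
        split_ifs <;> simp
      map_smul' := fun c ρ => by
        funext s t
        simp only [queryBlock, projOn, Matrix.smul_apply, RingHom.id_apply]
        split_ifs <;> simp }
  have key : (copyQuery e : Circuit 𝒢 a' b' W (W ⊕ Fin a)).runL 𝓞 =
      ∑ q, (kronB W (Fin a)).flip (ketbra q) ∘ₗ blockL q := op_linearMap_ext fun s t => by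
    rw [LinearMap.sum_apply, Circuit.runL_apply]
    change _ = ∑ q, kron (queryBlock e q (bk s t)) (ketbra q)
    have h1 : ∀ s : W → Bool, xorAt (Function.Embedding.inr : Fin a ↪ W ⊕ Fin a)
        (fun j => ext0 (Function.Embedding.inl : W ↪ W ⊕ Fin a) s (Sum.inl (e (Sum.inl j))))
        (ext0 (Function.Embedding.inl : W ↪ W ⊕ Fin a) s) =
        Sum.elim s fun i => s (e (Sum.inl i)) := by
      intro s
      symm
      have h2 : ∀ w, ext0 (Function.Embedding.inl : W ↪ W ⊕ Fin a) s (Sum.inl w) = s w :=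
        fun w => ext0_apply _ _ w
      rw [xorAt, eq_extend_iff]
      refine ⟨?_, ?_⟩
      · funext i
        have h3 : ext0 (Function.Embedding.inl : W ↪ W ⊕ Fin a) s (Sum.inr i) = false :=
          ext0_of_notMem _ _ (by simp)
        simp [h2, h3]
      · rintro (w | i) hw
        · simp [h2]
        · exact absurd rfl (hw i)
    rw [copyQuery, Circuit.run_comp, Circuit.run_build, Circuit.keep_refl, load_bk,
      acts_cnotList_bk, h1, h1, ← kron_bk, Circuit.run_onRight_kron, run_fanCircuit_bk]
    have h4 : ∀ q, queryBlock e q (bk s t) =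
        if (fun i => s (e (Sum.inl i))) = q ∧ (fun i => t (e (Sum.inl i))) = q then bk s t
        else 0 := by
      intro q
      funext u v
      rw [queryBlock, projOn]
      by_cases h : u = s ∧ v = t
      · obtain ⟨rfl, rfl⟩ := h
        split_ifs <;> rfl
      · rw [bk_of_ne h]
        split_ifs
        · rw [bk_of_ne h]
        · rfl
        · rw [bk_of_ne h]
        · rfl
    simp only [h4]
    by_cases hst : (fun i => s (e (Sum.inl i))) = fun i => t (e (Sum.inl i))
    · rw [if_pos hst, Finset.sum_eq_single fun i => s (e (Sum.inl i))]
      · rw [if_pos ⟨rfl, hst.symm⟩]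
        rfl
      · intro q _ hq
        rw [if_neg fun h => hq h.1.symm, kron_zero_left]
      · simp
    · rw [if_neg hst, kron_zero_right, Finset.sum_eq_zero]
      intro q _
      rw [if_neg fun h => hst (h.1.trans h.2.symm), kron_zero_left]
  rw [← Circuit.runL_apply, key, LinearMap.sum_apply]
  rfl

theorem size_copyQuery_le (e : Fin a ⊕ Fin b ↪ W) :
    (copyQuery e : Circuit 𝒢 a' b' W (W ⊕ Fin a)).size ≤ 2 * Fintype.card W + 5 * a + 3 := by
  refine (Circuit.size_comp_le _ _).trans ?_
  rw [Circuit.size_build, Circuit.size_onRight, size_fanCircuit, cnotList]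
  simp
  omega

/-- The circuit that XORs a register into the answer wires. -/
noncomputable def addAnswer (e : Fin a ⊕ Fin b ↪ W) : Circuit 𝒢 a' b' (W ⊕ Fin b) W :=
  Circuit.build (W := W ⊕ Fin b) (Function.Embedding.refl _) Function.Embedding.inl
    (cnotList (fun i => Sum.inr i) ((answerEmb e).trans Function.Embedding.inl) (by simp)
      Finset.univ.toList)

theorem run_addAnswer (e : Fin a ⊕ Fin b ↪ W) (𝓞 : Oracle a' b') (ρ : Op W) (y : BitStr b) :
    (addAnswer e : Circuit 𝒢 a' b' (W ⊕ Fin b) W).run 𝓞 (kron ρ (ketbra y)) =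
      writeAnswer e y ρ := by
  let writeL : Op W →ₗ[ℂ] Op W :=
    { toFun := writeAnswer e y
      map_add' := fun ρ σ => by simp only [writeAnswer, conjBy, mul_add, add_mul]
      map_smul' := fun c ρ => by
        simp only [writeAnswer, conjBy, RingHom.id_apply, Matrix.mul_smul, Matrix.smul_mul] }
  have key : (addAnswer e : Circuit 𝒢 a' b' (W ⊕ Fin b) W).runL 𝓞 ∘ₗ
      (kronB W (Fin b)).flip (ketbra y) = writeL := op_linearMap_ext fun s t => by
    change Circuit.runL _ _ (kron (bk s t) (ketbra y)) = writeAnswer e y (bk s t)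
    have h1 : ∀ s : W → Bool, xorAt ((answerEmb e).trans Function.Embedding.inl :
        Fin b ↪ W ⊕ Fin b) (fun j => (Sum.elim s y : W ⊕ Fin b → Bool) (Sum.inr j)) (Sum.elim s y) =
        Sum.elim (xorAt (answerEmb e) y s) y := by
      intro s
      symm
      refine (eq_extend_iff _ _ _ _).2 ⟨?_, ?_⟩
      · funext i
        simp [xorAt]
      · rintro (w | i) hw
        · change xorAt (answerEmb e) y s w = s w
          rw [xorAt]
          exact extend_emb_of_notMem (answerEmb e) _ s fun k hk => hw k (congrArg Sum.inl hk)
        · rfl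
    rw [Circuit.runL_apply, ketbra_eq_bk, kron_bk, addAnswer, Circuit.run_build, Circuit.load_refl,
      acts_cnotList_bk, h1, h1, ← kron_bk, keep_inl, traceRight_kron, tr_bk, if_pos rfl, one_smul,
      writeAnswer, conjBy_basisMap_bk (xorAt_involutive _ _)]
  rw [← Circuit.runL_apply]
  exact congrArg (fun L => L ρ) key

theorem size_addAnswer (e : Fin a ⊕ Fin b ↪ W) :
    (addAnswer e : Circuit 𝒢 a' b' (W ⊕ Fin b) W).size = Fintype.card W + b + b := by
  rw [addAnswer, Circuit.size_build, cnotList]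
  simp

/-- On databases with less than `N` records, the circuit `Θ` answers queries and records them. -/
def AnswersWith {R : Type} [Fintype R] (Θ : Circuit 𝒢 a' b' (Fin a ⊕ X) (Fin b ⊕ X))
    (𝓞 : Oracle a' b') (ans : Records a b → BitStr a → R → BitStr b)
    (enc : Records a b → X → Bool) (N : ℕ) : Prop :=
  ∀ d, d.length < N → ∀ q, Θ.run 𝓞 (kron (ketbra q) (ketbra (enc d))) =
    (Fintype.card R : ℝ)⁻¹ • ∑ r, kron (ketbra (ans d q r)) (ketbra (enc ((q, ans d q r) :: d)))

/-- The circuit that performs a query by means of `Θ`. -/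
noncomputable def recQuery (Θ : Circuit 𝒢 a' b' (Fin a ⊕ X) (Fin b ⊕ X))
    (e : Fin a ⊕ Fin b ↪ W) : Circuit 𝒢 a' b' (W ⊕ X) (W ⊕ X) :=
  ((copyQuery e).onLeft X).comp ((Circuit.ofEquiv (Equiv.sumAssoc W (Fin a) X)).comp
    ((Θ.onRight W).comp ((Circuit.ofEquiv (Equiv.sumAssoc W (Fin b) X).symm).comp
      ((addAnswer e).onLeft X))))

theorem size_recQuery_le (Θ : Circuit 𝒢 a' b' (Fin a ⊕ X) (Fin b ⊕ X))
    (e : Fin a ⊕ Fin b ↪ W) :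
    (recQuery Θ e).size ≤ 12 * Fintype.card W + 4 * Fintype.card X + 3 + Θ.size := by
  have h1 := size_copyQuery_le (𝒢 := 𝒢) (a' := a') (b' := b') e
  have h2 := size_addAnswer (𝒢 := 𝒢) (a' := a') (b' := b') e
  have h3 := Fintype.card_le_of_embedding e
  refine (Circuit.size_comp_le _ _).trans ((add_le_add_right ((Circuit.size_comp_le _ _).trans
    (add_le_add_right ((Circuit.size_comp_le _ _).trans (add_le_add_right
      (Circuit.size_comp_le _ _) _)) _)) _).trans ?_)
  rw [Circuit.size_onLeft, Circuit.size_onLeft, Circuit.size_onRight, Circuit.size_ofEquiv,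
    Circuit.size_ofEquiv, h2]
  simp only [Fintype.card_sum, Fintype.card_fin] at h3 ⊢
  omega

/-- The circuit that performs a gate, with queries performed by means of `Θ`. -/
noncomputable def recGate (Θ : Circuit 𝒢 a' b' (Fin a ⊕ X) (Fin b ⊕ X)) (g : Gate 𝒢 a b W) :
    Circuit 𝒢 a' b' (W ⊕ X) (W ⊕ X) :=
  match g with
  | .query e => recQuery Θ e
  | g => (Circuit.ofGates g.retarget.toList).onLeft X

theorem recGate_of_not_isQuery (Θ : Circuit 𝒢 a' b' (Fin a ⊕ X) (Fin b ⊕ X)) {g : Gate 𝒢 a b W}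
    (h : g.isQuery = false) :
    recGate Θ g = (Circuit.ofGates g.retarget.toList).onLeft X := by
  cases g with
  | query e => simp [Gate.isQuery] at h
  | _ => rfl

/-- The circuit that performs a list of gates, with queries performed by means of `Θ`. -/
noncomputable def recGates (Θ : Circuit 𝒢 a' b' (Fin a ⊕ X) (Fin b ⊕ X)) :
    List (Gate 𝒢 a b W) → Circuit 𝒢 a' b' (W ⊕ X) (W ⊕ X)
  | [] => Circuit.ofGates []
  | g :: gs => (recGate Θ g).comp (recGates Θ gs)

/-- The size of `Θ` is charged per query and not per gate: in a circuit without queries, `Θ` must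
not count, as its size depends on the oracle lengths. -/
theorem size_recGates_le (Θ : Circuit 𝒢 a' b' (Fin a ⊕ X) (Fin b ⊕ X))
    (gs : List (Gate 𝒢 a b W)) :
    (recGates Θ gs).size ≤ Fintype.card W + Fintype.card X +
      gs.length * (12 * Fintype.card W + 4 * Fintype.card X + 3) + Gate.qcount gs * Θ.size := by
  induction gs with
  | nil => simp [recGates, Circuit.size_ofGates]
  | cons g gs ih =>
    refine (Circuit.size_comp_le _ _).trans ?_
    have hg : (recGate Θ g).size ≤ 12 * Fintype.card W + 4 * Fintype.card X + 3 +
        (if g.isQuery then 1 else 0) * Θ.size := by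
      rcases h : g.isQuery with _ | _
      · obtain ⟨g', hg'⟩ := Gate.exists_retarget (a' := a') (b' := b') h
        rw [recGate_of_not_isQuery Θ h, Circuit.size_onLeft, Circuit.size_ofGates, hg']
        simp
        omega
      · obtain ⟨e, rfl⟩ := Gate.exists_of_isQuery h
        rw [if_pos rfl, one_mul]
        exact size_recQuery_le Θ e
    have h2 : Gate.qcount (g :: gs) = Gate.qcount gs + if g.isQuery then 1 else 0 :=
      List.countP_cons
    rw [List.length_cons, h2, add_mul, add_mul]
    omega

variable {R : Type} [Fintype R] {Θ : Circuit 𝒢 a' b' (Fin a ⊕ X) (Fin b ⊕ X)} {𝓞 : Oracle a' b'}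
  {ans : Records a b → BitStr a → R → BitStr b} {enc : Records a b → X → Bool} {N : ℕ}

theorem run_real_smul {I J : Type} [Fintype I] [Fintype J] (C : Circuit 𝒢 a' b' I J)
    (𝓞 : Oracle a' b') (c : ℝ) (ρ : Op I) : C.run 𝓞 (c • ρ) = c • C.run 𝓞 ρ := by
  rw [← Complex.coe_smul, Circuit.run_smul, Complex.coe_smul]

theorem kron_real_smul_right {I J : Type} (c : ℝ) (ρ : Op I) (σ : Op J) :
    kron ρ (c • σ) = c • kron ρ σ := by
  rw [← Complex.coe_smul, kron_smul_right, Complex.coe_smul]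

theorem relabel_sum {I J ι : Type} (e : I ≃ J) (S : Finset ι) (f : ι → Op I) :
    relabel e (∑ i ∈ S, f i) = ∑ i ∈ S, relabel e (f i) := map_sum (relabelL e) f S

theorem relabel_real_smul {I J : Type} (e : I ≃ J) (c : ℝ) (ρ : Op I) :
    relabel e (c • ρ) = c • relabel e ρ := rfl

theorem run_recQuery (hΘ : AnswersWith Θ 𝓞 ans enc N) (e : Fin a ⊕ Fin b ↪ W) {d : Records a b}
    (hd : d.length < N) (ρ : Op W) :
    (recQuery Θ e).run 𝓞 (kron ρ (ketbra (enc d))) =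
      stepE (recording ans) (.query e : Gate 𝒢 a b W) (fun d σ => kron σ (ketbra (enc d))) d ρ := by
  simp only [recQuery, Circuit.run_comp, Circuit.run_onLeft_kron, run_copyQuery, kron_sum_left,
    Circuit.run_ofEquiv, relabel_sumAssoc, Circuit.run_sum, Circuit.run_onRight_kron]
  simp only [hΘ d hd, kron_real_smul_right, kron_sum_right, relabel_real_smul, relabel_sum,
    relabel_sumAssoc_symm, run_real_smul, Circuit.run_sum, Circuit.run_onLeft_kron, run_addAnswer]
  rw [stepE_query, ← Finset.smul_sum, Finset.sum_comm]
  rfl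

theorem run_recGate (hΘ : AnswersWith Θ 𝓞 ans enc N) (g : Gate 𝒢 a b W) {d : Records a b}
    (hd : g.isQuery = true → d.length < N) (ρ : Op W) :
    (recGate Θ g).run 𝓞 (kron ρ (ketbra (enc d))) =
      stepE (recording ans) g (fun d σ => kron σ (ketbra (enc d))) d ρ := by
  rcases h : g.isQuery with _ | _
  · obtain ⟨g', hg'⟩ := Gate.exists_retarget (a' := a') (b' := b') h
    rw [recGate_of_not_isQuery Θ h, Circuit.run_onLeft_kron, Circuit.run_ofGates, hg',
      stepE_of_not_isQuery _ h _ _ _ fun _ _ => false]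
    rw [← Gate.apply_of_retarget hg' _ 𝓞]
    rfl
  · obtain ⟨e, rfl⟩ := Gate.exists_of_isQuery h
    exact run_recQuery hΘ e (hd h) ρ

/-- Each query fills one slot, so the hypothesis reserves room for all queries still to come. -/
theorem run_recGates (hΘ : AnswersWith Θ 𝓞 ans enc N) (gs : List (Gate 𝒢 a b W))
    {d : Records a b} (hd : d.length + Gate.qcount gs ≤ N) (ρ : Op W) :
    (recGates Θ gs).run 𝓞 (kron ρ (ketbra (enc d))) =
      runE (recording ans) gs (fun d σ => kron σ (ketbra (enc d))) d ρ := by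
  induction gs generalizing d ρ with
  | nil => rw [recGates, Circuit.run_ofGates]; rfl
  | cons g gs ih =>
    have h2 : Gate.qcount (g :: gs) = Gate.qcount gs + if g.isQuery then 1 else 0 :=
      List.countP_cons
    rw [h2] at hd
    rw [recGates, Circuit.run_comp, run_recGate hΘ g (fun h => by rw [if_pos h] at hd; omega)]
    have h1 := map_stepE (((recGates Θ gs).runL 𝓞).restrictScalars ℝ) (recording ans) g
      (fun d σ => kron σ (ketbra (enc d))) d ρ
    simp only [LinearMap.restrictScalars_apply, Circuit.runL_apply] at h1
    rw [h1, runE_cons]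
    rcases h : g.isQuery with _ | _
    · rw [stepE_of_not_isQuery _ h _ _ _ fun _ _ => false,
        stepE_of_not_isQuery _ h _ _ _ fun _ _ => false]
      exact ih (by omega) _
    · obtain ⟨e, rfl⟩ := Gate.exists_of_isQuery h
      rw [stepE_query, stepE_query]
      congr 1
      refine Finset.sum_congr rfl fun r _ => Finset.sum_congr rfl fun q _ => ih ?_ _
      rw [if_pos h] at hd
      simp only [recording, List.length_cons]
      omega

/-! ### Recorded circuits and repeated evaluations -/

variable {I J Z K : Type} [Fintype I] [DecidableEq I] [Fintype J] [DecidableEq J]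
  [Fintype Z] [DecidableEq Z] [Fintype K] [DecidableEq K]

/-- The circuit `C`, with queries performed by means of `Θ`. -/
noncomputable def recCircuit (Θ : Circuit 𝒢 a' b' (Fin a ⊕ X) (Fin b ⊕ X))
    (C : Circuit 𝒢 a b I J) : Circuit 𝒢 a' b' (I ⊕ X) (J ⊕ X) :=
  ((Circuit.ofLoad C.inp).onLeft X).comp
    ((recGates Θ C.gates).comp ((Circuit.ofKeep C.out).onLeft X))

theorem run_recCircuit (hΘ : AnswersWith Θ 𝓞 ans enc N) (C : Circuit 𝒢 a b I J)
    {d : Records a b} (hd : d.length + C.qcount ≤ N) (ρ : Op I) :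
    (recCircuit Θ C).run 𝓞 (kron ρ (ketbra (enc d))) =
      circE (recording ans) C (fun d σ => kron σ (ketbra (enc d))) d ρ := by
  rw [recCircuit, Circuit.run_comp, Circuit.run_comp, Circuit.run_onLeft_kron, Circuit.run_ofLoad,
    run_recGates hΘ C.gates hd]
  have h1 := map_runE ((((Circuit.ofKeep C.out).onLeft X : Circuit 𝒢 a' b' _ _).runL
    𝓞).restrictScalars ℝ) (recording ans) C.gates (fun d σ => kron σ (ketbra (enc d))) d
    (load C.inp ρ)
  simp only [LinearMap.restrictScalars_apply, Circuit.runL_apply, Circuit.run_onLeft_kron,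
    Circuit.run_ofKeep] at h1
  exact h1

theorem size_recCircuit_le (Θ : Circuit 𝒢 a' b' (Fin a ⊕ X) (Fin b ⊕ X)) (C : Circuit 𝒢 a b I J) :
    (recCircuit Θ C).size ≤
      (C.size + 1) * (12 * C.size + 4 * Fintype.card X + 6) + C.qcount * Θ.size := by
  have h1 := size_recGates_le Θ C.gates
  refine (Circuit.size_comp_le _ _).trans ((add_le_add_right (Circuit.size_comp_le _ _) _).trans ?_)
  rw [Circuit.size_onLeft, Circuit.size_onLeft, Circuit.size_ofLoad, Circuit.size_ofKeep]
  have hl : C.gates.length ≤ C.size := Nat.le_add_left _ _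
  have hw : Fintype.card C.Wire ≤ C.size := Nat.le_add_right _ _
  have h2 : C.gates.length * (12 * Fintype.card C.Wire + 4 * Fintype.card X + 3) ≤
      C.size * (12 * C.size + 4 * Fintype.card X + 3) := by gcongr
  rw [Circuit.qcount]
  nlinarith

/-- The circuit that evaluates a program on a random input and discards the value, with queries
performed by means of `Θ`. -/
noncomputable def roundCircuit (Θ : Circuit 𝒢 a' b' (Fin a ⊕ X) (Fin b ⊕ X))
    (C : Circuit 𝒢 a b (Z ⊕ K) (Z ⊕ J)) (D : Circuit 𝒢 a' b' (Fin 0) K) :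
    Circuit 𝒢 a' b' (Z ⊕ X) (Z ⊕ X) :=
  (adjoin D (Z ⊕ X)).comp ((Circuit.ofEquiv (rightComm Z X K)).comp ((recCircuit Θ C).comp
    ((Circuit.ofEquiv (rightComm Z J X)).comp (Circuit.ofKeep Function.Embedding.inl))))

theorem traceRight_relabel_rightComm (ρ : Op (Z ⊕ J)) (σ : Op X) :
    traceRight (relabel (rightComm Z J X) (kron ρ σ)) = kron (traceRight ρ) σ := by
  funext s t
  simp only [kron, traceRight, Finset.sum_mul]
  refine Finset.sum_congr rfl fun u _ => ?_
  have h : ∀ s : Z ⊕ X → Bool, (fun i => (Sum.elim s u : (Z ⊕ X) ⊕ J → Bool)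
      (rightComm Z J X (Sum.inl i))) = Sum.elim (fun i => s (Sum.inl i)) u := by
    intro s
    funext i
    rcases i with i | i <;> rfl
  rw [← h s, ← h t]
  rfl

theorem kron_ofReal_smul {I J : Type} (c : ℝ) (ρ : Op I) (σ : Op J) :
    kron ρ ((c : ℂ) • σ) = c • kron ρ σ := by
  rw [kron_smul_right, Complex.coe_smul]

theorem run_roundCircuit (hΘ : AnswersWith Θ 𝓞 ans enc N) (C : Circuit 𝒢 a b (Z ⊕ K) (Z ⊕ J))
    {D : Circuit 𝒢 a' b' (Fin 0) K} {w : (K → Bool) → ℝ}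
    (hD : D.run 𝓞 (ketbra Fin.elim0) = ∑ x, (w x : ℂ) • ketbra x)
    {d : Records a b} (hd : d.length + C.qcount ≤ N) (ρ : Op Z) :
    (roundCircuit Θ C D).run 𝓞 (kron ρ (ketbra (enc d))) =
      roundE (recording ans) C w (fun d σ => kron σ (ketbra (enc d))) d ρ := by
  simp only [roundCircuit, Circuit.run_comp, run_adjoin, hD, kron_sum_right, kron_ofReal_smul,
    Circuit.run_sum, run_real_smul, Circuit.run_ofEquiv, relabel_rightComm]
  rw [roundE, evalE]
  refine Finset.sum_congr rfl fun x _ => congrArg (w x • ·) ?_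
  rw [run_recCircuit hΘ C hd, attach_eq_kron]
  have h1 := map_circE ((traceRightL ∘ₗ relabelL (rightComm Z J X)).restrictScalars ℝ)
    (recording ans) C (fun d σ => kron σ (ketbra (enc d))) d (kron ρ (ketbra x))
  rw [Circuit.run_ofKeep, keep_inl]
  refine h1.trans ?_
  congr 1
  funext d σ
  exact traceRight_relabel_rightComm _ _

theorem size_roundCircuit_le (Θ : Circuit 𝒢 a' b' (Fin a ⊕ X) (Fin b ⊕ X))
    (C : Circuit 𝒢 a b (Z ⊕ K) (Z ⊕ J)) (D : Circuit 𝒢 a' b' (Fin 0) K) :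
    (roundCircuit Θ C D).size ≤ D.size + 5 * C.size + 5 * Fintype.card X + (recCircuit Θ C).size := by
  have hi := Fintype.card_le_of_embedding C.inp
  have ho := Fintype.card_le_of_embedding C.out
  have hw : Fintype.card C.Wire ≤ C.size := Nat.le_add_right _ _
  refine (Circuit.size_comp_le _ _).trans ((add_le_add_right ((Circuit.size_comp_le _ _).trans
    (add_le_add_right ((Circuit.size_comp_le _ _).trans (add_le_add_right
      (Circuit.size_comp_le _ _) _)) _)) _).trans ?_)
  have h1 := size_adjoin_le (U := Z ⊕ X) D
  rw [Circuit.size_ofEquiv, Circuit.size_ofEquiv, Circuit.size_ofKeep]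
  simp only [Fintype.card_sum] at *
  omega

/-- A circuit repeated `i` times. -/
noncomputable def repeatCircuit {V : Type} [Fintype V] [DecidableEq V] (C : Circuit 𝒢 a' b' V V) :
    ℕ → Circuit 𝒢 a' b' V V
  | 0 => Circuit.ofGates []
  | i + 1 => (repeatCircuit C i).comp C

theorem size_repeatCircuit_le {V : Type} [Fintype V] [DecidableEq V] (C : Circuit 𝒢 a' b' V V)
    (i : ℕ) : (repeatCircuit C i).size ≤ Fintype.card V + i * C.size := by
  induction i with
  | zero => simp [repeatCircuit, Circuit.size_ofGates]
  | succ i ih =>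
    refine (Circuit.size_comp_le _ _).trans ?_
    rw [add_mul]
    omega

theorem run_repeat_roundCircuit (hΘ : AnswersWith Θ 𝓞 ans enc N)
    (C : Circuit 𝒢 a b (Z ⊕ K) (Z ⊕ J)) {D : Circuit 𝒢 a' b' (Fin 0) K} {w : (K → Bool) → ℝ}
    (hD : D.run 𝓞 (ketbra Fin.elim0) = ∑ x, (w x : ℂ) • ketbra x) (i : ℕ)
    {d : Records a b} (hd : d.length + i * C.qcount ≤ N) (ρ : Op Z) :
    (repeatCircuit (roundCircuit Θ C D) i).run 𝓞 (kron ρ (ketbra (enc d))) =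
      (roundE (recording ans) C w)^[i] (fun d σ => kron σ (ketbra (enc d))) d ρ := by
  induction i with
  | zero => rw [repeatCircuit, Circuit.run_ofGates]; rfl
  | succ i ih =>
    rw [add_mul, one_mul] at hd
    rw [repeatCircuit, Circuit.run_comp, ih (by omega), Function.iterate_succ_apply]
    have h1 := map_iterate_roundE (((roundCircuit Θ C D).runL 𝓞).restrictScalars ℝ)
      (recording ans) C w i (fun d σ => kron σ (ketbra (enc d))) d ρ
    simp only [LinearMap.restrictScalars_apply, Circuit.runL_apply] at h1
    rw [h1]
    exact iterate_roundE_congr _ _ _ _ _ _ fun d' σ hd' => run_roundCircuit hΘ C hD (by omega) σ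

end record

/-! ### Databases on registers -/

/-- A register with `L` slots for records and `L₁` slots for background records. -/
abbrev DBReg (a b L L₁ : ℕ) : Type := (Fin L ⊕ Fin L₁) × (Unit ⊕ (Fin a ⊕ Fin b))

section database

variable {a b L L₁ : ℕ}

theorem card_dbReg : Fintype.card (DBReg a b L L₁) = (L + L₁) * (1 + (a + b)) := by
  simp

/-- The contents of a slot: a bit that tells whether it is used, the query, and the answer. -/
def slotBits : Option (BitStr a × BitStr b) → Unit ⊕ (Fin a ⊕ Fin b) → Bool
  | none => fun _ => false
  | some p => Sum.elim (fun _ => true) (Sum.elim p.1 p.2)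

/-- The contents of a database register. -/
def encode (L L₁ : ℕ) (d d₁ : Records a b) : DBReg a b L L₁ → Bool :=
  fun s => slotBits (Sum.elim (fun i : Fin L => d[i.1]?) (fun j : Fin L₁ => d₁[j.1]?) s.1) s.2

/-- Whether a slot is used for the query `q`. -/
def isMatch (q : BitStr a) (v : Unit ⊕ (Fin a ⊕ Fin b) → Bool) : Bool :=
  v (Sum.inl ()) && (List.finRange a).all fun i => !(xor (q i) (v (Sum.inr (Sum.inl i))))

theorem isMatch_none (q : BitStr a) : isMatch q (slotBits (none : Option (BitStr a × BitStr b))) =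
    false := rfl

theorem isMatch_some (q : BitStr a) (p : BitStr a × BitStr b) :
    isMatch q (slotBits (some p)) = (q == p.1) := by
  rw [Bool.eq_iff_iff]
  simp only [isMatch, slotBits, Sum.elim_inl, Sum.elim_inr, Bool.true_and, List.all_eq_true,
    List.mem_finRange, true_implies, Bool.not_eq_true', bne_eq_false_iff_eq, beq_iff_eq, funext_iff]

/-- The answer recorded for `q` in a database register, and `r` if there is none. -/
def lookupBits (L L₁ : ℕ) (q : BitStr a) (x : DBReg a b L L₁ → Bool) (r : BitStr b) : BitStr b :=
  fun k => (((List.finRange L).map Sum.inl ++ (List.finRange L₁).map Sum.inr).foldr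
    (fun s acc => bif isMatch q (fun w => x (s, w)) then x (s, Sum.inr (Sum.inr k)) else acc) (r k))

/-- The right fold lets the earliest matching slot win, as `List.lookup` does. Unused slots never
match because their flag is off, and `d.length ≤ L` ensures that no record is cut off. -/
theorem foldr_slots (q : BitStr a) (k : Fin b) (L : ℕ) (d : Records a b) (hd : d.length ≤ L)
    (r : Bool) :
    (List.finRange L).foldr (fun i acc => bif isMatch q (slotBits d[i.1]?) then
      slotBits d[i.1]? (Sum.inr (Sum.inr k)) else acc) r =
      ((List.lookup q d).map fun y => y k).getD r := by
  induction d generalizing L with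
  | nil =>
    have : ∀ l : List (Fin L), l.foldr (fun i acc => bif isMatch q (slotBits
        ([] : Records a b)[i.1]?) then slotBits ([] : Records a b)[i.1]? (Sum.inr (Sum.inr k))
        else acc) r = r := by
      intro l
      induction l with
      | nil => rfl
      | cons i l ih => rw [List.foldr_cons, ih]; simp [isMatch_none]
    exact this _
  | cons p d ih =>
    obtain _ | L := L
    · simp at hd
    · rw [List.finRange_succ, List.foldr_cons, List.foldr_map]
      have h1 : ((p :: d)[(0 : Fin (L + 1)).1]?) = some p := rfl
      have h2 : ∀ i : Fin L, (p :: d)[i.succ.1]? = d[i.1]? := fun i => by simp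
      simp only [h1, h2, isMatch_some]
      rw [ih L (by simpa using hd), List.lookup_cons]
      by_cases hq : q == p.1
      · simp [hq, slotBits]
      · simp [hq]

theorem lookupBits_encode (q : BitStr a) {d d₁ : Records a b} (hd : d.length ≤ L)
    (hd₁ : d₁.length ≤ L₁) (r : BitStr b) :
    lookupBits L L₁ q (encode L L₁ d d₁) r = (List.lookup q (d ++ d₁)).getD r := by
  funext k
  rw [lookupBits, List.foldr_append, List.foldr_map, List.foldr_map, lookup_append_eq]
  have h1 := foldr_slots q k L₁ d₁ hd₁ (r k)
  have h2 := foldr_slots q k L d hd (((List.lookup q d₁).map fun y => y k).getD (r k))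
  refine ((congrArg (fun z => List.foldr _ z (List.finRange L)) h1).trans h2).trans ?_
  rcases List.lookup q d with _ | y <;> rcases List.lookup q d₁ with _ | y' <;> rfl

/-- The source of every bit of the register after recording a query and its answer. -/
def pushSource (a b L L₁ : ℕ) :
    Fin b ⊕ DBReg a b L L₁ → ((Fin a ⊕ DBReg a b L L₁) ⊕ Fin b) ⊕ Bool
  | Sum.inl k => Sum.inl (Sum.inr k)
  | Sum.inr (Sum.inr j, w) => Sum.inl (Sum.inl (Sum.inr (Sum.inr j, w)))
  | Sum.inr (Sum.inl ⟨0, _⟩, w) =>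
    Sum.elim (fun _ => Sum.inr true) (Sum.elim (fun i => Sum.inl (Sum.inl (Sum.inl i)))
      fun k => Sum.inl (Sum.inr k)) w
  | Sum.inr (Sum.inl ⟨i + 1, h⟩, w) =>
    Sum.inl (Sum.inl (Sum.inr (Sum.inl ⟨i, Nat.lt_of_succ_lt h⟩, w)))

/-- A new record shifts the slots by one and fills slot zero. A full register loses its last slot,
but `encode` truncates in the same place, so no bound on the length is required. -/
theorem fan_pushSource (q : BitStr a) (y : BitStr b) (d d₁ : Records a b) :
    fan (pushSource a b L L₁) (Sum.elim (Sum.elim q (encode L L₁ d d₁)) y) =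
      Sum.elim y (encode L L₁ ((q, y) :: d) d₁) := by
  funext w
  rcases w with k | ⟨⟨i, hi⟩ | j, w⟩
  · rfl
  · obtain _ | i := i
    · rcases w with _ | _ | _ <;> rfl
    · simp [fan, pushSource, encode]
  · rfl

end database

section lookup

variable {𝒢 : Set (Matrix.unitaryGroup Bool ℂ)} {a b a' b' L L₁ : ℕ} {U : Type}
  [Fintype U] [DecidableEq U]

theorem ComputesBit.foldr {ι : Type} (l : List ι) {c f : ι → (U → Bool) → Bool}
    {g : (U → Bool) → Bool} {k m n : ℕ} (hc : ∀ i, ComputesBit 𝒢 a b (c i) m)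
    (hf : ∀ i, ComputesBit 𝒢 a b (f i) n) (hg : ComputesBit 𝒢 a b g k) :
    ComputesBit 𝒢 a b (fun x => l.foldr (fun i acc => bif c i x then f i x else acc) (g x))
      (l.length * (2 * m + n + 5 * (5 * Fintype.card U + 10)) + k) := by
  induction l with
  | nil => exact hg.mono (by simp)
  | cons i l ih =>
    refine ((hc i).cond (hf i) ih).mono ?_
    rw [List.length_cons, add_mul]
    omega

theorem computesBit_isMatch (q : Fin a → U) (v : Unit ⊕ (Fin a ⊕ Fin b) → U) :
    ComputesBit 𝒢 a' b' (fun x => isMatch (fun i => x (q i)) fun w => x (v w))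
      (6 * (5 * Fintype.card U + 10) * (a + 2)) := by
  refine ((computesBit_var (v (Sum.inl ()))).and (ComputesBit.all (List.finRange a) fun i =>
    ((computesBit_var (q i)).xor (computesBit_var (v (Sum.inr (Sum.inl i))))).not)).mono ?_
  rw [List.length_finRange]
  nlinarith

/-- A bound for the size of a circuit that answers and records queries. -/
def answerSize (a b L : ℕ) : ℕ :=
  20 * (b + 1) * (L + 1) * (a + 4) * (5 * (a + b + L * (1 + (a + b))) + 10) +
    5 * b * (b + 1) + 2 * (b + 1) * (b + 1)

theorem answerSize_mono {a b L a' b' L' : ℕ} (ha : a ≤ a') (hb : b ≤ b') (hL : L ≤ L') :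
    answerSize a b L ≤ answerSize a' b' L' := by
  unfold answerSize
  gcongr

-- A random string `r` is always drawn beforehand. Each answer bit is then a deterministic fold over
-- the slots with `r` as default, and a fan pushes the query with its answer. Own slots precede
-- background slots, in agreement with `d ++ d₁`.
variable (𝒢 a b a' b' L L₁) in
theorem exists_lazy_answerer : ∃ Θ : Circuit 𝒢 a' b' (Fin a ⊕ DBReg a b L L₁)
    (Fin b ⊕ DBReg a b L L₁), Θ.size ≤ answerSize a b (L + L₁) ∧
    ∀ 𝓞 (d₁ : Records a b), d₁.length ≤ L₁ → AnswersWith Θ 𝓞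
      (fun d q r => (List.lookup q (d ++ d₁)).getD r) (fun d => encode L L₁ d d₁) L := by
  obtain ⟨Cr, hr1, hr2⟩ := exists_randomBits (𝒢 := 𝒢) (a := a') (b := b') b
  have hbit := computes_fin (𝒢 := 𝒢) (a := a') (b := b')
    (U := (Fin a ⊕ DBReg a b L L₁) ⊕ Fin b)
    (G := fun u => lookupBits L L₁ (fun i => u (Sum.inl (Sum.inl i)))
      (fun w => u (Sum.inl (Sum.inr w))) fun k => u (Sum.inr k)) fun k =>
    ComputesBit.foldr _ (fun s => computesBit_isMatch (fun i => Sum.inl (Sum.inl i))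
      fun w => Sum.inl (Sum.inr (s, w)))
      (fun s => computesBit_var (Sum.inl (Sum.inr (s, Sum.inr (Sum.inr k)))))
      (computesBit_var (Sum.inr k))
  have hpush := ((computes_fan (𝒢 := 𝒢) (a := a') (b := b')
    (U := (Fin a ⊕ DBReg a b L L₁) ⊕ Fin b) (fun w => Sum.inl (Sum.inl w))).pair hbit).comp
    (computes_fan (pushSource a b L L₁))
  obtain ⟨C, hC1, hC2⟩ := hpush
  refine ⟨(adjoin Cr _).comp C, ?_, fun 𝓞 d₁ hd₁ d hd q => ?_⟩
  · refine (Circuit.size_comp_le _ _).trans ((add_le_add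
      ((size_adjoin_le Cr).trans (add_le_add_right hr1 _)) hC1).trans ?_)
    simp only [Fintype.card_sum, card_dbReg, Fintype.card_fin, List.length_append, List.length_map,
      List.length_finRange]
    rw [answerSize]
    generalize hX : (L + L₁) * (1 + (a + b)) = X
    generalize L + L₁ = l
    have h1 : a + X + b = a + b + X := by ring
    rw [h1]
    generalize hv : 5 * (a + b + X) + 10 = v
    have hX1 : 5 * a + 5 * b + 5 * X + 10 ≤ v := by omega
    have h2 : (b + 1) * (l * (2 * (6 * v * (a + 2)) + v + 5 * v) + v + 5 * (a + b + X) + 2 * b +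
        10) ≤ (b + 1) * ((l + 1) * (12 * v * (a + 3))) + 2 * (b + 1) * (b + 1) := by
      have h3 : l * (2 * (6 * v * (a + 2)) + v + 5 * v) + v + 5 * (a + b + X) + 10 ≤
          (l + 1) * (12 * v * (a + 3)) := by
        nlinarith
      nlinarith
    have h4 : (b + 1) * ((l + 1) * (12 * v * (a + 3))) + 4 * v ≤
        20 * (b + 1) * (l + 1) * (a + 4) * v := by
      have h5 : 1 ≤ (b + 1) * (l + 1) * (a + 4) :=
        Nat.one_le_iff_ne_zero.2 (by positivity)
      have h6 : (b + 1) * ((l + 1) * (12 * v * (a + 3))) ≤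
          12 * ((b + 1) * (l + 1) * (a + 4)) * v := by
        calc (b + 1) * ((l + 1) * (12 * v * (a + 3)))
            ≤ (b + 1) * ((l + 1) * (12 * v * (a + 4))) := by gcongr; omega
          _ = _ := by ring
      nlinarith
    omega
  · have hlook := fun r => lookupBits_encode (L := L) (L₁ := L₁) q hd.le hd₁ r
    rw [Circuit.run_comp, run_adjoin, hr2, kron_smul_right, kron_sum_right, kron_ketbra,
      Circuit.run_smul, Circuit.run_sum]
    have h1 : ((Fintype.card (BitStr b) : ℕ) : ℂ)⁻¹ = (((Fintype.card (BitStr b) : ℝ)⁻¹ : ℝ) : ℂ) :=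
      by push_cast; rfl
    rw [h1, Complex.coe_smul]
    congr 1
    refine Finset.sum_congr rfl fun r _ => ?_
    rw [kron_ketbra, hC2, kron_ketbra]
    dsimp only
    rw [← hlook r, ← fan_pushSource]
    rfl

-- This is for the reduction: the true oracle writes into a fresh register, and the same push as in
-- the lazy answerer records the result. Hence simulated and genuine databases have the same format.
variable (𝒢 a b L) in
theorem exists_real_answerer : ∃ Θ : Circuit 𝒢 a b (Fin a ⊕ DBReg a b L 0)
    (Fin b ⊕ DBReg a b L 0), Θ.size ≤ answerSize a b L ∧
    ∀ 𝓞, AnswersWith Θ 𝓞 (fun _ q (_ : Unit) => 𝓞 q) (fun d => encode L 0 d []) L := by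
  let e : Fin a ⊕ Fin b ↪ (Fin a ⊕ DBReg a b L 0) ⊕ Fin b :=
    Function.Embedding.sumMap Function.Embedding.inl (Function.Embedding.refl _)
  refine ⟨(Circuit.build (W := (Fin a ⊕ DBReg a b L 0) ⊕ Fin b) Function.Embedding.inl
    (Function.Embedding.refl _) [Gate.query e]).comp (fanCircuit (pushSource a b L 0)), ?_,
    fun 𝓞 d _ q => ?_⟩
  · refine (Circuit.size_comp_le _ _).trans ?_
    rw [Circuit.size_build, size_fanCircuit, answerSize]
    simp only [Fintype.card_sum, card_dbReg, Fintype.card_fin, List.length_singleton, add_zero]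
    generalize hX : L * (1 + (a + b)) = X
    have h5 : 1 ≤ (b + 1) * (L + 1) * (a + 4) := Nat.one_le_iff_ne_zero.2 (by positivity)
    nlinarith
  · have h1 : xorAnswer 𝓞 e (ext0 (Function.Embedding.inl : _ ↪ (Fin a ⊕ DBReg a b L 0) ⊕ Fin b)
        (Sum.elim q (encode L 0 d []))) = Sum.elim (Sum.elim q (encode L 0 d [])) (𝓞 q) := by
      have h2 : ∀ w, ext0 (Function.Embedding.inl : _ ↪ (Fin a ⊕ DBReg a b L 0) ⊕ Fin b)
          (Sum.elim q (encode L 0 d [])) (Sum.inl w) = Sum.elim q (encode L 0 d []) w :=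
        fun w => ext0_apply _ _ w
      symm
      rw [xorAnswer_eq, xorAt, eq_extend_iff]
      refine ⟨?_, ?_⟩
      · funext k
        have h3 : ext0 (Function.Embedding.inl : _ ↪ (Fin a ⊕ DBReg a b L 0) ⊕ Fin b)
          (Sum.elim q (encode L 0 d [])) (Sum.inr k) = false := ext0_of_notMem _ _ (by simp)
        have h4 : (fun i => ext0 (Function.Embedding.inl : _ ↪ (Fin a ⊕ DBReg a b L 0) ⊕ Fin b)
          (Sum.elim q (encode L 0 d [])) (e (Sum.inl i))) = q := funext fun i => h2 (Sum.inl i)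
        rw [h4]
        change 𝓞 q k = xor (ext0 _ _ (Sum.inr k)) (𝓞 q k)
        rw [h3, Bool.false_xor]
      · rintro (w | k) hw
        · exact (h2 w).symm
        · exact absurd rfl (hw k)
    rw [Circuit.run_comp, Circuit.run_build, Circuit.keep_refl, kron_ketbra, ketbra_eq_bk, load_bk,
      ← ketbra_eq_bk, acts_cons, acts_nil, Gate.apply_query_ketbra, h1, run_fanCircuit_ketbra,
      fan_pushSource]
    simp [kron_ketbra]

/-- The circuit that turns the records of a database into background records. -/
noncomputable def toBackground (𝒢 : Set (Matrix.unitaryGroup Bool ℂ)) (a' b' a b L L₁ : ℕ) :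
    Circuit 𝒢 a' b' (DBReg a b L₁ 0) (DBReg a b L L₁) :=
  fanCircuit fun s => Sum.elim (fun _ => Sum.inr false) (fun j => Sum.inl (Sum.inl j, s.2)) s.1

theorem run_toBackground (𝓞 : Oracle a' b') (d : Records a b) :
    (toBackground 𝒢 a' b' a b L L₁).run 𝓞 (ketbra (encode L₁ 0 d [])) =
      ketbra (encode L L₁ [] d) := by
  rw [toBackground, run_fanCircuit_ketbra]
  congr 1
  funext s
  obtain ⟨i | j, w⟩ := s <;> rfl

/-- The circuit that deletes the background records. -/
noncomputable def dropBackground (𝒢 : Set (Matrix.unitaryGroup Bool ℂ)) (a' b' a b L L₁ : ℕ) :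
    Circuit 𝒢 a' b' (DBReg a b L L₁) (DBReg a b L 0) :=
  fanCircuit fun s => Sum.elim (fun i => Sum.inl (Sum.inl i, s.2)) (fun j => j.elim0) s.1

theorem run_dropBackground (𝓞 : Oracle a' b') (d d₁ : Records a b) :
    (dropBackground 𝒢 a' b' a b L L₁).run 𝓞 (ketbra (encode L L₁ d d₁)) =
      ketbra (encode L 0 d []) := by
  rw [dropBackground, run_fanCircuit_ketbra]
  congr 1
  funext s
  obtain ⟨i | j, w⟩ := s
  · rfl
  · exact j.elim0

/-- The circuit that outputs an empty database. -/
noncomputable def emptyDB (𝒢 : Set (Matrix.unitaryGroup Bool ℂ)) (a' b' a b L L₁ : ℕ) :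
    Circuit 𝒢 a' b' (Fin 0) (DBReg a b L L₁) := fanCircuit fun _ => Sum.inr false

theorem run_emptyDB (𝓞 : Oracle a' b') :
    (emptyDB 𝒢 a' b' a b L L₁).run 𝓞 (ketbra Fin.elim0) = ketbra (encode L L₁ [] []) := by
  rw [emptyDB, run_fanCircuit_ketbra]
  congr 1
  funext s
  obtain ⟨i | j, w⟩ := s <;> rfl

end lookup

/-! ### The plain scheme for one security parameter -/

section sampler

variable {𝒢 : Set (Matrix.unitaryGroup Bool ℂ)} {a b : ℕ} {K : Type} [Fintype K] [DecidableEq K]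

theorem run_measureAll (𝓞 : Oracle a b) (ρ : Op K) :
    (fanCircuit Sum.inl : Circuit 𝒢 a b K K).run 𝓞 ρ = ∑ x, ρ x x • ketbra x := by
  classical
  have key : (fanCircuit Sum.inl : Circuit 𝒢 a b K K).runL 𝓞 =
      ∑ x, (Matrix.entryLinearMap ℂ ℂ x x).smulRight (ketbra x) := op_linearMap_ext fun s t => by
    rw [Circuit.runL_apply, run_fanCircuit_bk, LinearMap.sum_apply]
    simp only [LinearMap.smulRight_apply, Matrix.entryLinearMap_apply]
    by_cases hst : s = t
    · subst hst
      rw [if_pos rfl, Finset.sum_eq_single s]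
      · rw [bk_of_eq ⟨rfl, rfl⟩, one_smul]
        rfl
      · intro x _ hx
        rw [bk_of_ne fun h => hx h.1, zero_smul]
      · simp
    · rw [if_neg hst, Finset.sum_eq_zero]
      intro x _
      rw [bk_of_ne fun h => hst (h.1.symm.trans h.2), zero_smul]
  rw [← Circuit.runL_apply, key, LinearMap.sum_apply]
  rfl

/-- The hypothesis determines only the diagonal of the output. Measuring removes the coherences, and
positivity makes the diagonal entries real. -/
theorem exists_sampler (D : Circuit 𝒢 0 0 (Fin 0) K) {w : (K → Bool) → ℝ}
    (hD : ∀ x, outcomeProb (D.run id (ketbra Fin.elim0)) x = w x) (a b : ℕ) :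
    ∃ D' : Circuit 𝒢 a b (Fin 0) K, D'.size ≤ D.size + 3 * Fintype.card K + 3 ∧
      ∀ 𝓞, D'.run 𝓞 (ketbra Fin.elim0) = ∑ x, (w x : ℂ) • ketbra x := by
  refine ⟨(D.lift a b).comp (fanCircuit Sum.inl), ?_, fun 𝓞 => ?_⟩
  · refine (Circuit.size_comp_le _ _).trans ?_
    have := D.size_lift_le (a := a) (b := b)
    rw [size_fanCircuit]
    omega
  · rw [Circuit.run_comp, Circuit.run_lift, run_measureAll]
    refine Finset.sum_congr rfl fun x _ => ?_
    rw [(Circuit.psd_run D id (psd_ketbra Fin.elim0)).diag_eq_re x, ← hD x]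
    rfl

end sampler

/-! ### Size bounds for the circuits of the scheme -/

section sizes

/-- A bound for the size of the database registers. -/
def dbSize (s k : ℕ) : ℕ := (k + 1) * s * (1 + s)

/-- A bound for the size of recorded circuits. -/
def recSize (s k : ℕ) : ℕ :=
  (s + 1) * (12 * s + 4 * dbSize s k + 6) + s * answerSize s s ((k + 1) * s)

/-- A bound for the size of repeated evaluations. -/
def roundsSize (s k : ℕ) : ℕ :=
  s + dbSize s k + k * (9 * s + 3 + 5 * dbSize s k + recSize s k)

/-- A bound for the size of the circuits of the plain scheme. -/
def plainSize (s k : ℕ) : ℕ :=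
  (k + 1) * (40 * s + 40 * dbSize s k + 50 + recSize s k + roundsSize s k)

/-- A database without slots has size zero whatever `a` and `b` are, so the oracle lengths need a
bound only for `0 < l`. -/
theorem dbSize_of_le {a b s k l : ℕ} (hl : l ≤ (k + 1) * s) (hab : 0 < l → a + b ≤ s) :
    l * (1 + (a + b)) ≤ dbSize s k := by
  rcases Nat.eq_zero_or_pos l with rfl | h
  · simp
  · rw [dbSize]
    have := hab h
    gcongr

theorem recSize_of_le {𝒢 : Set (Matrix.unitaryGroup Bool ℂ)} {a b a' b' s k l : ℕ} {X I J : Type}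
    [Fintype X] [DecidableEq X] [Fintype I] [DecidableEq I] [Fintype J] [DecidableEq J]
    {Θ : Circuit 𝒢 a' b' (Fin a ⊕ X) (Fin b ⊕ X)} {C : Circuit 𝒢 a b I J}
    (hΘ : Θ.size ≤ answerSize a b l) (hl : l ≤ (k + 1) * s) (hC : C.size ≤ s)
    (hX : Fintype.card X ≤ dbSize s k) : (recCircuit Θ C).size ≤ recSize s k := by
  refine (size_recCircuit_le Θ C).trans ?_
  have h1 : C.qcount * Θ.size ≤ s * answerSize s s ((k + 1) * s) := by
    have hq : C.qcount ≤ s := (List.countP_le_length).trans ((Nat.le_add_left _ _).trans hC)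
    rcases Nat.eq_zero_or_pos C.qcount with h | h
    · rw [h, zero_mul]
      exact Nat.zero_le _
    · obtain ⟨g, -, hg⟩ := List.countP_pos_iff.1 h
      obtain ⟨e, rfl⟩ := Gate.exists_of_isQuery hg
      have he := Fintype.card_le_of_embedding e
      rw [Fintype.card_sum, Fintype.card_fin, Fintype.card_fin] at he
      have hw : Fintype.card C.Wire ≤ s := (Nat.le_add_right _ _).trans hC
      exact Nat.mul_le_mul hq (hΘ.trans (answerSize_mono (by omega) (by omega) hl))
  rw [recSize]
  gcongr

/-- A query gate embeds its `a + b` wires into those of the circuit. This is the only control on the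
oracle lengths. -/
theorem Circuit.le_size_of_qcount_pos {𝒢 : Set (Matrix.unitaryGroup Bool ℂ)} {a b : ℕ} {I J : Type}
    {C : Circuit 𝒢 a b I J} (h : 0 < C.qcount) : a + b ≤ C.size := by
  obtain ⟨g, -, hg⟩ := List.countP_pos_iff.1 h
  obtain ⟨e, rfl⟩ := Gate.exists_of_isQuery hg
  have he := Fintype.card_le_of_embedding e
  rw [Fintype.card_sum, Fintype.card_fin, Fintype.card_fin] at he
  exact he.trans (Nat.le_add_right _ _)

theorem Circuit.qcount_le_size {𝒢 : Set (Matrix.unitaryGroup Bool ℂ)} {a b : ℕ} {I J : Type}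
    (C : Circuit 𝒢 a b I J) : C.qcount ≤ C.size :=
  List.countP_le_length.trans (Nat.le_add_left _ _)

end sizes

section plain

variable {𝒢 : Set (Matrix.unitaryGroup Bool ℂ)} {a b : ℕ} {I Z J K : Type} [Fintype I]
  [DecidableEq I] [Fintype Z] [DecidableEq Z] [Fintype J] [DecidableEq J] [Fintype K]
  [DecidableEq K] {M : Type} [AddCommGroup M] [Module ℝ M]

/-- Two lazy phases, the second with the records of the first as background, amount to a single
oracle sampled in advance. Lazy sampling is undone first for the rounds with `d₁` fixed, then for
`CP`. -/
theorem circE_iterate_roundE_lazy (cp : Circuit 𝒢 a b I Z) (ev : Circuit 𝒢 a b (Z ⊕ K) (Z ⊕ J))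
    (w : (K → Bool) → ℝ) (i : ℕ) {κ : Records a b → Records a b → Op Z → M}
    {κr : Oracle a b → Records a b → Op Z → M} {T : Oracle a b → Op Z →ₗ[ℝ] M}
    (h : ∀ d₁ d σ, κ d₁ d σ = oavg fun 𝓞 => κr (override (d ++ d₁) 𝓞) d σ)
    (hT : ∀ 𝓞 σ, (roundE (realA 𝓞) ev w)^[i] (κr 𝓞) [] σ = T 𝓞 σ) (ρ : Op I) :
    circE (lazyA []) cp (fun d₁ σ => (roundE (lazyA d₁) ev w)^[i] (κ d₁) [] σ) [] ρ =
      oavg fun 𝓞 => T 𝓞 (cp.run 𝓞 ρ) := by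
  have h1 := circE_lazy [] cp
    (κ := fun d₁ σ => (roundE (lazyA d₁) ev w)^[i] (κ d₁) [] σ)
    (κr := fun 𝓞 _ σ => T 𝓞 σ) (fun d σ => by
      rw [iterate_roundE_lazy d ev w i (h d)]
      simp only [List.nil_append, List.append_nil, hT]) [] ρ
  rw [h1]
  congr 1
  funext 𝓞
  exact circE_real 𝓞 cp (T 𝓞) [] ρ

theorem circE_iterate_roundE_evalE_lazy (cp : Circuit 𝒢 a b I Z)
    (ev : Circuit 𝒢 a b (Z ⊕ K) (Z ⊕ J)) (w : (K → Bool) → ℝ) (i : ℕ)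
    (κ : (K → Bool) → Op (Z ⊕ J) →ₗ[ℝ] M) (ρ : Op I) :
    circE (lazyA []) cp (fun d₁ σ => (roundE (lazyA d₁) ev w)^[i]
      (evalE (lazyA d₁) ev w fun x _ σ => κ x σ) [] σ) [] ρ =
      oavg fun 𝓞 => ∑ x, w x • κ x (ev.run 𝓞
        (attach ((roundL 𝓞 ev w)^[i] (cp.run 𝓞 ρ)) x)) := by
  let T (𝓞 : Oracle a b) : Op Z →ₗ[ℝ] M := ∑ x, w x •
    (κ x ∘ₗ (ev.runL 𝓞 ∘ₗ (kronB Z K).flip (ketbra x)).restrictScalars ℝ)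
  have hT : ∀ 𝓞 σ, T 𝓞 σ = ∑ x, w x • κ x (ev.run 𝓞 (attach σ x)) := by
    intro 𝓞 σ
    rw [LinearMap.sum_apply]
    refine Finset.sum_congr rfl fun x _ => ?_
    rw [attach_eq_kron, ← Circuit.runL_apply]
    rfl
  simp only [← hT]
  refine (circE_iterate_roundE_lazy cp ev w i
    (κ := fun d₁ => evalE (lazyA d₁) ev w fun x _ σ => κ x σ)
    (κr := fun 𝓞 => evalE (realA 𝓞) ev w fun x _ σ => κ x σ)
    (T := fun 𝓞 => T 𝓞 ∘ₗ ((roundL 𝓞 ev w) ^ i).restrictScalars ℝ)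
    (fun d₁ d σ => evalE_lazy d₁ ev w (κr := fun _ x _ σ => κ x σ)
      (fun x d σ => (oavg_const _).symm) d σ) (fun 𝓞 σ => ?_) ρ).trans ?_
  · have h1 : (evalE (realA 𝓞) ev w fun x _ σ => κ x σ) = fun _ σ => T 𝓞 σ := by
      funext d σ
      rw [evalE_real, hT]
    rw [h1, iterate_roundE_real, LinearMap.comp_apply, LinearMap.restrictScalars_apply,
      Module.End.pow_apply]
  · congr 1
    funext 𝓞
    rw [LinearMap.comp_apply, LinearMap.restrictScalars_apply, Module.End.pow_apply]

/-- The bound for fixed `d₁` is carried through the execution of `CP`, whose records number at most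
its gates. -/
theorem sum_circE_evalE_le (cp : Circuit 𝒢 a b I Z)
    (ev : Circuit 𝒢 a b (Z ⊕ K) (Z ⊕ J)) {w : (K → Bool) → ℝ} (hw0 : ∀ x, 0 ≤ w x)
    (hw1 : ∑ x, w x = 1) {κ : (K → Bool) → Op (Z ⊕ J) → ℝ} (h0 : ∀ x σ, PSD σ → 0 ≤ κ x σ)
    (h1 : ∀ x σ, PSD σ → κ x σ ≤ (tr σ).re) (k : ℕ) {ρ : Op I} (hρ : PSD ρ) :
    ∑ i ∈ Finset.range k, circE (lazyA []) cp (fun d₁ σ => (roundE (lazyA d₁) ev w)^[i]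
      (evalE (lazyA d₁) ev w fun x _ σ => κ x σ) [] σ) [] ρ ≤
    ∑ i ∈ Finset.range k, circE (lazyA []) cp (fun d₁ σ => (roundE (lazyA d₁) ev w)^[i]
      (evalE (lazyA []) ev w fun x _ σ => κ x σ) [] σ) [] ρ + cp.size * (tr ρ).re := by
  rw [← circE_sum, ← circE_sum, ← circE_tr (lazyA ([] : Records a b)) cp (cp.size : ℝ) [] ρ,
    ← circE_add]
  refine circE_mono _ cp [] hρ fun d₁ σ hd hσ => ?_
  refine (sum_evalE_lazy_le d₁ ev hw0 hw1 (fun x _ => h0 x) (fun x _ => h1 x) k hσ).trans ?_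
  gcongr
  · exact hσ.tr_re_nonneg
  · refine hd.trans ?_
    rw [List.length_nil, zero_add]
    exact Nat.le_add_left _ _

variable (cp : Circuit 𝒢 a b I Z) (ev : Circuit 𝒢 a b (Z ⊕ K) (Z ⊕ J))

/-- The program with the database of recorded queries. -/
noncomputable def withDB {a b : ℕ} (L : ℕ) (d : Records a b) (σ : Op Z) : Op (Z ⊕ DBReg a b L 0) :=
  kron σ (ketbra (encode L 0 d []))


theorem size_repeat_roundCircuit_le {a' b' L L₁ s k l : ℕ}
    {Θ : Circuit 𝒢 a' b' (Fin a ⊕ DBReg a b L L₁) (Fin b ⊕ DBReg a b L L₁)}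
    {D : Circuit 𝒢 a' b' (Fin 0) K} {n : ℕ} (hD : D.size ≤ n + 3 * Fintype.card K + 3)
    (hΘ : Θ.size ≤ answerSize a b l) (hl : l ≤ (k + 1) * s) (hs : ev.size + n ≤ s)
    (hX : Fintype.card (DBReg a b L L₁) ≤ dbSize s k) {i : ℕ} (hi : i ≤ k) :
    (repeatCircuit (roundCircuit Θ ev D) i).size ≤ roundsSize s k := by
  have h1 := size_roundCircuit_le Θ ev D
  have h2 := recSize_of_le (C := ev) hΘ hl (by omega) hX
  have h3 := Fintype.card_le_of_embedding ev.inp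
  have h4 : Fintype.card ev.Wire ≤ ev.size := Nat.le_add_right _ _
  refine (size_repeatCircuit_le _ i).trans ?_
  rw [Fintype.card_sum] at h3 ⊢
  refine add_le_add (by omega) (Nat.mul_le_mul hi ?_)
  omega

/-- For fixed `i`: recorded `CP` from an empty database, its records turned into background, `i`
recorded rounds, background deleted. `exists_mixture` then averages over `i`. -/
theorem exists_plain_cp (D : Circuit 𝒢 0 0 (Fin 0) K) {w : (K → Bool) → ℝ}
    (hD : ∀ x, outcomeProb (D.run id (ketbra Fin.elim0)) x = w x) {s : ℕ}
    (hs : cp.size + ev.size + D.size ≤ s) (m L : ℕ) (hL : L = 2 ^ m * ev.qcount) :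
    ∃ C : Circuit 𝒢 0 0 I (Z ⊕ DBReg a b L 0), C.size ≤ plainSize s (2 ^ m) ∧
      ∀ 𝓞 x, C.run 𝓞 (ketbra x) = ((2 : ℝ) ^ m)⁻¹ • ∑ i ∈ Finset.range (2 ^ m),
        circE (lazyA []) cp (fun d₁ σ => (roundE (lazyA d₁) ev w)^[i] (withDB L) [] σ) []
          (ketbra x) := by
  obtain ⟨D', hD1, hD2⟩ := exists_sampler D hD 0 0
  obtain ⟨Θ₀, h₀, h₀'⟩ := exists_lazy_answerer 𝒢 a b 0 0 cp.qcount 0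
  obtain ⟨Θ₁, h₁, h₁'⟩ := exists_lazy_answerer 𝒢 a b 0 0 L cp.qcount
  have hcp := cp.qcount_le_size
  have hev := ev.qcount_le_size
  have hl : L + cp.qcount ≤ (2 ^ m + 1) * s := by
    rw [add_mul, one_mul, hL]
    exact add_le_add (Nat.mul_le_mul_left _ (by omega)) (by omega)
  -- A nonempty database means that `CP` or `Eval` contains a query gate, and that gate bounds `a +
  -- b`.
  have hab : 0 < L + cp.qcount → a + b ≤ s := by
    intro h
    rcases Nat.eq_zero_or_pos cp.qcount with h' | h'
    · have : 0 < ev.qcount := Nat.pos_of_ne_zero fun h'' => by simp [hL, h', h''] at h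
      have := Circuit.le_size_of_qcount_pos this
      omega
    · have := Circuit.le_size_of_qcount_pos h'
      omega
  have hX0 : Fintype.card (DBReg a b cp.qcount 0) ≤ dbSize s (2 ^ m) := by
    rw [card_dbReg]
    exact dbSize_of_le (by omega) fun h => hab (by omega)
  have hX1 : Fintype.card (DBReg a b L cp.qcount) ≤ dbSize s (2 ^ m) := by
    rw [card_dbReg]
    exact dbSize_of_le hl hab
  have hX2 : Fintype.card (DBReg a b L 0) ≤ dbSize s (2 ^ m) := by
    rw [card_dbReg]
    exact dbSize_of_le (by omega) fun h => hab (by omega)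
  let C₁ (i : ℕ) := ((toBackground 𝒢 0 0 a b L cp.qcount).onRight Z).comp
    ((repeatCircuit (roundCircuit Θ₁ ev D') i).comp
      ((dropBackground 𝒢 0 0 a b L cp.qcount).onRight Z))
  let C (i : ℕ) := (adjoin (emptyDB 𝒢 0 0 a b cp.qcount 0) I).comp ((recCircuit Θ₀ cp).comp (C₁ i))
  have hCsize : ∀ i ≤ 2 ^ m, (C i).size ≤
      4 * s + 8 * dbSize s (2 ^ m) + 9 + recSize s (2 ^ m) + roundsSize s (2 ^ m) := by
    intro i hi
    refine (Circuit.size_comp_le _ _).trans ((add_le_add_right ((Circuit.size_comp_le _ _).trans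
      (add_le_add_right ((Circuit.size_comp_le _ _).trans (add_le_add_right
        (Circuit.size_comp_le _ _) _)) _)) _).trans ?_)
    have hr := size_repeat_roundCircuit_le (L := L) (L₁ := cp.qcount) (ev := ev) hD1 h₁ hl
      (by omega) hX1 hi
    have h2 := recSize_of_le (C := cp) (k := 2 ^ m) (s := s) h₀ (by omega) (by omega) hX0
    have h3 := size_adjoin_le (U := I) (emptyDB 𝒢 0 0 a b cp.qcount 0)
    have h4 := Fintype.card_le_of_embedding cp.inp
    have h5 := Fintype.card_le_of_embedding cp.out
    have h6 : Fintype.card cp.Wire ≤ cp.size := Nat.le_add_right _ _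
    rw [emptyDB, size_fanCircuit, Fintype.card_fin] at h3
    rw [Circuit.size_onRight, Circuit.size_onRight, toBackground, dropBackground, size_fanCircuit,
      size_fanCircuit, emptyDB]
    omega
  have hC₁ : ∀ 𝓞 i, i < 2 ^ m → ∀ (d₁ : Records a b) (σ : Op Z), d₁.length ≤ cp.qcount →
      (C₁ i).run 𝓞 (kron σ (ketbra (encode cp.qcount 0 d₁ []))) =
        (roundE (lazyA d₁) ev w)^[i] (withDB L) [] σ := by
    intro 𝓞 i hi d₁ σ hd
    have hi' : ([] : Records a b).length + i * ev.qcount ≤ L := by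
      rw [List.length_nil, zero_add, hL]
      exact Nat.mul_le_mul_right _ hi.le
    have h2 := run_repeat_roundCircuit (h₁' 𝓞 d₁ hd) ev (hD2 𝓞) i hi' σ
    rw [Circuit.run_comp, Circuit.run_onRight_kron, run_toBackground, Circuit.run_comp, h2]
    have h3 := map_iterate_roundE ((((dropBackground 𝒢 0 0 a b L cp.qcount).onRight Z).runL
      𝓞).restrictScalars ℝ) (lazyA d₁) ev w i
      (fun d σ => kron σ (ketbra (encode L cp.qcount d d₁))) [] σ
    simp only [LinearMap.restrictScalars_apply, Circuit.runL_apply, Circuit.run_onRight_kron,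
      run_dropBackground] at h3
    exact h3
  have hC : ∀ 𝓞 i, i < 2 ^ m → ∀ x, (C i).run 𝓞 (ketbra x) =
      circE (lazyA []) cp (fun d₁ σ => (roundE (lazyA d₁) ev w)^[i] (withDB L) [] σ) []
        (ketbra x) := by
    intro 𝓞 i hi x
    have h2 := run_recCircuit (h₀' 𝓞 [] (Nat.zero_le _)) cp (d := [])
      (by rw [List.length_nil, zero_add]) (ketbra x)
    rw [Circuit.run_comp, run_adjoin, run_emptyDB, Circuit.run_comp, h2]
    have h3 := map_circE (((C₁ i).runL 𝓞).restrictScalars ℝ) (lazyA []) cp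
      (fun d σ => kron σ (ketbra (encode cp.qcount 0 d []))) [] (ketbra x)
    simp only [LinearMap.restrictScalars_apply, Circuit.runL_apply] at h3
    refine h3.trans (circE_congr _ _ _ _ fun d' σ hd' => hC₁ 𝓞 i hi d' σ ?_)
    rwa [List.length_nil, zero_add] at hd'
  -- `exists_mixture` asks for a size bound at every index; capping the index supplies it without
  -- changing those below `2 ^ m`.
  obtain ⟨E, hE1, hE2⟩ := exists_mixture m _ (fun i => C (min i (2 ^ m)))
    fun i => hCsize _ (min_le_right _ _)
  refine ⟨E, ?_, fun 𝓞 x => ?_⟩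
  · have h4 := Fintype.card_le_of_embedding cp.inp
    have h5 := Fintype.card_le_of_embedding cp.out
    have h6 : Fintype.card cp.Wire ≤ cp.size := Nat.le_add_right _ _
    rw [Fintype.card_sum] at hE1
    refine (Nat.le_of_add_right_le hE1).trans ?_
    rw [plainSize]
    exact Nat.mul_le_mul (Nat.le_succ _) (by omega)
  · have h2 : ((2 : ℂ) ^ m)⁻¹ = ((((2 : ℝ) ^ m)⁻¹ : ℝ) : ℂ) := by push_cast; rfl
    rw [hE2, h2, Complex.coe_smul]
    congr 1
    refine Finset.sum_congr rfl fun i hi => ?_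
    rw [Finset.mem_range] at hi
    rw [min_eq_left hi.le, hC 𝓞 i hi]

theorem exists_plain_eval {s : ℕ} (hs : ev.size ≤ s) (m L : ℕ) (hL : L = 2 ^ m * ev.qcount) :
    ∃ C : Circuit 𝒢 0 0 ((Z ⊕ DBReg a b L 0) ⊕ K) ((Z ⊕ DBReg a b L 0) ⊕ J),
      C.size ≤ plainSize s (2 ^ m) ∧
      ∀ 𝓞 d, d.length + ev.qcount ≤ L → ∀ ρ x, C.run 𝓞 (attach (withDB L d ρ) x) =
        relabel (rightComm Z J (DBReg a b L 0)) (circE (lazyA []) ev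
          (fun d σ => kron σ (ketbra (encode L 0 d []))) d (attach ρ x)) := by
  obtain ⟨Θ, h, h'⟩ := exists_lazy_answerer 𝒢 a b 0 0 L 0
  have hev := ev.qcount_le_size
  have hl : L ≤ (2 ^ m + 1) * s := by
    rw [add_mul, one_mul, hL]
    exact le_add_right (Nat.mul_le_mul_left _ (by omega))
  have hX : Fintype.card (DBReg a b L 0) ≤ dbSize s (2 ^ m) := by
    rw [card_dbReg]
    refine dbSize_of_le hl fun h => ?_
    have : 0 < ev.qcount := Nat.pos_of_ne_zero fun h'' => by simp [hL, h''] at h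
    have := Circuit.le_size_of_qcount_pos this
    omega
  have inst : DecidableEq ((Z ⊕ DBReg a b L 0) ⊕ J) := instDecidableEqSum
  refine ⟨(Circuit.ofEquiv (rightComm Z (DBReg a b L 0) K)).comp ((recCircuit Θ ev).comp
    (Circuit.ofEquiv (rightComm Z J (DBReg a b L 0)))), ?_, fun 𝓞 d hd ρ x => ?_⟩
  · refine (Circuit.size_comp_le _ _).trans ((add_le_add_right (Circuit.size_comp_le _ _) _).trans ?_)
    have h2 := recSize_of_le (C := ev) h hl hs hX
    have h3 := Fintype.card_le_of_embedding ev.inp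
    have h4 := Fintype.card_le_of_embedding ev.out
    have h5 : Fintype.card ev.Wire ≤ ev.size := Nat.le_add_right _ _
    rw [Circuit.size_ofEquiv, Circuit.size_ofEquiv, plainSize, add_mul, one_mul]
    simp only [Fintype.card_sum] at h3 h4 hX ⊢
    omega
  · rw [Circuit.run_comp, Circuit.run_ofEquiv, withDB, attach_eq_kron, relabel_rightComm,
      Circuit.run_comp, Circuit.run_ofEquiv, attach_eq_kron]
    congr 1
    exact run_recCircuit (h' 𝓞 [] (Nat.zero_le _)) ev hd (kron ρ (ketbra x))

/-- The attacker's imitation of the preparation: it starts from a given program and uses real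
queries, with no access to the records of `CP`. -/
theorem exists_real_rounds (D : Circuit 𝒢 0 0 (Fin 0) K) {w : (K → Bool) → ℝ}
    (hD : ∀ x, outcomeProb (D.run id (ketbra Fin.elim0)) x = w x) {s : ℕ}
    (hs : ev.size + D.size ≤ s) (m L : ℕ) (hL : L = 2 ^ m * ev.qcount) {i : ℕ} (hi : i < 2 ^ m) :
    ∃ C : Circuit 𝒢 a b Z (Z ⊕ DBReg a b L 0), C.size ≤ plainSize s (2 ^ m) ∧
      ∀ 𝓞 ρ, C.run 𝓞 ρ = (roundE (realA 𝓞) ev w)^[i] (withDB L) [] ρ := by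
  obtain ⟨D', hD1, hD2⟩ := exists_sampler D hD a b
  obtain ⟨Θ, h, h'⟩ := exists_real_answerer 𝒢 a b L
  have hev := ev.qcount_le_size
  have hl : L ≤ (2 ^ m + 1) * s := by
    rw [add_mul, one_mul, hL]
    exact le_add_right (Nat.mul_le_mul_left _ (by omega))
  have hX : Fintype.card (DBReg a b L 0) ≤ dbSize s (2 ^ m) := by
    rw [card_dbReg]
    refine dbSize_of_le hl fun h => ?_
    have : 0 < ev.qcount := Nat.pos_of_ne_zero fun h'' => by simp [hL, h''] at h
    have := Circuit.le_size_of_qcount_pos this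
    omega
  refine ⟨(adjoin (emptyDB 𝒢 a b a b L 0) Z).comp (repeatCircuit (roundCircuit Θ ev D') i), ?_,
    fun 𝓞 ρ => ?_⟩
  · refine (Circuit.size_comp_le _ _).trans ?_
    have hr := size_repeat_roundCircuit_le (L := L) (L₁ := 0) (ev := ev) hD1 h hl hs hX hi.le
    have h3 := size_adjoin_le (U := Z) (emptyDB 𝒢 a b a b L 0)
    have h4 := Fintype.card_le_of_embedding ev.inp
    have h5 : Fintype.card ev.Wire ≤ ev.size := Nat.le_add_right _ _
    rw [emptyDB, size_fanCircuit, Fintype.card_fin] at h3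
    rw [plainSize, add_mul, one_mul, emptyDB]
    rw [Fintype.card_sum] at h4
    omega
  · have hi' : ([] : Records a b).length + i * ev.qcount ≤ L := by
      rw [List.length_nil, zero_add, hL]
      exact Nat.mul_le_mul_right _ hi.le
    rw [Circuit.run_comp, run_adjoin, run_emptyDB]
    exact run_repeat_roundCircuit (h' 𝓞) ev (hD2 𝓞) i hi' ρ

end plain

/-! ### Polynomial bounds -/

theorem PolyBounded.mono {s t : ℕ → ℕ} (ht : PolyBounded t) (h : ∀ n, s n ≤ t n) :
    PolyBounded s := by
  obtain ⟨p, hp⟩ := ht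
  exact ⟨p, fun n => (h n).trans (hp n)⟩

theorem polyBounded_const (c : ℕ) : PolyBounded fun _ => c := ⟨Polynomial.C c, fun n => by simp⟩

theorem polyBounded_eval (p : Polynomial ℕ) : PolyBounded fun n => p.eval n := ⟨p, fun _ => le_rfl⟩

theorem PolyBounded.add {s t : ℕ → ℕ} (hs : PolyBounded s) (ht : PolyBounded t) :
    PolyBounded fun n => s n + t n := by
  obtain ⟨p, hp⟩ := hs
  obtain ⟨q, hq⟩ := ht
  exact ⟨p + q, fun n => by rw [Polynomial.eval_add]; exact add_le_add (hp n) (hq n)⟩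

theorem PolyBounded.mul {s t : ℕ → ℕ} (hs : PolyBounded s) (ht : PolyBounded t) :
    PolyBounded fun n => s n * t n := by
  obtain ⟨p, hp⟩ := hs
  obtain ⟨q, hq⟩ := ht
  exact ⟨p * q, fun n => by rw [Polynomial.eval_mul]; exact Nat.mul_le_mul (hp n) (hq n)⟩

theorem polyBounded_plainSize {s k : ℕ → ℕ} (hs : PolyBounded s) (hk : PolyBounded k) :
    PolyBounded fun n => plainSize (s n) (k n) := by
  have c := polyBounded_const
  have hl : PolyBounded fun n => (k n + 1) * s n := (hk.add (c 1)).mul hs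
  have hd : PolyBounded fun n => dbSize (s n) (k n) := hl.mul ((c 1).add hs)
  have ha : PolyBounded fun n => answerSize (s n) (s n) ((k n + 1) * s n) :=
    ((((((c 20).mul (hs.add (c 1))).mul (hl.add (c 1))).mul (hs.add (c 4))).mul
      (((c 5).mul ((hs.add hs).add (hl.mul ((c 1).add (hs.add hs))))).add (c 10))).add
      (((c 5).mul hs).mul (hs.add (c 1)))).add
      (((c 2).mul (hs.add (c 1))).mul (hs.add (c 1)))
  have hr : PolyBounded fun n => recSize (s n) (k n) :=
    ((hs.add (c 1)).mul ((((c 12).mul hs).add ((c 4).mul hd)).add (c 6))).add (hs.mul ha)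
  have ho : PolyBounded fun n => roundsSize (s n) (k n) :=
    (hs.add hd).add (hk.mul (((((c 9).mul hs).add (c 3)).add ((c 5).mul hd)).add hr))
  exact (hk.add (c 1)).mul
    ((((((c 40).mul hs).add ((c 40).mul hd)).add (c 50)).add hr).add ho)

theorem Negligible.add {μ ν : ℕ → ℝ} (hμ : Negligible μ) (hν : Negligible ν) :
    Negligible fun n => μ n + ν n := Asymptotics.SuperpolynomialDecay.add hμ hν

theorem Negligible.eventually_lt {μ : ℕ → ℝ} (hμ : Negligible μ) (p : Polynomial ℕ) :
    ∀ᶠ n in Filter.atTop, ((p.eval n : ℕ) : ℝ) * μ n < 1 / 2 := by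
  have h := (Asymptotics.SuperpolynomialDecay.polynomial_mul hμ
    (p.map (Nat.castRingHom ℝ))) 0
  simp only [pow_zero, one_mul] at h
  filter_upwards [h.eventually_lt_const (by norm_num : (0 : ℝ) < 1 / 2)] with n hn
  rwa [← map_natCast (Nat.castRingHom ℝ) n, Polynomial.eval_map_apply] at hn

/-- Uniform indices are made from coins, so the number of rounds has to be a power of two; one
exists within a constant factor of `N + 1`. -/
theorem exists_pow_two (N : ℕ) : ∃ m, N < 2 ^ m ∧ 2 ^ m ≤ 2 * N + 2 := by
  refine ⟨Nat.log 2 (N + 1) + 1, ?_, ?_⟩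
  · exact (Nat.lt_succ_self N).trans (Nat.lt_pow_succ_log_self (by norm_num) (N + 1))
  · have := Nat.pow_log_le_self 2 (Nat.succ_ne_zero N)
    rw [pow_succ]
    simp only [Nat.succ_eq_add_one] at this
    omega

/-! ### The success probability of the plain scheme -/

section values

variable {𝒢 : Set (Matrix.unitaryGroup Bool ℂ)} {a b : ℕ} {I Z J K : Type} [Fintype I]
  [DecidableEq I] [Fintype Z] [DecidableEq Z] [Fintype J] [DecidableEq J] [Fintype K]
  [DecidableEq K]

/-- The probability of an outcome of the second register as a linear map. -/
noncomputable def outcomeProbRightL (y : J → Bool) : Op (Z ⊕ J) →ₗ[ℝ] ℝ where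
  toFun ρ := outcomeProbRight ρ y
  map_add' ρ σ := by simp [outcomeProbRight, Finset.sum_add_distrib]
  map_smul' c ρ := by simp [outcomeProbRight, Finset.mul_sum]

theorem outcomeProbRight_nonneg {ρ : Op (Z ⊕ J)} (h : PSD ρ) (y : J → Bool) :
    0 ≤ outcomeProbRight ρ y := Finset.sum_nonneg fun _ _ => h.diag_re_nonneg _

theorem outcomeProbRight_le_tr {ρ : Op (Z ⊕ J)} (h : PSD ρ) (y : J → Bool) :
    outcomeProbRight ρ y ≤ (tr ρ).re := by
  rw [← tr_traceRight, tr_eq, Complex.re_sum]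
  refine Finset.sum_le_sum fun s _ => ?_
  rw [traceRight, Complex.re_sum]
  exact Finset.single_le_sum (f := fun u => (ρ (Sum.elim s u) (Sum.elim s u)).re)
    (fun _ _ => h.diag_re_nonneg _) (Finset.mem_univ y)

theorem outcomeProbRight_relabel_rightComm {X : Type} [Fintype X] [DecidableEq X] (σ : Op (Z ⊕ J))
    (c : X → Bool) (y : J → Bool) :
    outcomeProbRight (relabel (rightComm Z J X) (kron σ (ketbra c))) y =
      outcomeProbRight σ y := by
  have h : ∀ (s : Z → Bool) (v : X → Bool), relabel (rightComm Z J X) (kron σ (ketbra c))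
      (Sum.elim (Sum.elim s v) y) (Sum.elim (Sum.elim s v) y) =
      if v = c then σ (Sum.elim s y) (Sum.elim s y) else 0 := by
    intro s v
    have h1 : (fun i => (Sum.elim (Sum.elim s v) y : (Z ⊕ X) ⊕ J → Bool)
        (rightComm Z J X (Sum.inl i))) = Sum.elim s y := by
      funext i
      rcases i with i | i <;> rfl
    change σ (fun i => (Sum.elim (Sum.elim s v) y : (Z ⊕ X) ⊕ J → Bool)
        (rightComm Z J X (Sum.inl i))) (fun i => (Sum.elim (Sum.elim s v) y : (Z ⊕ X) ⊕ J → Bool)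
        (rightComm Z J X (Sum.inl i))) * (if v = c ∧ v = c then 1 else 0) = _
    rw [h1]
    by_cases hv : v = c <;> simp [hv]
  rw [outcomeProbRight, outcomeProbRight, ← Equiv.sum_comp (Equiv.sumArrowEquivProdArrow Z X Bool).symm,
    Fintype.sum_prod_type]
  refine Finset.sum_congr rfl fun s _ => ?_
  have h2 : ∀ v : X → Bool, (Equiv.sumArrowEquivProdArrow Z X Bool).symm (s, v) = Sum.elim s v :=
    fun v => rfl
  simp only [h2, h, apply_ite Complex.re, Complex.zero_re]
  simp

variable {cp : Circuit 𝒢 a b I Z} {ev : Circuit 𝒢 a b (Z ⊕ K) (Z ⊕ J)} {w : (K → Bool) → ℝ}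
  {m L : ℕ}

theorem plain_success (hL : L = 2 ^ m * ev.qcount) {C : Circuit 𝒢 0 0 I (Z ⊕ DBReg a b L 0)}
    {E : Circuit 𝒢 0 0 ((Z ⊕ DBReg a b L 0) ⊕ K) ((Z ⊕ DBReg a b L 0) ⊕ J)}
    (hC : ∀ 𝓞 x, C.run 𝓞 (ketbra x) = ((2 : ℝ) ^ m)⁻¹ • ∑ i ∈ Finset.range (2 ^ m),
      circE (lazyA []) cp (fun d₁ σ => (roundE (lazyA d₁) ev w)^[i] (withDB L) [] σ) [] (ketbra x))
    (hE : ∀ 𝓞 d, d.length + ev.qcount ≤ L → ∀ ρ x, E.run 𝓞 (attach (withDB L d ρ) x) =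
      relabel (rightComm Z J (DBReg a b L 0)) (circE (lazyA []) ev
        (fun d σ => kron σ (ketbra (encode L 0 d []))) d (attach ρ x)))
    (F : (K → Bool) → (J → Bool)) (𝓞 : Oracle 0 0) (v : I → Bool) :
    ∑ x, w x * outcomeProbRight (E.run 𝓞 (attach (C.run 𝓞 (ketbra v)) x)) (F x) =
      ((2 : ℝ) ^ m)⁻¹ * ∑ i ∈ Finset.range (2 ^ m),
        circE (lazyA []) cp (fun d₁ σ => (roundE (lazyA d₁) ev w)^[i]
          (evalE (lazyA []) ev w fun x _ σ => outcomeProbRight σ (F x)) [] σ) [] (ketbra v) := by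
  let G : Op (Z ⊕ DBReg a b L 0) →ₗ[ℝ] ℝ := ∑ x, w x • (outcomeProbRightL (F x) ∘ₗ
    (E.runL 𝓞 ∘ₗ (kronB _ K).flip (ketbra x)).restrictScalars ℝ)
  have hG : ∀ τ, G τ = ∑ x, w x * outcomeProbRight (E.run 𝓞 (attach τ x)) (F x) := by
    intro τ
    rw [LinearMap.sum_apply]
    refine Finset.sum_congr rfl fun x _ => ?_
    rw [attach_eq_kron, ← Circuit.runL_apply]
    rfl
  have hG' : ∀ (d : Records a b) (σ : Op Z), d.length + ev.qcount ≤ L → G (withDB L d σ) =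
      evalE (lazyA []) ev w (fun x _ σ => outcomeProbRight σ (F x)) d σ := by
    intro d σ hd
    rw [hG]
    refine Finset.sum_congr rfl fun x _ => congrArg (w x * ·) ?_
    rw [hE 𝓞 d hd]
    have h1 := map_circE (outcomeProbRightL (F x) ∘ₗ
      (relabelL (rightComm Z J (DBReg a b L 0))).restrictScalars ℝ) (lazyA []) ev
      (fun d σ => kron σ (ketbra (encode L 0 d []))) d (attach σ x)
    refine h1.trans ?_
    congr 1
    funext d σ
    exact outcomeProbRight_relabel_rightComm _ _ _
  rw [← hG, hC, map_smul, map_sum, smul_eq_mul]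
  refine congrArg _ (Finset.sum_congr rfl fun i hi => ?_)
  rw [map_circE]
  congr 1
  funext d₁ σ
  rw [map_iterate_roundE]
  refine iterate_roundE_congr _ _ _ _ _ _ fun d σ hd => hG' d σ ?_
  -- The strict bound `i < 2 ^ m` leaves room in the database for the evaluation that follows the
  -- `i` rounds.
  have h2 : (i + 1) * ev.qcount ≤ L := by
    rw [hL]
    exact Nat.mul_le_mul_right _ (Finset.mem_range.1 hi)
  rw [List.length_nil] at hd
  rw [add_mul, one_mul] at h2
  omega

/-- The outcome of the piracy experiment with given circuits, as a linear function of the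
program. -/
noncomputable def pirateL {RB RC : Type} [Fintype RB] [Fintype RC] (𝓞 : Oracle a b)
    (A : Circuit 𝒢 a b Z (RB ⊕ RC)) (B : Circuit 𝒢 a b (RB ⊕ K) J) (C : Circuit 𝒢 a b (RC ⊕ K) J)
    (w : (K → Bool) → ℝ) (F : (K → Bool) → (J → Bool)) : Op Z →ₗ[ℝ] ℝ where
  toFun τ := ∑ xB, ∑ xC, w xB * w xC * outcomeProb ((B.par C).run 𝓞
    (relabel (Equiv.sumSumSumComm RB RC K K) (attach (A.run 𝓞 τ) (Sum.elim xB xC))))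
    (Sum.elim (F xB) (F xC))
  map_add' ρ σ := by
    simp only [← Finset.sum_add_distrib, ← mul_add]
    refine Finset.sum_congr rfl fun xB _ => Finset.sum_congr rfl fun xC _ => congrArg _ ?_
    simp only [attach_eq_kron, ← Circuit.runL_apply, ← relabelL_apply, map_add, ← kronB_apply,
      LinearMap.add_apply]
    simp [outcomeProb]
  map_smul' c ρ := by
    simp only [Finset.mul_sum, smul_eq_mul, RingHom.id_apply, mul_left_comm c]
    refine Finset.sum_congr rfl fun xB _ => Finset.sum_congr rfl fun xC _ => congrArg _ ?_
    simp only [attach_eq_kron, ← Circuit.runL_apply, ← relabelL_apply, ← Complex.coe_smul, map_smul,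
      ← kronB_apply, LinearMap.smul_apply]
    simp [outcomeProb]

theorem run_par_lift {I J I₁ J₁ : Type} [Fintype I] [Fintype J] [Fintype I₁] [Fintype J₁]
    (B : Circuit 𝒢 0 0 I J) (C : Circuit 𝒢 0 0 I₁ J₁) (𝓞 : Oracle a b) (ρ : Op (I ⊕ I₁)) :
    ((B.lift a b).par (C.lift a b)).run 𝓞 ρ = (B.par C).run id ρ := by
  have h : ((B.lift a b).par (C.lift a b)).runL 𝓞 = (B.par C).runL id :=
    op_sum_linearMap_ext fun ρ σ => by
      rw [Circuit.runL_apply, Circuit.runL_apply, Circuit.run_par_kron, Circuit.run_par_kron,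
        Circuit.run_lift, Circuit.run_lift]
  rw [← Circuit.runL_apply, h, Circuit.runL_apply]

theorem pirateL_lift {RB RC V : Type} [Fintype RB] [Fintype RC] [Fintype V] (𝓞 : Oracle a b)
    (A : Circuit 𝒢 0 0 V (RB ⊕ RC)) (B : Circuit 𝒢 0 0 (RB ⊕ K) J) (C : Circuit 𝒢 0 0 (RC ⊕ K) J)
    (w : (K → Bool) → ℝ) (F : (K → Bool) → (J → Bool)) (T : Circuit 𝒢 a b Z V) (τ : Op Z) :
    pirateL 𝓞 (T.comp (A.lift a b)) (B.lift a b) (C.lift a b) w F τ =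
      pirateL id A B C w F (T.run 𝓞 τ) := by
  simp only [pirateL, LinearMap.coe_mk, AddHom.coe_mk, run_par_lift, Circuit.run_comp,
    Circuit.run_lift]

/-- For each `i` the plain program is the oracle average of `T i` applied to the original program.
The attack on it is a linear functional that does not involve the oracle, so it commutes with the
average. -/
theorem plain_pirate {RB RC : Type} [Fintype RB] [Fintype RC]
    {C : Circuit 𝒢 0 0 I (Z ⊕ DBReg a b L 0)}
    (hC : ∀ 𝓞 x, C.run 𝓞 (ketbra x) = ((2 : ℝ) ^ m)⁻¹ • ∑ i ∈ Finset.range (2 ^ m),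
      circE (lazyA []) cp (fun d₁ σ => (roundE (lazyA d₁) ev w)^[i] (withDB L) [] σ) [] (ketbra x))
    {T : ℕ → Circuit 𝒢 a b Z (Z ⊕ DBReg a b L 0)}
    (hT : ∀ i < 2 ^ m, ∀ 𝓞 ρ, (T i).run 𝓞 ρ = (roundE (realA 𝓞) ev w)^[i] (withDB L) [] ρ)
    (A₀ : Circuit 𝒢 0 0 (Z ⊕ DBReg a b L 0) (RB ⊕ RC)) (B₀ : Circuit 𝒢 0 0 (RB ⊕ K) J)
    (C₀ : Circuit 𝒢 0 0 (RC ⊕ K) J) (wc : (K → Bool) → ℝ) (F : (K → Bool) → (J → Bool))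
    (v : I → Bool) :
    pirateL id A₀ B₀ C₀ wc F (C.run id (ketbra v)) =
      ((2 : ℝ) ^ m)⁻¹ * ∑ i ∈ Finset.range (2 ^ m), oavg fun 𝓞 =>
        pirateL 𝓞 ((T i).comp (A₀.lift a b)) (B₀.lift a b) (C₀.lift a b) wc F
          (cp.run 𝓞 (ketbra v)) := by
  rw [hC, map_smul, map_sum, smul_eq_mul]
  refine congrArg _ (Finset.sum_congr rfl fun i hi => ?_)
  have h1 : circE (lazyA []) cp (fun d₁ σ => (roundE (lazyA d₁) ev w)^[i] (withDB L) [] σ) []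
      (ketbra v) = oavg fun 𝓞 => (((T i).runL 𝓞).restrictScalars ℝ) (cp.run 𝓞 (ketbra v)) := by
    refine circE_iterate_roundE_lazy cp ev w i (κ := fun _ => withDB L) (κr := fun _ => withDB L)
      (T := fun 𝓞 => ((T i).runL 𝓞).restrictScalars ℝ) (fun _ _ _ => (oavg_const _).symm)
      (fun 𝓞 σ => ?_) (ketbra v)
    rw [← hT i (Finset.mem_range.1 hi), LinearMap.restrictScalars_apply, Circuit.runL_apply]
  rw [h1, map_oavg]
  refine congrArg _ (funext fun 𝓞 => ?_)
  rw [LinearMap.restrictScalars_apply, Circuit.runL_apply]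
  exact (pirateL_lift 𝓞 A₀ B₀ C₀ wc F (T i) (cp.run 𝓞 (ketbra v))).symm

end values

theorem oracleAvg_zero (g : Oracle 0 0 → ℝ) : oracleAvg g = g id := by
  have : g = fun _ => g id := funext fun 𝓞 => congrArg g (Subsingleton.elim _ _)
  rw [this, oracleAvg_eq_oavg, oavg_const]

theorem sum_toReal {ι : Type} [Fintype ι] (p : PMF ι) : ∑ x, (p x).toReal = 1 := by
  rw [← ENNReal.toReal_sum fun x _ => p.apply_ne_top x, ← tsum_fintype (L := .unconditional ι),
    p.tsum_coe, ENNReal.toReal_one]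

/-! ### The experiments of the original scheme as oracle averages -/

namespace Scheme

variable {𝒢 : Set (Matrix.unitaryGroup Bool ℂ)} {F : FunctionClass} {a b : ℕ → ℕ}

theorem stateAfter_eq (S : Scheme 𝒢 F a b) {n : ℕ} (D : PMF (BitStr (F.inLen n)))
    (f : F.Member n) (𝓞 : Oracle (a n) (b n)) (k : ℕ) :
    S.stateAfter D f 𝓞 k = (roundL 𝓞 (S.eval n) fun x => (D x).toReal)^[k]
      ((S.cp n).run 𝓞 (ketbra (F.desc n f))) := by
  induction k with
  | zero => rfl
  | succ k ih => rw [Function.iterate_succ_apply', ← ih, roundL_apply, stateAfter]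

/-- The true experiment is rewritten with lazy sampling and the records of `CP` as background, the
form in which the effect of erasing them can be measured. -/
theorem successProb_eq (S : Scheme 𝒢 F a b) {n : ℕ} (D : PMF (BitStr (F.inLen n)))
    (f : F.Member n) (k : ℕ) :
    S.successProb D f k = circE (lazyA []) (S.cp n) (fun d₁ σ =>
      (roundE (lazyA d₁) (S.eval n) fun x => (D x).toReal)^[k]
        (evalE (lazyA d₁) (S.eval n) (fun x => (D x).toReal)
          fun x _ σ => outcomeProbRight σ (F.toFun n f x)) [] σ) [] (ketbra (F.desc n f)) := by
  have h := circE_iterate_roundE_evalE_lazy (S.cp n) (S.eval n) (fun x => (D x).toReal) k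
    (fun x => outcomeProbRightL (F.toFun n f x)) (ketbra (F.desc n f))
  refine Eq.trans ?_ h.symm
  rw [successProb, oracleAvg_eq_oavg]
  simp only [stateAfter_eq]
  rfl

theorem pirateProb_eq (S : Scheme 𝒢 F a b) (A : Adversary S) {n : ℕ} (DF : PMF (F.Member n))
    (DC : F.Member n → PMF (BitStr (F.inLen n))) :
    S.pirateProb A DF DC = oavg fun 𝓞 => ∑ f, (DF f).toReal *
      pirateL 𝓞 (A.alice n) (A.bob n) (A.charlie n) (fun x => (DC f x).toReal) (F.toFun n f)
        ((S.cp n).run 𝓞 (ketbra (F.desc n f))) := oracleAvg_eq_oavg _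

end Scheme

/-! ### The plain scheme -/

/-- Reusability gives a negligible error for one sequence of indices, and security a threshold for
one adversary. A sequence that is extremal at every `n` makes either apply to all indices below `k
n` at once. -/
theorem exists_uniform_argmin {ι : ℕ → Type} [∀ n, Fintype (ι n)] (k : ℕ → ℕ) (hk : ∀ n, 0 < k n)
    (g : ∀ n, ι n → ℕ → ℝ) :
    ∃ j : ℕ → ℕ, (∀ n, j n < k n) ∧ ∀ n, ∀ i < k n, ∀ f, ∃ f', g n f' (j n) ≤ g n f i := by
  have h : ∀ n, ∃ j < k n, ∀ i < k n, ∀ f, ∃ f', g n f' j ≤ g n f i := by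
    intro n
    rcases isEmpty_or_nonempty (ι n) with h | h
    · exact ⟨0, hk n, fun i _ f => h.elim f⟩
    · obtain ⟨p, hp, hmin⟩ := Finset.exists_min_image (Finset.range (k n) ×ˢ Finset.univ)
        (fun p : ℕ × ι n => g n p.2 p.1)
        ((Finset.nonempty_range_iff.2 (hk n).ne').product Finset.univ_nonempty)
      refine ⟨p.1, Finset.mem_range.1 (Finset.mem_product.1 hp).1, fun i hi f => ⟨p.2, ?_⟩⟩
      exact hmin (i, f) (Finset.mem_product.2 ⟨Finset.mem_range.2 hi, Finset.mem_univ _⟩)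
  choose j hj1 hj2 using h
  exact ⟨j, hj1, hj2⟩

theorem mainTheorem3 (𝒢 : Set (Matrix.unitaryGroup Bool ℂ)) (F : FunctionClass)
    (DF : ∀ n, PMF (F.Member n)) (DX : ∀ n, PMF (BitStr (F.inLen n)))
    (DC : ∀ n, F.Member n → PMF (BitStr (F.inLen n))) (δ : ℕ → ℝ)
    (hsamp : EfficientlySamplable 𝒢 DX)
    (a b : ℕ → ℕ) (S : Scheme 𝒢 F a b) (ν : ℕ → ℝ) (hν : Negligible ν)
    (hcorr : S.MeanCorrect DX fun n => 1 - ν n)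
    (hreuse : S.Reusable DX fun n => 1 - ν n)
    (hsec : S.Secure DF DC δ)
    (ε : ℕ → ℝ) (hε : Noticeable ε) :
    ∃ P : PlainScheme 𝒢 F,
      P.MeanCorrect DX (fun n => 1 - ε n) ∧ P.Secure DF DC δ := by
  obtain ⟨D, hDq, hD⟩ := hsamp
  obtain ⟨p, hp⟩ := hε
  -- With more than `2 * p.eval n` times the size of `CP` many rounds, erasing the background costs
  -- at most half of `1 / p.eval n` on average.
  choose m hm1 hm2 using fun n => exists_pow_two (2 * p.eval n * (S.cp n).size)
  have hcpq : PolyBounded fun n => (S.cp n).size := S.cp_qpt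
  have hevq : PolyBounded fun n => (S.eval n).size := S.eval_qpt
  have hDq' : PolyBounded fun n => (D n).size := hDq
  have hs : PolyBounded fun n => (S.cp n).size + (S.eval n).size + (D n).size :=
    (hcpq.add hevq).add hDq'
  have hk : PolyBounded fun n => 2 ^ m n :=
    (((polyBounded_const 2).mul (((polyBounded_const 2).mul (polyBounded_eval p)).mul hcpq)).add
      (polyBounded_const 2)).mono hm2
  have hplain := polyBounded_plainSize hs hk
  choose cp hcp1 hcp2 using fun n => exists_plain_cp (S.cp n) (S.eval n) (D n)
    (w := fun x => (DX n x).toReal) (hD n) le_rfl (m n) _ rfl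
  choose ev hev1 hev2 using fun n => exists_plain_eval (S.eval n)
    (s := (S.cp n).size + (S.eval n).size + (D n).size) (by omega) (m n) _ rfl
  have hT : ∀ n i, ∃ C : Circuit 𝒢 (a n) (b n) (S.Z n)
      (S.Z n ⊕ DBReg (a n) (b n) (2 ^ m n * (S.eval n).qcount) 0), i < 2 ^ m n →
      C.size ≤ plainSize ((S.cp n).size + (S.eval n).size + (D n).size) (2 ^ m n) ∧
      ∀ 𝓞 ρ, C.run 𝓞 ρ = (roundE (realA 𝓞) (S.eval n) fun x => (DX n x).toReal)^[i]
        (withDB (2 ^ m n * (S.eval n).qcount)) [] ρ := by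
    intro n i
    by_cases hi : i < 2 ^ m n
    · obtain ⟨C, h1, h2⟩ := exists_real_rounds (S.eval n) (D n)
        (w := fun x => (DX n x).toReal) (hD n)
        (s := (S.cp n).size + (S.eval n).size + (D n).size) (by omega) (m n) _ rfl hi
      exact ⟨C, fun _ => ⟨h1, h2⟩⟩
    · exact ⟨Circuit.ofLoad Function.Embedding.inl, fun h => absurd h hi⟩
  choose T hT using hT
  refine ⟨{
    Z := fun n => S.Z n ⊕ DBReg (a n) (b n) (2 ^ m n * (S.eval n).qcount) 0
    fintypeZ := fun n => inferInstance
    decEqZ := fun n => inferInstance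
    cp := cp
    eval := ev
    cp_qpt := hplain.mono hcp1
    eval_qpt := hplain.mono hev1 }, ?_, ?_⟩
  · obtain ⟨j, hj1, hj2⟩ := exists_uniform_argmin (fun n => 2 ^ m n) (fun n => by positivity)
      fun n f i => S.successProb (DX n) f i
    obtain ⟨μ, hμ, hS⟩ := hreuse j (hk.mono fun n => (hj1 n).le)
    filter_upwards [hS, hp, (hν.add hμ).eventually_lt p] with n hn hpn hνμ f
    have h1 := plain_success rfl (hcp2 n) (hev2 n) (F.toFun n f) id (F.desc n f)
    have h2 := sum_circE_evalE_le (S.cp n) (S.eval n) (w := fun x => (DX n x).toReal)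
      (fun x => ENNReal.toReal_nonneg) (sum_toReal (DX n))
      (κ := fun x σ => outcomeProbRight σ (F.toFun n f x))
      (fun x σ h => outcomeProbRight_nonneg h _) (fun x σ h => outcomeProbRight_le_tr h _)
      (2 ^ m n) (psd_ketbra (F.desc n f))
    simp only [← Scheme.successProb_eq, tr_ketbra, Complex.one_re, mul_one] at h2
    -- The worst pair of index and function at `n` has index `j n`, so reusability along `j` bounds
    -- every pair.
    have h3 : ∀ i ∈ Finset.range (2 ^ m n), 1 - (ν n + μ n) ≤ S.successProb (DX n) f i := by
      intro i hi
      obtain ⟨f', hf'⟩ := hj2 n i (Finset.mem_range.1 hi) f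
      have := hn f'
      linarith
    have h4 := Finset.sum_le_sum h3
    rw [Finset.sum_const, Finset.card_range, nsmul_eq_mul] at h4
    rw [Scheme.successProb, oracleAvg_zero]
    refine le_trans ?_ h1.ge
    have hk0 : (0 : ℝ) < 2 ^ m n := by positivity
    rw [inv_mul_eq_div, le_div_iff₀ hk0]
    refine le_trans ?_ (sub_le_iff_le_add.2 (h4.trans h2))
    push_cast
    have hp0 : (0 : ℝ) < ((p.eval n : ℕ) : ℝ) := Nat.cast_pos.2 hpn.1
    have h5 : 2 * ((p.eval n : ℕ) : ℝ) * (S.cp n).size ≤ 2 ^ m n := by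
      exact_mod_cast (hm1 n).le
    -- The allowance `1 / p.eval n` is split evenly between the erased background and the negligible
    -- errors.
    have h6 : ((S.cp n).size : ℝ) ≤ 2 ^ m n * (1 / (2 * (p.eval n : ℕ))) := by
      rw [mul_one_div, le_div_iff₀ (by positivity)]
      linarith
    have h7 : ν n + μ n ≤ 1 / (2 * (p.eval n : ℕ)) := by
      rw [le_div_iff₀ (by positivity)]
      linarith
    have h8 : (1 : ℝ) / (2 * (p.eval n : ℕ)) + 1 / (2 * (p.eval n : ℕ)) = 1 / (p.eval n : ℕ) := by
      field_simp
      norm_num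
    have h9 := hpn.2
    nlinarith
  · intro A
    -- The sign turns the minimum into a maximum: `j n` is the index most favourable to the pirates.
    obtain ⟨j, hj1, hj2⟩ := exists_uniform_argmin (ι := fun _ => Unit) (fun n => 2 ^ m n)
      (fun n => by positivity) fun n _ i => -(oavg fun 𝓞 => ∑ f, (DF n f).toReal *
        pirateL 𝓞 ((T n i).comp ((A.alice n).lift (a n) (b n))) ((A.bob n).lift (a n) (b n))
          ((A.charlie n).lift (a n) (b n)) (fun x => (DC n f x).toReal) (F.toFun n f)
          ((S.cp n).run 𝓞 (ketbra (F.desc n f))))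
    have hA : PolyBounded fun n => (A.alice n).size := A.alice_qpt
    filter_upwards [hsec {
      RB := A.RB
      RC := A.RC
      fintypeRB := A.fintypeRB
      fintypeRC := A.fintypeRC
      -- Before the plain attack, this pirate makes a plain program out of the original one by `j n`
      -- rounds with real queries. The other two never query the oracle.
      alice := fun n => (T n (j n)).comp ((A.alice n).lift (a n) (b n))
      bob := fun n => (A.bob n).lift (a n) (b n)
      charlie := fun n => (A.charlie n).lift (a n) (b n)
      alice_qpt := (hplain.add hA).mono fun n => (Circuit.size_comp_le _ _).trans
        (add_le_add (hT n (j n) (hj1 n)).1 (Circuit.size_lift_le _))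
      bob_qpt := A.bob_qpt.mono fun n => Circuit.size_lift_le _
      charlie_qpt := A.charlie_qpt.mono fun n => Circuit.size_lift_le _ }] with n hn
    refine le_trans ?_ hn
    rw [Scheme.pirateProb_eq, Scheme.pirateProb_eq, ← oracleAvg_eq_oavg, oracleAvg_zero]
    have hk0 : (0 : ℝ) < 2 ^ m n := by positivity
    have h1 : ∀ f, pirateL id (A.alice n) (A.bob n) (A.charlie n) (fun x => (DC n f x).toReal)
        (F.toFun n f) ((cp n).run id (ketbra (F.desc n f))) = _ := fun f =>
      plain_pirate (hcp2 n) (fun i hi => (hT n i hi).2) (A.alice n) (A.bob n) (A.charlie n)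
        (fun x => (DC n f x).toReal) (F.toFun n f) (F.desc n f)
    dsimp only
    simp only [h1, mul_left_comm _ ((2 : ℝ) ^ m n)⁻¹]
    rw [← Finset.mul_sum, inv_mul_eq_div, div_le_iff₀ hk0]
    simp only [Finset.mul_sum]
    rw [Finset.sum_comm]
    -- The mean over all indices is at most the value at the best one, where the security of the
    -- original scheme applies.
    have h2 : ∀ i ∈ Finset.range (2 ^ m n), _ ≤ _ := fun i hi => by
      obtain ⟨-, h⟩ := hj2 n i (Finset.mem_range.1 hi) ()
      exact neg_le_neg_iff.1 h
    refine (Finset.sum_le_sum fun i hi => ?_).trans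
      ((Finset.sum_le_sum h2).trans_eq ?_)
    · refine le_of_eq ?_
      simp only [← smul_eq_mul, oavg_smul]
      rw [oavg_sum]
    · rw [Finset.sum_const, Finset.card_range, nsmul_eq_mul, mul_comm]
      push_cast
      rfl
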